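/- There is an absolute constant $c>0$ such that, for all $\tau\in(0,1)$, $q_0,q_1,q_2,q_3\ge 0$ and $M$, there are $C_0=C_0(\tau,q_0,\dots,q_3,M)>0$ and $n_0=n_0(\tau,q_0,\dots,q_3,M)$ such that, with $C_1:=c\,C_0$, the following holds for all $n\ge n_0$ ($n\geq 1$), $p$, $d$. Put $\mathbf q:=\max\{3q_1,q_1+q_2,q_3\}$, $\bar{\mathbf q}_0:=2\lceil q_0\mathbf q/2\rceil$, $q^*:=2^{(\bar{\mathbf q}_0+4)/2}$, $\log_+x:=\max\{1,\log x\}$. Assume: (1) $\tau\le p/n\le 1/\tau$. (2) $\ell_1,\dots,\ell_n:\mathbb R\to\mathbb R$ are continuous (for instance convex), $R:\mathbb R^p\to\mathbb R$ is a function, and there are $\bar\rho\in(0,1]$, $L_{\ell_i}\ge 1$ and functions $\mathcal D_\ell,\mathcal M_\ell:(0,\bar\rho)\to\mathbb R_{\ge0}$ with $\mathcal M_\ell\le 1\le\mathcal D_\ell$ such that $|\ell_i(x)|\le L_{\ell_i}(1+|x|^{q_0})$ for all $i,x$, and such that for every $\rho\in(0,\bar\rho)$ and $i$ there is $\ell_{i;\rho}\in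 C^3(\mathbb R)$, $\ell_{i;\rho}\ge0$, with $\|\ell_{i;\rho}-\ell_i\|_\infty\le\mathcal M_\ell(\rho)$ and $|\ell_{i;\rho}^{(k)}(x)|\le\mathcal D_\ell(\rho)\,(1+|\ell_{i;\rho}(x)|^{q_k})$ for all $x$ and $k=1,2,3$. (3) $X_1,\dots,X_n$ are i.i.d. random vectors in $\mathbb R^p$ with $E[X_i]=0$, $E[X_iX_i^\top]=\Sigma/n$, $\Sigma$ positive definite, $\lambda_{\max}(\Sigma)\le M$, and $(E|\sqrt n\,X_{i,j}|^{q^*})^{1/q^*}\le M$ for all $i,j$. (4) The distribution of $X_i$ is $d$-block dependent: $\{1,\dots,p\}$ has a partition into $k\le p$ cells $B_1,\dots,B_k$ with $|B_a|\le d$ such that the subvectors $(X_{i,j})_{j\in B_1},\dots,(X_{i,j})_{j\in B_k}$ are independent. Let $G_1,\dots,G_n$ be i.i.d. $N(0,\Sigma/n)$, and for $Z\in\{X,G\}$ let $H(w,Z):=\frac1n\sum_{i=1}^n\ell_i(Z_i^\top w)+R(w)$. For $L,\delta>0$ put $\mathcal M_R(L,\delta):=\sup\{|R(w)-R(w')|: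 w,w'\in[-L,L]^p,\ \|w-w'\|_\infty\le\delta\}\in[0,\infty]$, and put $$\sigma_n:=\frac{p\,d^{3+\bar{\mathbf q}_0/2}}{n^{5/2}}+\frac{p\,d^2}{n^{3/2}}+\frac{p\,d^{\bar{\mathbf q}_0+2}}{n^{(\bar{\mathbf q}_0+3)/2}},\qquad \omega_n:=n^{-(q_0q_1+3)/2}\sigma_n,\qquad Av:=\frac1n\sum_{i=1}^nL_{\ell_i}^{\mathbf q},$$ $$r_R(L):=\inf_{\rho\in(0,\bar\rho)}\Big\{\mathcal M_\ell(\rho)+\mathcal D_\ell(\rho)^3\inf_{\delta\in(0,\omega_n)}\Big[\mathcal M_R(L,\delta)+Av^{1/3}\,L^{(\bar{\mathbf q}_0+3)/3}\,\log_+^{2/3}(L/\delta)\,\sigma_n^{1/3}\Big]\Big\}.$$ Then for every $L_n\ge1$ and every nonempty $\mathcal S_n\subset[-L_n,L_n]^p$, where $\min$ denotes the infimum if it is not attained: (a) for every $g\in C^3(\mathbb R)$, with $K_g:=1+\max_{0\le k\le3}\|g^{(k)}\|_\infty\in[1,\infty]$, $$\Big|E\,g\Big(\min_{w\in\mathcal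 S_n}H(w,X)\Big)-E\,g\Big(\min_{w\in\mathcal S_n}H(w,G)\Big)\Big|\le C_0\,K_g\,r_R(L_n);$$ (b) for all $z\in\mathbb R$ and $\varepsilon>0$, $$\Pr\Big(\min_{w\in\mathcal S_n}H(w,X)>z+3\varepsilon\Big)\le\Pr\Big(\min_{w\in\mathcal S_n}H(w,G)>z+\varepsilon\Big)+C_1\max\{1,\varepsilon^{-3}\}\,r_R(L_n),$$ and the same inequality holds with $X$ and $G$ interchanged. -/

import Mathlib

open MeasureTheory ProbabilityTheory Set
open scoped ENNReal

/-- `d`-block dependence of a random vector `X` in `ℝ^p`: the coordinates can be partitioned into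
`k ≤ p` cells of size at most `d` such that the subvectors of `X` belonging to the different
cells are independent. -/
def BlockDependent {Ω : Type*} [MeasurableSpace Ω] {p : ℕ} (d : ℕ)
    (X : Ω → EuclideanSpace ℝ (Fin p)) (μ : Measure Ω) : Prop :=
  ∃ k : ℕ, k ≤ p ∧ ∃ B : Fin k → Finset (Fin p),
    Pairwise (fun a b => Disjoint (B a) (B b)) ∧
    (∀ j : Fin p, ∃ a, j ∈ B a) ∧
    (∀ a, (B a).card ≤ d) ∧
    iIndepFun (fun (a : Fin k) (ω : Ω) (j : B a) => X ω j) μ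

/-- The empirical risk `H(w, A) = (1/n) ∑ i, ℓ i (A i ⬝ w) + R w` of the design matrix with
rows `A i`. -/
noncomputable def empRisk {n p : ℕ} (ℓ : Fin n → ℝ → ℝ) (R : EuclideanSpace ℝ (Fin p) → ℝ)
    (w : EuclideanSpace ℝ (Fin p)) (A : Fin n → EuclideanSpace ℝ (Fin p)) : ℝ :=
  (1 / (n : ℝ)) * ∑ i, ℓ i (∑ j, A i j * w j) + R w

/-- The minimized (infimal) empirical risk over `w ∈ S`. -/
noncomputable def minRisk {n p : ℕ} (ℓ : Fin n → ℝ → ℝ) (R : EuclideanSpace ℝ (Fin p) → ℝ)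
    (S : Set (EuclideanSpace ℝ (Fin p))) (A : Fin n → EuclideanSpace ℝ (Fin p)) : ℝ :=
  ⨅ w : S, empRisk ℓ R w A

/-- The cube `[-L, L]^p`. -/
def cube (p : ℕ) (L : ℝ) : Set (EuclideanSpace ℝ (Fin p)) :=
  {w | ∀ j, |w j| ≤ L}

/-- The exponent `𝐪 = max {3 q₁, q₁ + q₂, q₃}`. -/
noncomputable def bq (q : Fin 4 → ℝ) : ℝ := max (3 * q 1) (max (q 1 + q 2) (q 3))

/-- The even integer `2 ⌈q₀ 𝐪 / 2⌉`. -/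
noncomputable def bq0 (q : Fin 4 → ℝ) : ℕ := 2 * ⌈q 0 * bq q / 2⌉₊

/-- The moment order `q* = 2 ^ ((bq0 + 4) / 2)`; the exponent is an integer. -/
noncomputable def qStar (q : Fin 4 → ℝ) : ℕ := 2 ^ ((bq0 q + 4) / 2)

/-- The assumption on the losses: polynomial growth, and smooth nonnegative approximations
`ℓs ρ i` of `ℓ i` with self-bounding derivatives. Only the values of `Ml` and `Dl` on `(0, ρbar)`
matter. -/
structure LossAssumption {n : ℕ} (q : Fin 4 → ℝ) (ρbar : ℝ) (Lℓ : Fin n → ℝ)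
    (Dl Ml : ℝ → ℝ) (ℓ : Fin n → ℝ → ℝ) : Prop where
  q_nonneg : ∀ k, 0 ≤ q k
  ρbar_mem : ρbar ∈ Ioc (0 : ℝ) 1
  one_le_Lℓ : ∀ i, 1 ≤ Lℓ i
  Ml_mem : ∀ ρ ∈ Ioo 0 ρbar, Ml ρ ∈ Icc (0 : ℝ) 1
  one_le_Dl : ∀ ρ ∈ Ioo 0 ρbar, 1 ≤ Dl ρ
  growth : ∀ i x, |ℓ i x| / (1 + |x| ^ q 0) ≤ Lℓ i
  approx : ∃ ℓs : ℝ → Fin n → ℝ → ℝ, ∀ ρ ∈ Ioo 0 ρbar, ∀ i,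
    (∀ x, 0 ≤ ℓs ρ i x) ∧
    ContDiff ℝ 3 (ℓs ρ i) ∧
    (∀ x, |ℓs ρ i x - ℓ i x| ≤ Ml ρ) ∧
    (∀ k : Fin 4, k ≠ 0 → ∀ x,
      |iteratedDeriv k (ℓs ρ i) x| / (1 + |ℓs ρ i x| ^ q k) ≤ Dl ρ)

/-- The modulus of continuity of `R` on `[-L, L]^p` in the uniform norm, valued in `[0, ∞]`. -/
noncomputable def modR {p : ℕ} (R : EuclideanSpace ℝ (Fin p) → ℝ) (L δ : ℝ) : ℝ≥0∞ :=
  ⨆ (w ∈ cube p L) (w' ∈ cube p L) (_ : ∀ j, |w j - w' j| ≤ δ), ENNReal.ofReal |R w - R w'|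

/-- `log₊ x = max {1, log x}`. -/
noncomputable def logPlus (x : ℝ) : ℝ := max 1 (Real.log x)

/-- The quantity `σ_n`. -/
noncomputable def sigmaN (n p d : ℕ) (q : Fin 4 → ℝ) : ℝ :=
  (p : ℝ) * (d : ℝ) ^ (3 + (bq0 q : ℝ) / 2) / (n : ℝ) ^ (5 / 2 : ℝ)
    + (p : ℝ) * (d : ℝ) ^ 2 / (n : ℝ) ^ (3 / 2 : ℝ)
    + (p : ℝ) * (d : ℝ) ^ (bq0 q + 2) / (n : ℝ) ^ (((bq0 q : ℝ) + 3) / 2)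

/-- The quantity `ω_n`. -/
noncomputable def omegaN (n p d : ℕ) (q : Fin 4 → ℝ) : ℝ :=
  (n : ℝ) ^ (-(q 0 * q 1 + 3) / 2) * sigmaN n p d q

/-- The average `(1/n) ∑ i, (Lℓ i) ^ 𝐪`. -/
noncomputable def avL {n : ℕ} (q : Fin 4 → ℝ) (Lℓ : Fin n → ℝ) : ℝ :=
  (1 / (n : ℝ)) * ∑ i, Lℓ i ^ bq q

/-- The rate `r_R(L)`, valued in `[0, ∞]`. -/
noncomputable def rateR {n p : ℕ} (d : ℕ) (q : Fin 4 → ℝ) (ρbar : ℝ) (Lℓ : Fin n → ℝ)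
    (Dl Ml : ℝ → ℝ) (R : EuclideanSpace ℝ (Fin p) → ℝ) (L : ℝ) : ℝ≥0∞ :=
  ⨅ ρ ∈ Ioo 0 ρbar, (ENNReal.ofReal (Ml ρ) + ENNReal.ofReal (Dl ρ ^ 3) *
    ⨅ δ ∈ Ioo 0 (omegaN n p d q), (modR R L δ +
      ENNReal.ofReal (avL q Lℓ ^ (1 / 3 : ℝ) * L ^ (((bq0 q : ℝ) + 3) / 3)
        * logPlus (L / δ) ^ (2 / 3 : ℝ) * sigmaN n p d q ^ (1 / 3 : ℝ))))

/-- `K_g = 1 + max_{k = 0, …, 3} ‖g⁽ᵏ⁾‖_∞`, valued in `[0, ∞]`. -/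
noncomputable def Kg (g : ℝ → ℝ) : ℝ≥0∞ :=
  1 + ⨆ (k : Fin 4) (x : ℝ), ENNReal.ofReal |iteratedDeriv k g x|

/-!
The minimum over `S` is replaced by the soft minimum `-(n b)⁻¹ log ∑ exp (-n b H)` of the smoothed
risk over a finite net of mesh about `δ`; this costs `𝓜_ℓ(ρ) + 𝓜_R(L, δ)` and the entropy term
`p log₊ (L / δ) / (n b)`. The expectation of a smooth function of the soft minimum is compared by
a Lindeberg argument that replaces one *block* of one row at a time. A block enters only through
one loss, so in the third order remainder the derivatives of that loss appear averaged under a Gibbs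
measure that favours small values of the loss. Since these derivatives are bounded by increasing
functions of the loss, Chebyshev's association inequality shows that dropping the loss from the
Gibbs weight only increases the average; the remaining weight is independent of the row, so its
moments can be integrated separately, and no union bound over the net is needed. Summing the third
moments of the blocks gives `b² σ_n`, and optimizing over `b` gives `σ_n ^ (1 / 3)`.
-/

section WeightedAverage

variable {W : Type*} [Fintype W]

/-- The average of `a` with respect to the (unnormalized) weights `c`. -/
noncomputable def wavg (c a : W → ℝ) : ℝ := (∑ w, c w * a w) / ∑ w, c w

lemma wavg_mono {c a a' : W → ℝ} (hc : ∀ w, 0 < c w) (h : ∀ w, a w ≤ a' w) :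
    wavg c a ≤ wavg c a' :=
  div_le_div_of_nonneg_right
    (Finset.sum_le_sum fun w _ => mul_le_mul_of_nonneg_left (h w) (hc w).le)
    (Finset.sum_nonneg fun w _ => (hc w).le)

lemma wavg_const_mul (c a : W → ℝ) (k : ℝ) : wavg c (fun w => k * a w) = k * wavg c a := by
  simp only [wavg, mul_left_comm (c _), ← Finset.mul_sum, mul_div_assoc]

lemma abs_wavg_le {c a e : W → ℝ} (hc : ∀ w, 0 < c w) (h : ∀ w, |a w| ≤ e w) :
    |wavg c a| ≤ wavg c e := by
  refine abs_le.2 ⟨?_, wavg_mono hc fun w => (abs_le.1 (h w)).2⟩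
  calc -wavg c e = wavg c (fun w => -1 * e w) := by rw [wavg_const_mul, neg_one_mul]
    _ ≤ wavg c a := wavg_mono hc fun w => by linarith [(abs_le.1 (h w)).1]

/-- **Chebyshev's association inequality**, in cross-multiplied form. -/
lemma sum_mul_sum_le_of_monovary {c a e : W → ℝ} (hc : ∀ w, 0 ≤ c w) (h : Monovary a e) :
    (∑ w, c w * a w) * (∑ w, c w * e w) ≤ (∑ w, c w) * ∑ w, c w * (a w * e w) := by
  have key : 0 ≤ ∑ w, ∑ w', c w * c w' * ((a w' - a w) * (e w' - e w)) :=
    Finset.sum_nonneg fun w _ => Finset.sum_nonneg fun w' _ =>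
      mul_nonneg (mul_nonneg (hc w) (hc w')) (monovary_iff_forall_mul_nonneg.1 h w w')
  have expand : ∑ w, ∑ w', c w * c w' * ((a w' - a w) * (e w' - e w))
      = (∑ w, c w * (a w * e w)) * (∑ w, c w) + (∑ w, c w) * (∑ w, c w * (a w * e w))
        - (∑ w, c w * a w) * (∑ w, c w * e w) - (∑ w, c w * e w) * (∑ w, c w * a w) := by
    simp only [Finset.sum_mul_sum, ← Finset.sum_add_distrib, ← Finset.sum_sub_distrib]
    exact Finset.sum_congr rfl fun w _ => Finset.sum_congr rfl fun w' _ => by ring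
  linarith [mul_comm (∑ w, c w * (a w * e w)) (∑ w, c w),
    mul_comm (∑ w, c w * e w) (∑ w, c w * a w)]

variable [Nonempty W]

lemma sum_weights_pos {c : W → ℝ} (hc : ∀ w, 0 < c w) : 0 < ∑ w, c w :=
  Finset.sum_pos (fun w _ => hc w) Finset.univ_nonempty

lemma wavg_const_add {c : W → ℝ} (hc : ∀ w, 0 < c w) (a : W → ℝ) (k : ℝ) :
    wavg c (fun w => k + a w) = k + wavg c a := by
  have := (sum_weights_pos hc).ne'
  simp only [wavg, mul_add, Finset.sum_add_distrib, ← Finset.sum_mul]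
  field_simp

lemma wavg_mul_wavg_le {c a e : W → ℝ} (hc : ∀ w, 0 < c w) (h : Monovary a e) :
    wavg c a * wavg c e ≤ wavg c (a * e) := by
  have hpos := sum_weights_pos hc
  unfold wavg
  rw [div_mul_div_comm, div_le_div_iff₀ (mul_pos hpos hpos) hpos]
  have := mul_le_mul_of_nonneg_left (sum_mul_sum_le_of_monovary (fun w => (hc w).le) h) hpos.le
  simp only [Pi.mul_apply]
  linarith

lemma wavg_tilt_le {c a e : W → ℝ} (hc : ∀ w, 0 < c w) (he : ∀ w, 0 < e w) (h : Antivary a e) :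
    wavg (c * e) a ≤ wavg c a := by
  have key := sum_mul_sum_le_of_monovary (fun w => (hc w).le) h.neg_left
  simp only [Pi.neg_apply, mul_neg, neg_mul, Finset.sum_neg_distrib] at key
  have hce : 0 < ∑ w, c w * e w := sum_weights_pos fun w => mul_pos (hc w) (he w)
  simp only [wavg, Pi.mul_apply]
  rw [div_le_div_iff₀ hce (sum_weights_pos hc)]
  simp only [mul_assoc, mul_comm (e _)]
  linarith

lemma abs_wavg_mul_wavg_le {c a a' e e' : W → ℝ} (hc : ∀ w, 0 < c w) (h : ∀ w, |a w| ≤ e w)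
    (h' : ∀ w, |a' w| ≤ e' w) (hmono : Monovary e e') :
    |wavg c a * wavg c a'| ≤ wavg c (e * e') := by
  rw [abs_mul]
  exact (mul_le_mul (abs_wavg_le hc h) (abs_wavg_le hc h') (abs_nonneg _)
    ((abs_nonneg _).trans (abs_wavg_le hc h))).trans (wavg_mul_wavg_le hc hmono)

end WeightedAverage

section Cumulants

variable {W : Type*}

/-- The second derivative of `-b⁻¹ log ∑ w, c w * exp (-b * F w t)`, where `m` is the tilted weight
and `a₁, a₂` are the first two derivatives of `F`. -/
noncomputable def secondCumulant [Fintype W] (b : ℝ) (m a₁ a₂ : W → ℝ) : ℝ :=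
  wavg m a₂ - b * (wavg m (a₁ * a₁) - wavg m a₁ * wavg m a₁)

/-- The third derivative of `-b⁻¹ log ∑ w, c w * exp (-b * F w t)`, where `m` is the tilted weight
and `a₁, a₂, a₃` are the first three derivatives of `F`. -/
noncomputable def thirdCumulant [Fintype W] (b : ℝ) (m a₁ a₂ a₃ : W → ℝ) : ℝ :=
  wavg m a₃ - 3 * b * wavg m (a₂ * a₁) + 3 * b * (wavg m a₁ * wavg m a₂)
    + b ^ 2 * wavg m (a₁ * a₁ * a₁) - 3 * b ^ 2 * (wavg m (a₁ * a₁) * wavg m a₁)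
    + 2 * b ^ 2 * wavg m a₁ ^ 3

/-- Comonotone majorants `e₁, e₂` of `a₁, a₂` and a common majorant `ψ` of `a₃` and of the products
of total order three; this is what bounds the cumulants up to order three by the average of `ψ`. -/
structure CumulantMajorant (a₁ a₂ a₃ e₁ e₂ ψ : W → ℝ) : Prop where
  le₁ : ∀ w, |a₁ w| ≤ e₁ w
  le₂ : ∀ w, |a₂ w| ≤ e₂ w
  le₃ : ∀ w, |a₃ w| ≤ ψ w
  mono : Monovary e₁ e₂
  mul_le : ∀ w, e₁ w * e₂ w ≤ ψ w
  cube_le : ∀ w, e₁ w ^ 3 ≤ ψ w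

namespace CumulantMajorant

variable {a₁ a₂ a₃ e₁ e₂ ψ : W → ℝ} (h : CumulantMajorant a₁ a₂ a₃ e₁ e₂ ψ)

include h

lemma nonneg (w : W) : 0 ≤ e₁ w := (abs_nonneg _).trans (h.le₁ w)

lemma abs_sq_le (w : W) : |(a₁ * a₁) w| ≤ (e₁ * e₁) w := by
  rw [Pi.mul_apply, abs_mul]
  exact mul_le_mul (h.le₁ w) (h.le₁ w) (abs_nonneg _) (h.nonneg w)

variable [Fintype W] {m : W → ℝ} (hm : ∀ w, 0 < m w)

include hm

lemma abs_wavg_mul_le : |wavg m (a₂ * a₁)| ≤ wavg m ψ :=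
  abs_wavg_le hm fun w => by
    rw [Pi.mul_apply, abs_mul, mul_comm]
    exact (mul_le_mul (h.le₁ w) (h.le₂ w) (abs_nonneg _) (h.nonneg w)).trans (h.mul_le w)

lemma abs_wavg_cube_le : |wavg m (a₁ * a₁ * a₁)| ≤ wavg m ψ :=
  abs_wavg_le hm fun w => by
    rw [Pi.mul_apply, Pi.mul_apply, ← pow_two, ← pow_succ, abs_pow]
    exact (pow_le_pow_left₀ (abs_nonneg _) (h.le₁ w) 3).trans (h.cube_le w)

variable [Nonempty W]

lemma abs_mul_wavg_le : |wavg m a₁ * wavg m a₂| ≤ wavg m ψ :=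
  (abs_wavg_mul_wavg_le hm h.le₁ h.le₂ h.mono).trans (wavg_mono hm h.mul_le)

lemma wavg_mul_le : wavg m (e₁ * e₁) * wavg m e₁ ≤ wavg m ψ :=
  (wavg_mul_wavg_le hm ((monovary_self e₁).mul_left₀ h.nonneg h.nonneg (monovary_self e₁))).trans
    (wavg_mono hm fun w => by simpa [pow_succ] using h.cube_le w)

lemma abs_wavg_sq_mul_wavg_le : |wavg m (a₁ * a₁) * wavg m a₁| ≤ wavg m ψ := by
  refine le_trans ?_ (h.wavg_mul_le hm)
  rw [abs_mul]
  exact mul_le_mul (abs_wavg_le hm h.abs_sq_le) (abs_wavg_le hm h.le₁) (abs_nonneg _)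
    ((abs_nonneg _).trans (abs_wavg_le hm h.abs_sq_le))

lemma abs_wavg_pow_le : |wavg m a₁ ^ 3| ≤ wavg m ψ := by
  have hsq : |wavg m a₁ ^ 2| ≤ wavg m (e₁ * e₁) := by
    rw [pow_two]
    exact abs_wavg_mul_wavg_le hm h.le₁ h.le₁ (monovary_self e₁)
  refine le_trans ?_ (h.wavg_mul_le hm)
  rw [pow_succ, abs_mul]
  exact mul_le_mul hsq (abs_wavg_le hm h.le₁) (abs_nonneg _) ((abs_nonneg _).trans hsq)

lemma abs_mul_secondCumulant_le {b : ℝ} (hb : 1 ≤ b) :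
    |wavg m a₁ * secondCumulant b m a₁ a₂| ≤ 3 * b * wavg m ψ := by
  have expand : wavg m a₁ * secondCumulant b m a₁ a₂ = wavg m a₁ * wavg m a₂
      - b * (wavg m (a₁ * a₁) * wavg m a₁) + b * wavg m a₁ ^ 3 := by
    rw [secondCumulant]
    ring
  have h₁₂ := abs_le.1 ((h.abs_mul_wavg_le hm).trans
    (le_mul_of_one_le_left ((abs_nonneg _).trans (h.abs_mul_wavg_le hm)) hb))
  have h₁₁ := abs_le.1 (h.abs_wavg_sq_mul_wavg_le hm)
  have h₁ := abs_le.1 (h.abs_wavg_pow_le hm)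
  rw [expand, abs_le]
  constructor <;> nlinarith

lemma abs_thirdCumulant_le {b : ℝ} (hb : 1 ≤ b) :
    |thirdCumulant b m a₁ a₂ a₃| ≤ 13 * b ^ 2 * wavg m ψ := by
  have scaled : ∀ {k x : ℝ}, |k| ≤ b ^ 2 → |x| ≤ wavg m ψ → |k * x| ≤ b ^ 2 * wavg m ψ :=
    fun hk hx => by
      rw [abs_mul]
      exact mul_le_mul hk hx (abs_nonneg _) (sq_nonneg b)
  have h1 : |(1 : ℝ)| ≤ b ^ 2 := by rw [abs_one]; nlinarith
  have hb1 : |b| ≤ b ^ 2 := by rw [abs_of_pos (by linarith)]; nlinarith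
  have hb2 : |b ^ 2| ≤ b ^ 2 := (abs_sq b).le
  have t₁ := abs_le.1 (scaled h1 (abs_wavg_le hm h.le₃))
  have t₂ := abs_le.1 (scaled hb1 (h.abs_wavg_mul_le hm))
  have t₃ := abs_le.1 (scaled hb1 (h.abs_mul_wavg_le hm))
  have t₄ := abs_le.1 (scaled hb2 (h.abs_wavg_cube_le hm))
  have t₅ := abs_le.1 (scaled hb2 (h.abs_wavg_sq_mul_wavg_le hm))
  have t₆ := abs_le.1 (scaled hb2 (h.abs_wavg_pow_le hm))
  rw [thirdCumulant, abs_le]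
  constructor <;> linarith

end CumulantMajorant

end Cumulants

section Gibbs

variable {W : Type*}

/-- The Gibbs weights of the energies `F w t` at inverse temperature `b`, with base weights `c`. -/
noncomputable def gibbsWeight (b : ℝ) (c : W → ℝ) (F : W → ℝ → ℝ) (t : ℝ) : W → ℝ :=
  fun w => c w * Real.exp (-b * F w t)

variable {b : ℝ} {c : W → ℝ} {F F₁ F₂ F₃ : W → ℝ → ℝ} {t : ℝ}

lemma gibbsWeight_pos (hc : ∀ w, 0 < c w) (b : ℝ) (F : W → ℝ → ℝ) (t : ℝ) (w : W) :
    0 < gibbsWeight b c F t w :=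
  mul_pos (hc w) (Real.exp_pos _)

lemma hasDerivAt_gibbsWeight {w : W} {f' : ℝ} (hF : HasDerivAt (F w) f' t) :
    HasDerivAt (fun t => gibbsWeight b c F t w) (-b * (gibbsWeight b c F t w * f')) t :=
  ((hF.const_mul (-b)).exp.const_mul (c w)).congr_deriv (by simp only [gibbsWeight]; ring)

variable [Fintype W]

/-- The Gibbs average of the observables `A w` at time `t`. -/
noncomputable def gibbsAvg (b : ℝ) (c : W → ℝ) (F A : W → ℝ → ℝ) (t : ℝ) : ℝ :=
  wavg (gibbsWeight b c F t) (A · t)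

variable [Nonempty W]

lemma hasDerivAt_gibbsAvg (hc : ∀ w, 0 < c w) {A A₁ : W → ℝ → ℝ}
    (hF : ∀ w, HasDerivAt (F w) (F₁ w t) t) (hA : ∀ w, HasDerivAt (A w) (A₁ w t) t) :
    HasDerivAt (gibbsAvg b c F A)
      (gibbsAvg b c F A₁ t
        - b * (gibbsAvg b c F (A * F₁) t - gibbsAvg b c F A t * gibbsAvg b c F F₁ t)) t := by
  have hnum := HasDerivAt.fun_sum (u := Finset.univ) fun w _ =>
    (hasDerivAt_gibbsWeight (b := b) (c := c) (hF w)).fun_mul (hA w)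
  have hden := HasDerivAt.fun_sum (u := Finset.univ) fun w _ =>
    hasDerivAt_gibbsWeight (b := b) (c := c) (hF w)
  have hpos := sum_weights_pos (gibbsWeight_pos hc b F t)
  refine (hnum.fun_div hden hpos.ne').congr_deriv ?_
  have split : ∑ w, (-b * (gibbsWeight b c F t w * F₁ w t) * A w t
        + gibbsWeight b c F t w * A₁ w t)
      = -b * (∑ w, gibbsWeight b c F t w * (A w t * F₁ w t))
        + ∑ w, gibbsWeight b c F t w * A₁ w t := by
    rw [Finset.mul_sum, ← Finset.sum_add_distrib]
    exact Finset.sum_congr rfl fun w _ => by ring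
  rw [split, ← Finset.mul_sum]
  simp only [gibbsAvg, wavg, Pi.mul_apply]
  field_simp
  ring

lemma hasDerivAt_log_sum_gibbsWeight (hc : ∀ w, 0 < c w)
    (hF : ∀ w, HasDerivAt (F w) (F₁ w t) t) :
    HasDerivAt (fun t => Real.log (∑ w, gibbsWeight b c F t w)) (-b * gibbsAvg b c F F₁ t) t := by
  have hsum := HasDerivAt.fun_sum (u := Finset.univ) fun w _ =>
    hasDerivAt_gibbsWeight (b := b) (c := c) (hF w)
  refine (hsum.log (sum_weights_pos (gibbsWeight_pos hc b F t)).ne').congr_deriv ?_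
  rw [← Finset.mul_sum, mul_div_assoc, gibbsAvg, wavg]

lemma hasDerivAt_secondCumulant (hc : ∀ w, 0 < c w)
    (dF : ∀ w t, HasDerivAt (F w) (F₁ w t) t) (dF₁ : ∀ w t, HasDerivAt (F₁ w) (F₂ w t) t)
    (dF₂ : ∀ w t, HasDerivAt (F₂ w) (F₃ w t) t) (t : ℝ) :
    HasDerivAt (fun t => secondCumulant b (gibbsWeight b c F t) (F₁ · t) (F₂ · t))
      (thirdCumulant b (gibbsWeight b c F t) (F₁ · t) (F₂ · t) (F₃ · t)) t := by
  have d₁ := hasDerivAt_gibbsAvg (b := b) hc (dF · t) (dF₁ · t)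
  have d₂ := hasDerivAt_gibbsAvg (b := b) hc (dF · t) (dF₂ · t)
  have d₁₁ := hasDerivAt_gibbsAvg (b := b) hc (A := F₁ * F₁) (A₁ := fun w t => 2 * (F₂ * F₁) w t)
    (dF · t) fun w => ((dF₁ w t).fun_mul (dF₁ w t)).congr_deriv (by simp only [Pi.mul_apply]; ring)
  refine (d₂.sub ((d₁₁.sub (d₁.mul d₁)).const_mul b)).congr_deriv ?_
  have htwo : gibbsAvg b c F (fun w t => 2 * (F₂ * F₁) w t) t = 2 * gibbsAvg b c F (F₂ * F₁) t :=
    wavg_const_mul _ _ 2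
  have fold : ∀ A, wavg (gibbsWeight b c F t) (A · t) = gibbsAvg b c F A t := fun _ => rfl
  have fold₁₁ := fold (F₁ * F₁)
  have fold₂₁ := fold (F₂ * F₁)
  have fold₁₁₁ := fold (F₁ * F₁ * F₁)
  simp only [Pi.mul_def] at fold₁₁ fold₂₁ fold₁₁₁ htwo ⊢
  simp only [thirdCumulant, Pi.mul_def, fold, fold₁₁, fold₂₁, fold₁₁₁, htwo]
  ring

end Gibbs

section Taylor

lemma abs_sub_le_of_deriv_bound {f f' : ℝ → ℝ} (hf : ∀ t, HasDerivAt f (f' t) t) {K : ℝ}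
    (hK : ∀ t ∈ Icc (0 : ℝ) 1, |f' t| ≤ K) {t : ℝ} (ht : t ∈ Icc (0 : ℝ) 1) :
    |f t - f 0| ≤ K := by
  have h := (convex_Icc (0 : ℝ) 1).norm_image_sub_le_of_norm_hasDerivWithin_le
    (fun s _ => (hf s).hasDerivWithinAt) (fun s hs => by simpa using hK s hs)
    (left_mem_Icc.2 zero_le_one) ht
  have hK0 : 0 ≤ K := (abs_nonneg _).trans (hK t ht)
  simp only [Real.norm_eq_abs, sub_zero, abs_of_nonneg ht.1] at h
  nlinarith [ht.2]

lemma abs_taylor_two_le {f f₁ f₂ f₃ : ℝ → ℝ} (h₁ : ∀ t, HasDerivAt f (f₁ t) t)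
    (h₂ : ∀ t, HasDerivAt f₁ (f₂ t) t) (h₃ : ∀ t, HasDerivAt f₂ (f₃ t) t) {K : ℝ}
    (hK : ∀ t ∈ Icc (0 : ℝ) 1, |f₃ t| ≤ K) :
    |f 1 - (f 0 + f₁ 0 + f₂ 0 / 2)| ≤ K := by
  have order₂ : ∀ t ∈ Icc (0 : ℝ) 1, |f₂ t - f₂ 0| ≤ K := fun t ht =>
    abs_sub_le_of_deriv_bound h₃ hK ht
  have order₁ : ∀ t ∈ Icc (0 : ℝ) 1, |f₁ t - f₁ 0 - f₂ 0 * t| ≤ K := fun t ht => by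
    have := abs_sub_le_of_deriv_bound (f := fun t => f₁ t - f₂ 0 * t) (f' := fun t => f₂ t - f₂ 0)
      (fun t => ((h₂ t).fun_sub ((hasDerivAt_id' t).const_mul (f₂ 0))).congr_deriv (by ring))
      order₂ ht
    simp only [mul_zero, sub_zero] at this
    convert this using 2
    ring
  have order₀ := abs_sub_le_of_deriv_bound (f := fun t => f t - f₁ 0 * t - f₂ 0 * (t ^ 2 / 2))
    (f' := fun t => f₁ t - f₁ 0 - f₂ 0 * t)
    (fun t => (((h₁ t).fun_sub ((hasDerivAt_id' t).const_mul (f₁ 0))).fun_sub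
        ((((hasDerivAt_id' t).fun_pow 2).div_const 2).const_mul (f₂ 0))).congr_deriv
          (by norm_num)) order₁ (right_mem_Icc.2 zero_le_one)
  convert order₀ using 2
  ring

lemma hasDerivAt_iteratedDeriv_of_contDiff {f : ℝ → ℝ} {n : WithTop ℕ∞} (hf : ContDiff ℝ n f)
    {k : ℕ} (hk : k < n) (x : ℝ) :
    HasDerivAt (iteratedDeriv k f) (iteratedDeriv (k + 1) f x) x := by
  rw [iteratedDeriv_succ]
  exact (hf.differentiable_iteratedDeriv k hk x).hasDerivAt

/-- A test function whose value and first three derivatives are bounded by `K`. -/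
structure BoundedDerivs (g : ℝ → ℝ) (K : ℝ) : Prop where
  contDiff : ContDiff ℝ 3 g
  bound : ∀ (k : Fin 4) (x : ℝ), |iteratedDeriv k g x| ≤ K

namespace BoundedDerivs

variable {g : ℝ → ℝ} {K : ℝ} (hg : BoundedDerivs g K)

include hg

lemma abs_le (x : ℝ) : |g x| ≤ K := by simpa using hg.bound 0 x

lemma nonneg : 0 ≤ K := (abs_nonneg _).trans (hg.abs_le 0)

lemma continuous : Continuous g := hg.contDiff.continuous

lemma hasDerivAt (x : ℝ) : HasDerivAt g (iteratedDeriv 1 g x) x := by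
  simpa using hasDerivAt_iteratedDeriv_of_contDiff hg.contDiff (k := 0) (by norm_num) x

lemma hasDerivAt₁ (x : ℝ) : HasDerivAt (iteratedDeriv 1 g) (iteratedDeriv 2 g x) x :=
  hasDerivAt_iteratedDeriv_of_contDiff hg.contDiff (by norm_num) x

lemma hasDerivAt₂ (x : ℝ) : HasDerivAt (iteratedDeriv 2 g) (iteratedDeriv 3 g x) x :=
  hasDerivAt_iteratedDeriv_of_contDiff hg.contDiff (by norm_num) x

lemma abs_sub_le (x y : ℝ) : |g x - g y| ≤ K * |x - y| := by
  simpa using convex_univ.norm_image_sub_le_of_norm_hasDerivWithin_le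
    (fun x _ => (hg.hasDerivAt x).hasDerivWithinAt) (fun x _ => hg.bound 1 x) (mem_univ y)
    (mem_univ x)

lemma abs_taylor_comp_le {φ φ₁ φ₂ φ₃ : ℝ → ℝ} (h₁ : ∀ t, HasDerivAt φ (φ₁ t) t)
    (h₂ : ∀ t, HasDerivAt φ₁ (φ₂ t) t) (h₃ : ∀ t, HasDerivAt φ₂ (φ₃ t) t) {B : ℝ}
    (hB : ∀ t ∈ Icc (0 : ℝ) 1, |φ₁ t ^ 3| + 3 * |φ₁ t * φ₂ t| + |φ₃ t| ≤ B) :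
    |g (φ 1) - (g (φ 0) + iteratedDeriv 1 g (φ 0) * φ₁ 0
      + (iteratedDeriv 2 g (φ 0) * φ₁ 0 ^ 2 + iteratedDeriv 1 g (φ 0) * φ₂ 0) / 2)| ≤ K * B := by
  have d₁ : ∀ t, HasDerivAt (fun t => g (φ t)) (iteratedDeriv 1 g (φ t) * φ₁ t) t := fun t =>
    (hg.hasDerivAt (φ t)).comp t (h₁ t)
  have d₂ : ∀ t, HasDerivAt (fun t => iteratedDeriv 1 g (φ t) * φ₁ t)
      (iteratedDeriv 2 g (φ t) * φ₁ t ^ 2 + iteratedDeriv 1 g (φ t) * φ₂ t) t := fun t =>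
    (((hg.hasDerivAt₁ (φ t)).comp t (h₁ t)).fun_mul (h₂ t)).congr_deriv (by
      simp only [Function.comp]; ring)
  have d₃ : ∀ t, HasDerivAt
      (fun t => iteratedDeriv 2 g (φ t) * φ₁ t ^ 2 + iteratedDeriv 1 g (φ t) * φ₂ t)
      (iteratedDeriv 3 g (φ t) * φ₁ t ^ 3 + 3 * (iteratedDeriv 2 g (φ t) * (φ₁ t * φ₂ t))
        + iteratedDeriv 1 g (φ t) * φ₃ t) t := fun t =>
    ((((hg.hasDerivAt₂ (φ t)).comp t (h₁ t)).fun_mul ((h₂ t).fun_pow 2)).fun_add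
      (((hg.hasDerivAt₁ (φ t)).comp t (h₁ t)).fun_mul (h₃ t))).congr_deriv (by
        simp only [Function.comp]; push_cast; ring)
  refine abs_taylor_two_le d₁ d₂ d₃ fun t ht => ?_
  have mul_bound : ∀ (k : Fin 4) (x : ℝ), |iteratedDeriv k g (φ t) * x| ≤ K * |x| := fun k x => by
    rw [abs_mul]
    exact mul_le_mul_of_nonneg_right (hg.bound k _) (abs_nonneg _)
  calc _ ≤ |iteratedDeriv 3 g (φ t) * φ₁ t ^ 3| + |3 * (iteratedDeriv 2 g (φ t) * (φ₁ t * φ₂ t))|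
        + |iteratedDeriv 1 g (φ t) * φ₃ t| := abs_add_three _ _ _
    _ ≤ K * |φ₁ t ^ 3| + 3 * (K * |φ₁ t * φ₂ t|) + K * |φ₃ t| := by
        rw [abs_mul 3, abs_of_pos (three_pos : (0 : ℝ) < 3)]
        gcongr
        exacts [mul_bound 3 _, mul_bound 2 _, mul_bound 1 _]
    _ ≤ K * B := by nlinarith [hB t ht, hg.nonneg]

end BoundedDerivs

end Taylor

section SoftminExpansion

/-- A nonnegative `C³` function whose `k`-th derivative, `k = 1, 2, 3`, is bounded by `D` times a
function `G k` of its value. The index set includes `0` only to match the indexing of the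
derivatives; `G 0` plays no role. -/
structure SelfBounded (f : ℝ → ℝ) (D : ℝ) (G : Fin 4 → ℝ → ℝ) : Prop where
  nonneg : ∀ x, 0 ≤ f x
  contDiff : ContDiff ℝ 3 f
  bound : ∀ k : Fin 4, k ≠ 0 → ∀ x, |iteratedDeriv k f x| ≤ D * G k (f x)

/-- The third order products of the weights `G 1, G 2, G 3` are dominated on `[0, ∞)` by an
increasing function `Ψ`. -/
structure DominatedWeights (G : Fin 4 → ℝ → ℝ) (Ψ : ℝ → ℝ) : Prop where
  mono₁ : MonotoneOn (G 1) (Ici 0)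
  mono₂ : MonotoneOn (G 2) (Ici 0)
  mono : MonotoneOn Ψ (Ici 0)
  nonneg₁ : ∀ u, 0 ≤ u → 0 ≤ G 1 u
  nonneg₂ : ∀ u, 0 ≤ u → 0 ≤ G 2 u
  cube_le : ∀ u, 0 ≤ u → G 1 u ^ 3 ≤ Ψ u
  mul_le : ∀ u, 0 ≤ u → G 1 u * G 2 u ≤ Ψ u
  le : ∀ u, 0 ≤ u → G 3 u ≤ Ψ u

variable {W : Type*}

/-- The `k`-th derivative of the path `t ↦ f (r w + t * y w)`. -/
noncomputable def linePath (f : ℝ → ℝ) (r y : W → ℝ) (k : ℕ) (w : W) (t : ℝ) : ℝ :=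
  iteratedDeriv k f (r w + t * y w) * y w ^ k

lemma linePath_zero (f : ℝ → ℝ) (r y : W → ℝ) (w : W) (t : ℝ) :
    linePath f r y 0 w t = f (r w + t * y w) := by
  simp [linePath]

lemma linePath_time_zero (f : ℝ → ℝ) (r y : W → ℝ) (k : ℕ) (w : W) :
    linePath f r y k w 0 = iteratedDeriv k f (r w) * y w ^ k := by
  simp [linePath]

lemma hasDerivAt_linePath {f : ℝ → ℝ} {n : WithTop ℕ∞} (hf : ContDiff ℝ n f) {k : ℕ} (hk : k < n)
    (r y : W → ℝ) (w : W) (t : ℝ) :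
    HasDerivAt (linePath f r y k w) (linePath f r y (k + 1) w t) t := by
  have hline : HasDerivAt (fun t => r w + t * y w) (y w) t := by
    simpa using ((hasDerivAt_id' t).mul_const (y w)).const_add (r w)
  refine (((hasDerivAt_iteratedDeriv_of_contDiff hf hk _).comp t hline).mul_const
    (y w ^ k)).congr_deriv ?_
  simp only [linePath]
  ring

lemma SelfBounded.cumulantMajorant_linePath {f Ψ : ℝ → ℝ} {D η : ℝ} {G : Fin 4 → ℝ → ℝ}
    (hf : SelfBounded f D G) (hG : DominatedWeights G Ψ) (hD : 1 ≤ D) {y : W → ℝ}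
    (hy : ∀ w, |y w| ≤ η) (r : W → ℝ) (t : ℝ) :
    CumulantMajorant (linePath f r y 1 · t) (linePath f r y 2 · t) (linePath f r y 3 · t)
      (fun w => D * η * G 1 (f (r w + t * y w))) (fun w => D * η ^ 2 * G 2 (f (r w + t * y w)))
      (fun w => D ^ 3 * η ^ 3 * Ψ (f (r w + t * y w))) := by
  have hη : ∀ _ : W, 0 ≤ η := fun w => (abs_nonneg _).trans (hy w)
  have hΨ : ∀ u, 0 ≤ u → 0 ≤ Ψ u := fun u hu =>
    (pow_nonneg (hG.nonneg₁ u hu) 3).trans (hG.cube_le u hu)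
  have path_le : ∀ (k : Fin 4), k ≠ 0 → ∀ w,
      |linePath f r y k w t| ≤ D * η ^ (k : ℕ) * G k (f (r w + t * y w)) := fun k hk w => by
    rw [linePath, abs_mul, abs_pow]
    calc _ ≤ (D * G k (f (r w + t * y w))) * η ^ (k : ℕ) := mul_le_mul (hf.bound k hk _)
          (pow_le_pow_left₀ (abs_nonneg _) (hy w) _) (by positivity)
          ((abs_nonneg _).trans (hf.bound k hk _))
      _ = _ := by ring
  refine ⟨fun w => by simpa using path_le 1 (by decide) w, path_le 2 (by decide), fun w => ?_,
    fun w w' h => ?_, fun w => ?_, fun w => ?_⟩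
  · refine (path_le 3 (by decide) w).trans ?_
    have := hη w
    calc _ ≤ D * η ^ 3 * Ψ (f (r w + t * y w)) :=
          mul_le_mul_of_nonneg_left (hG.le _ (hf.nonneg _)) (by positivity)
      _ ≤ D ^ 3 * η ^ 3 * Ψ (f (r w + t * y w)) := mul_le_mul_of_nonneg_right
          (mul_le_mul_of_nonneg_right (le_self_pow₀ hD three_ne_zero) (by positivity))
          (hΨ _ (hf.nonneg _))
  · have := hη w
    refine mul_le_mul_of_nonneg_left (hG.mono₁ (hf.nonneg _) (hf.nonneg _) ?_) (by positivity)
    by_contra! hlt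
    exact h.not_ge (mul_le_mul_of_nonneg_left (hG.mono₂ (hf.nonneg _) (hf.nonneg _) hlt.le)
      (by positivity))
  · have := hη w
    calc _ = D ^ 2 * η ^ 3 * (G 1 (f (r w + t * y w)) * G 2 (f (r w + t * y w))) := by ring
      _ ≤ D ^ 3 * η ^ 3 * Ψ (f (r w + t * y w)) :=
        mul_le_mul (mul_le_mul_of_nonneg_right (pow_le_pow_right₀ hD (by norm_num))
          (by positivity)) (hG.mul_le _ (hf.nonneg _))
          (mul_nonneg (hG.nonneg₁ _ (hf.nonneg _)) (hG.nonneg₂ _ (hf.nonneg _))) (by positivity)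
  · have := hη w
    rw [mul_pow, mul_pow]
    exact mul_le_mul_of_nonneg_left (hG.cube_le _ (hf.nonneg _)) (by positivity)

variable [Fintype W]

lemma exists_quadratic_coefficients (A B C D : ℝ) (u v : W → ℝ) :
    ∃ (α : W → ℝ) (γ : W → W → ℝ), ∀ y : W → ℝ,
      A + B * (∑ w, u w * y w) + C * (∑ w, u w * y w) ^ 2 + D * ∑ w, v w * y w ^ 2
        = A + ∑ w, α w * y w + ∑ w, ∑ w', γ w w' * (y w * y w') := by
  classical
  refine ⟨fun w => B * u w, fun w w' => C * (u w * u w') + if w = w' then D * v w else 0,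
    fun y => ?_⟩
  have sq : C * (∑ w, u w * y w) ^ 2 = ∑ w, ∑ w', C * (u w * u w') * (y w * y w') := by
    rw [pow_two, Finset.sum_mul_sum, Finset.mul_sum]
    refine Finset.sum_congr rfl fun w _ => ?_
    rw [Finset.mul_sum]
    exact Finset.sum_congr rfl fun w' _ => by ring
  rw [sq]
  simp only [add_mul, Finset.sum_add_distrib, ite_mul, zero_mul, Finset.sum_ite_eq,
    Finset.mem_univ, if_true, Finset.mul_sum, mul_assoc, pow_two, add_assoc]

lemma gibbsAvg_linePath_time_zero (b : ℝ) (c : W → ℝ) (f : ℝ → ℝ) (r y : W → ℝ) :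
    gibbsAvg b c (linePath f r y 0) (linePath f r y 1) 0
      = ∑ w, gibbsWeight b c (fun w _ => f (r w)) 0 w * iteratedDeriv 1 f (r w)
          / (∑ w, gibbsWeight b c (fun w _ => f (r w)) 0 w) * y w := by
  simp only [gibbsAvg, wavg, gibbsWeight, linePath_time_zero, iteratedDeriv_zero, pow_zero, mul_one,
    pow_one, Finset.sum_div]
  exact Finset.sum_congr rfl fun w _ => by ring

lemma secondCumulant_linePath_time_zero (b : ℝ) (c : W → ℝ) (f : ℝ → ℝ) (r y : W → ℝ) :
    secondCumulant b (gibbsWeight b c (linePath f r y 0) 0) (linePath f r y 1 · 0)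
        (linePath f r y 2 · 0)
      = b * gibbsAvg b c (linePath f r y 0) (linePath f r y 1) 0 ^ 2
        + ∑ w, gibbsWeight b c (fun w _ => f (r w)) 0 w
            * (iteratedDeriv 2 f (r w) - b * iteratedDeriv 1 f (r w) ^ 2)
            / (∑ w, gibbsWeight b c (fun w _ => f (r w)) 0 w) * y w ^ 2 := by
  have second : ∑ w, gibbsWeight b c (fun w _ => f (r w)) 0 w
        * (iteratedDeriv 2 f (r w) - b * iteratedDeriv 1 f (r w) ^ 2)
        / (∑ w, gibbsWeight b c (fun w _ => f (r w)) 0 w) * y w ^ 2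
      = wavg (gibbsWeight b c (linePath f r y 0) 0) (linePath f r y 2 · 0)
        - b * wavg (gibbsWeight b c (linePath f r y 0) 0)
            ((linePath f r y 1 · 0) * (linePath f r y 1 · 0)) := by
    simp only [wavg, gibbsWeight, linePath_time_zero, iteratedDeriv_zero, pow_zero, mul_one,
      Finset.sum_div, Pi.mul_apply, Finset.mul_sum, ← Finset.sum_sub_distrib]
    exact Finset.sum_congr rfl fun w _ => by ring
  rw [second, secondCumulant, gibbsAvg]
  ring

variable [Nonempty W] {b N : ℝ} {c : W → ℝ}

lemma wavg_gibbsWeight_le {Ψ : ℝ → ℝ} (hΨ : MonotoneOn Ψ (Ici 0)) (hc : ∀ w, 0 < c w)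
    (hb : 0 ≤ b) {F : W → ℝ → ℝ} {t : ℝ} (hF : ∀ w, 0 ≤ F w t) :
    wavg (gibbsWeight b c F t) (fun w => Ψ (F w t)) ≤ wavg c (fun w => Ψ (F w t)) := by
  refine wavg_tilt_le hc (fun w => Real.exp_pos (-b * F w t)) fun w w' h => ?_
  have hlt : F w' t ≤ F w t := by
    by_contra! hlt
    exact h.not_ge (Real.exp_le_exp.2 (by nlinarith))
  exact hΨ (hF w') (hF w) hlt

lemma BoundedDerivs.abs_taylor_softmin_le {g : ℝ → ℝ} {K : ℝ} (hg : BoundedDerivs g K)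
    (hN : 1 ≤ N) (hb : 1 ≤ b) (hc : ∀ w, 0 < c w) {F F₁ F₂ F₃ : W → ℝ → ℝ}
    (dF : ∀ w t, HasDerivAt (F w) (F₁ w t) t) (dF₁ : ∀ w t, HasDerivAt (F₁ w) (F₂ w t) t)
    (dF₂ : ∀ w t, HasDerivAt (F₂ w) (F₃ w t) t) {e₁ e₂ ψ : ℝ → W → ℝ}
    (hmaj : ∀ t, CumulantMajorant (F₁ · t) (F₂ · t) (F₃ · t) (e₁ t) (e₂ t) (ψ t)) {B : ℝ}
    (hB : ∀ t ∈ Icc (0 : ℝ) 1, wavg (gibbsWeight b c F t) (ψ t) ≤ B) {φ : ℝ → ℝ}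
    (hφ : ∀ t, φ t = -(1 / (N * b)) * Real.log (∑ w, gibbsWeight b c F t w)) :
    |g (φ 1) - (g (φ 0) + iteratedDeriv 1 g (φ 0) * (gibbsAvg b c F F₁ 0 / N)
      + (iteratedDeriv 2 g (φ 0) * (gibbsAvg b c F F₁ 0 / N) ^ 2 + iteratedDeriv 1 g (φ 0)
        * (secondCumulant b (gibbsWeight b c F 0) (F₁ · 0) (F₂ · 0) / N)) / 2)|
      ≤ K * (23 * b ^ 2 * B / N) := by
  have hN0 : 0 < N := by linarith
  refine hg.abs_taylor_comp_le (φ₁ := fun t => gibbsAvg b c F F₁ t / N)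
    (φ₂ := fun t => secondCumulant b (gibbsWeight b c F t) (F₁ · t) (F₂ · t) / N)
    (φ₃ := fun t => thirdCumulant b (gibbsWeight b c F t) (F₁ · t) (F₂ · t) (F₃ · t) / N)
    (fun t => ?_) (fun t => ?_)
    (fun t => (hasDerivAt_secondCumulant hc dF dF₁ dF₂ t).div_const N) fun t ht => ?_
  · have hb0 : b ≠ 0 := by linarith
    rw [funext hφ]
    refine ((hasDerivAt_log_sum_gibbsWeight hc (dF · t)).const_mul _).congr_deriv ?_
    field_simp
  · exact (hasDerivAt_gibbsAvg hc (dF · t) (dF₁ · t)).div_const N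
  have hm := gibbsWeight_pos hc b F t
  have h₁ := (hmaj t).abs_wavg_pow_le hm
  have h₂ := (hmaj t).abs_mul_secondCumulant_le hm hb
  have h₃ := (hmaj t).abs_thirdCumulant_le hm hb
  have hψ : 0 ≤ wavg (gibbsWeight b c F t) (ψ t) := (abs_nonneg _).trans h₁
  have hB0 : 0 ≤ B := hψ.trans (hB t ht)
  have hbb : b ≤ b ^ 2 := le_self_pow₀ hb two_ne_zero
  have t₁ : |(gibbsAvg b c F F₁ t / N) ^ 3| ≤ b ^ 2 * B / N := by
    rw [div_pow, abs_div, abs_of_pos (pow_pos hN0 3)]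
    exact div_le_div₀ (by positivity) ((h₁.trans (hB t ht)).trans
      (le_mul_of_one_le_left hB0 (one_le_pow₀ hb))) hN0 (le_self_pow₀ hN three_ne_zero)
  have t₂ : |gibbsAvg b c F F₁ t / N
      * (secondCumulant b (gibbsWeight b c F t) (F₁ · t) (F₂ · t) / N)| ≤ 3 * b ^ 2 * B / N := by
    rw [div_mul_div_comm, abs_div, abs_of_pos (mul_pos hN0 hN0)]
    exact div_le_div₀ (by positivity) (h₂.trans (mul_le_mul (by linarith) (hB t ht) hψ
      (by positivity))) hN0 (le_mul_of_one_le_left hN0.le hN)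
  have t₃ : |thirdCumulant b (gibbsWeight b c F t) (F₁ · t) (F₂ · t) (F₃ · t) / N|
      ≤ 13 * b ^ 2 * B / N := by
    rw [abs_div, abs_of_pos hN0]
    exact div_le_div_of_nonneg_right (h₃.trans (mul_le_mul_of_nonneg_left (hB t ht)
      (by positivity))) hN0.le
  calc _ ≤ b ^ 2 * B / N + 3 * (3 * b ^ 2 * B / N) + 13 * b ^ 2 * B / N := by gcongr
    _ = 23 * b ^ 2 * B / N := by ring

/-- By Chebyshev's association inequality the remainder involves only the base weights `c`, not the
Gibbs weights. -/
lemma exists_softmin_expansion {g f Ψ : ℝ → ℝ} {K D : ℝ} {G : Fin 4 → ℝ → ℝ}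
    (hg : BoundedDerivs g K) (hf : SelfBounded f D G) (hG : DominatedWeights G Ψ) (hD : 1 ≤ D)
    (hN : 1 ≤ N) (hb : 1 ≤ b) (hc : ∀ w, 0 < c w) (r : W → ℝ) :
    ∃ (Φ₀ : ℝ) (α : W → ℝ) (γ : W → W → ℝ), ∀ (y : W → ℝ) (η Ξ : ℝ), (∀ w, |y w| ≤ η) →
      (∀ t ∈ Icc (0 : ℝ) 1, wavg c (fun w => Ψ (f (r w + t * y w))) ≤ Ξ) →
      |g (-(1 / (N * b)) * Real.log (∑ w, c w * Real.exp (-b * f (r w + y w))))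
          - (Φ₀ + ∑ w, α w * y w + ∑ w, ∑ w', γ w w' * (y w * y w'))|
        ≤ 23 * K * b ^ 2 * (D ^ 3 * η ^ 3 * Ξ) / N := by
  set m := gibbsWeight b c (fun w _ => f (r w)) 0 with hm
  set φ₀ := -(1 / (N * b)) * Real.log (∑ w, m w) with hφ₀
  set g₁ := iteratedDeriv 1 g φ₀
  set g₂ := iteratedDeriv 2 g φ₀
  obtain ⟨α, γ, hαγ⟩ := exists_quadratic_coefficients (g φ₀) (g₁ / N)
    (g₂ / (2 * N ^ 2) + g₁ * b / (2 * N)) (g₁ / (2 * N))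
    (fun w => m w * iteratedDeriv 1 f (r w) / ∑ w, m w)
    (fun w => m w * (iteratedDeriv 2 f (r w) - b * iteratedDeriv 1 f (r w) ^ 2) / ∑ w, m w)
  refine ⟨g φ₀, α, γ, fun y η Ξ hy hΞ => ?_⟩
  have hη : 0 ≤ η := (abs_nonneg _).trans (hy (Classical.arbitrary W))
  have taylor := hg.abs_taylor_softmin_le hN hb hc (F₁ := linePath f r y 1)
    (hasDerivAt_linePath hf.contDiff (by norm_num) r y)
    (hasDerivAt_linePath hf.contDiff (by norm_num) r y)
    (hasDerivAt_linePath hf.contDiff (by norm_num) r y) (hf.cumulantMajorant_linePath hG hD hy r)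
    (B := D ^ 3 * η ^ 3 * Ξ) (fun t ht => by
      rw [wavg_const_mul]
      refine mul_le_mul_of_nonneg_left ?_ (by positivity)
      simp only [← linePath_zero f r y] at hΞ ⊢
      exact (wavg_gibbsWeight_le hG.mono hc (by linarith)
        fun w => (hf.nonneg _).trans_eq (linePath_zero f r y w t).symm).trans (hΞ t ht))
    (fun _ => rfl)
  have start : ∑ w, gibbsWeight b c (linePath f r y 0) 0 w = ∑ w, m w := by
    simp only [hm, gibbsWeight, linePath_zero, zero_mul, add_zero]
  simp only [start, ← hφ₀, secondCumulant_linePath_time_zero, gibbsAvg_linePath_time_zero,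
    ← hm] at taylor
  rw [← hαγ y]
  convert taylor using 2
  · congr 1
    · simp only [gibbsWeight, linePath_zero, one_mul]
    · ring
  · ring

end SoftminExpansion

section ProductMeasure

variable {ι : Type*} [Fintype ι] [DecidableEq ι] {E : ι → Type*} [∀ i, MeasurableSpace (E i)]

lemma map_update_prod_pi (m : ∀ i, Measure (E i)) [∀ i, IsProbabilityMeasure (m i)] (j : ι)
    (Q : Measure (E j)) [IsProbabilityMeasure Q] :
    ((Measure.pi m).prod Q).map (fun z => Function.update z.1 j z.2)
      = Measure.pi (Function.update m j Q) := by
  have : ∀ i, IsProbabilityMeasure (Function.update m j Q i) := fun i => by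
    rcases eq_or_ne i j with rfl | h
    · simpa
    · simpa [h] using inferInstanceAs (IsProbabilityMeasure (m i))
  refine (Measure.pi_eq fun s hs => ?_).symm
  have hpre : (fun z : (∀ i, E i) × E j => Function.update z.1 j z.2) ⁻¹' univ.pi s
      = univ.pi (Function.update s j univ) ×ˢ s j := by
    ext ⟨x, y⟩
    simp only [mem_preimage, mem_univ_pi, mem_prod]
    refine ⟨fun h => ⟨fun i => ?_, by simpa using h j⟩, fun h i => ?_⟩ <;>
      rcases eq_or_ne i j with rfl | hi
    · simp
    · simpa [hi] using h i
    · simpa using h.2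
    · simpa [hi] using h.1 i
  rw [Measure.map_apply measurable_update' (MeasurableSet.univ_pi hs), hpre, Measure.prod_prod,
    Measure.pi_pi, ← Finset.mul_prod_erase _ _ (Finset.mem_univ j),
    ← Finset.mul_prod_erase _ _ (Finset.mem_univ j), mul_comm]
  simp only [Function.update_self, measure_univ, one_mul]
  congr 1
  exact Finset.prod_congr rfl fun i hi => by simp [Finset.ne_of_mem_erase hi]

/-- The telescoping sum of Lindeberg's replacement method. -/
lemma abs_integral_pi_sub_le_sum (P Q : ∀ i, Measure (E i)) (F : (∀ i, E i) → ℝ) (ε : ι → ℝ)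
    (h : ∀ m : ∀ i, Measure (E i), (∀ i, m i = P i ∨ m i = Q i) → ∀ j,
      |∫ x, F x ∂(Measure.pi (Function.update m j (P j)))
        - ∫ x, F x ∂(Measure.pi (Function.update m j (Q j)))| ≤ ε j) :
    |∫ x, F x ∂(Measure.pi P) - ∫ x, F x ∂(Measure.pi Q)| ≤ ∑ j, ε j := by
  have key : ∀ s : Finset ι, |∫ x, F x ∂(Measure.pi P)
      - ∫ x, F x ∂(Measure.pi (s.piecewise Q P))| ≤ ∑ j ∈ s, ε j := by
    intro s
    induction s using Finset.induction_on with
    | empty => simp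
    | insert j s hj ih =>
      have hs := h (s.piecewise Q P)
        (fun i => s.piecewise_cases Q P (fun x => x = P i ∨ x = Q i) (.inr rfl) (.inl rfl)) j
      rw [← s.piecewise_eq_of_notMem Q P hj, Function.update_eq_self,
        ← Finset.piecewise_insert] at hs
      rw [Finset.sum_insert hj, add_comm]
      exact (abs_sub_le _ _ _).trans (add_le_add ih hs)
  simpa using key Finset.univ

omit [Fintype ι] [∀ i, MeasurableSpace (E i)] in
lemma comp_updateFinset_of_dependsOn {β : Type*} {A : Finset ι} {f : (∀ i, E i) → β}
    (hf : DependsOn f A) (x₀ : ∀ i, E i) :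
    (f ∘ Function.updateFinset x₀ A) ∘ (fun x (i : A) => x i) = f := by
  ext x
  exact hf fun i hi => by simp [Function.updateFinset, Finset.mem_coe.1 hi]

omit [DecidableEq ι] in
lemma indepFun_pi_of_dependsOn (m : ∀ i, Measure (E i)) [∀ i, IsProbabilityMeasure (m i)]
    {β γ : Type*} [MeasurableSpace β] [MeasurableSpace γ] {f : (∀ i, E i) → β}
    {h : (∀ i, E i) → γ} (hf : Measurable f) (hh : Measurable h) {S T : Finset ι}
    (hST : Disjoint S T) (hfS : DependsOn f S) (hhT : DependsOn h T) :
    IndepFun f h (Measure.pi m) := by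
  classical
  obtain ⟨x₀⟩ := nonempty_of_isProbabilityMeasure (Measure.pi m)
  have coords : iIndepFun (fun i (x : ∀ i, E i) => x i) (Measure.pi m) :=
    iIndepFun_pi (X := fun i (y : E i) => y) fun i => aemeasurable_id
  have := (coords.indepFun_finset S T hST (fun i => measurable_pi_apply i)).comp
    (hf.comp (measurable_updateFinset (x := x₀))) (hh.comp (measurable_updateFinset (x := x₀)))
  rwa [comp_updateFinset_of_dependsOn hfS, comp_updateFinset_of_dependsOn hhT] at this

end ProductMeasure

section Moments

lemma exists_add_pow_remainder (s y : ℝ) (k : ℕ) :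
    ∃ R : ℝ, (s + y) ^ (k + 2) = s ^ (k + 2) + (k + 2) * s ^ (k + 1) * y + y ^ 2 * R ∧
      |R| ≤ (2 ^ (k + 2) - k - 3) * max |s| |y| ^ k := by
  induction k with
  | zero => exact ⟨1, by push_cast; ring, by norm_num⟩
  | succ k ih =>
    obtain ⟨R, hR, hb⟩ := ih
    refine ⟨(s + y) * R + (k + 2) * s ^ (k + 1), ?_, ?_⟩
    · rw [show k + 1 + 2 = (k + 2) + 1 by ring, pow_succ, hR]
      push_cast
      ring
    set M := max |s| |y|
    have hs : |s| ≤ M := le_max_left _ _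
    have hy : |y| ≤ M := le_max_right _ _
    have hM : 0 ≤ M := (abs_nonneg s).trans hs
    have h₁ : |(s + y) * R| ≤ (2 * M) * ((2 ^ (k + 2) - k - 3) * M ^ k) := by
      rw [abs_mul]
      exact mul_le_mul ((abs_add_le _ _).trans (by linarith)) hb (abs_nonneg _) (by linarith)
    have h₂ : |((k : ℝ) + 2) * s ^ (k + 1)| ≤ (k + 2) * M ^ (k + 1) := by
      rw [abs_mul, abs_pow, abs_of_nonneg (by positivity : (0 : ℝ) ≤ (k : ℝ) + 2)]
      gcongr
    refine (abs_add_le _ _).trans ((add_le_add h₁ h₂).trans_eq ?_)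
    push_cast
    ring

lemma add_pow_even_le (s y : ℝ) (j : ℕ) :
    (s + y) ^ (2 * (j + 1)) ≤ s ^ (2 * (j + 1)) + (2 * j + 2) * (s ^ (2 * j + 1) * y)
      + 4 ^ (j + 1) * (s ^ (2 * j) * y ^ 2 + y ^ (2 * (j + 1))) := by
  obtain ⟨R, hR, hb⟩ := exists_add_pow_remainder s y (2 * j)
  have hmax : max |s| |y| ^ (2 * j) ≤ s ^ (2 * j) + y ^ (2 * j) := by
    have hs : 0 ≤ s ^ (2 * j) := (even_two_mul j).pow_nonneg s
    have hy : 0 ≤ y ^ (2 * j) := (even_two_mul j).pow_nonneg y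
    rcases max_choice |s| |y| with h | h <;> rw [h, (even_two_mul j).pow_abs] <;> linarith
  have hR' : R ≤ 4 ^ (j + 1) * (s ^ (2 * j) + y ^ (2 * j)) := by
    refine (le_abs_self R).trans (hb.trans (mul_le_mul ?_ hmax (by positivity) (by positivity)))
    rw [show (4 : ℝ) ^ (j + 1) = 2 ^ (2 * j + 2) by rw [← mul_add_one, pow_mul]; norm_num]
    push_cast
    linarith [(Nat.cast_nonneg j : (0 : ℝ) ≤ j)]
  rw [mul_add_one, hR, pow_add y (2 * j) 2]
  push_cast
  nlinarith [mul_le_mul_of_nonneg_left hR' (sq_nonneg y)]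

/-- The constants in the moment inequality `integral_sum_pow_even_le`. -/
noncomputable def momentConst : ℕ → ℝ
  | 0 => 1
  | j + 1 => 4 ^ (j + 1) * (momentConst j + 1)

lemma momentConst_nonneg : ∀ j, 0 ≤ momentConst j
  | 0 => zero_le_one
  | j + 1 => mul_nonneg (by positivity) (by linarith [momentConst_nonneg j])

variable {Ω κ : Type*} [MeasurableSpace Ω] {μ : Measure Ω} [IsProbabilityMeasure μ]

lemma integrable_pow_of_memLp {f : Ω → ℝ} {J k : ℕ} (hf : MemLp f J μ) (hk : k ≤ J) :
    Integrable (fun ω => f ω ^ k) μ :=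
  (hf.mono_exponent (by exact_mod_cast hk)).integrable_norm_pow'.mono (hf.1.pow k)
    (by filter_upwards with ω; simp)

lemma integral_add_pow_even_le {X Y : Ω → ℝ} {j : ℕ} (hXY : IndepFun X Y μ)
    (hX : MemLp X (2 * (j + 1) : ℕ) μ) (hY : MemLp Y (2 * (j + 1) : ℕ) μ) (hY0 : ∫ ω, Y ω ∂μ = 0) :
    ∫ ω, (X ω + Y ω) ^ (2 * (j + 1)) ∂μ ≤ ∫ ω, X ω ^ (2 * (j + 1)) ∂μ
      + 4 ^ (j + 1) * ((∫ ω, X ω ^ (2 * j) ∂μ) * (∫ ω, Y ω ^ 2 ∂μ)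
        + ∫ ω, Y ω ^ (2 * (j + 1)) ∂μ) := by
  have iX : ∀ k ≤ 2 * (j + 1), Integrable (fun ω => X ω ^ k) μ := fun k =>
    integrable_pow_of_memLp hX
  have iY : ∀ k ≤ 2 * (j + 1), Integrable (fun ω => Y ω ^ k) μ := fun k =>
    integrable_pow_of_memLp hY
  have ind : ∀ k l, IndepFun (fun ω => X ω ^ k) (fun ω => Y ω ^ l) μ := fun k l =>
    hXY.comp (measurable_id.pow_const k) (measurable_id.pow_const l)
  have cross : Integrable (fun ω => X ω ^ (2 * j + 1) * Y ω) μ := by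
    simpa [Pi.mul_def] using (ind (2 * j + 1) 1).integrable_mul (iX _ (by omega)) (iY _ (by omega))
  have cross0 : ∫ ω, X ω ^ (2 * j + 1) * Y ω ∂μ = 0 := by
    have := (ind (2 * j + 1) 1).integral_fun_mul_eq_mul_integral (iX _ (by omega)).1
      (iY _ (by omega)).1
    simpa [hY0] using this
  have sq : Integrable (fun ω => X ω ^ (2 * j) * Y ω ^ 2) μ :=
    (ind _ _).integrable_mul (iX _ (by omega)) (iY _ (by omega))
  have tail := (sq.add (iY _ le_rfl)).const_mul (4 ^ (j + 1))
  refine (integral_mono (integrable_pow_of_memLp (hX.add hY) le_rfl)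
    (((iX _ le_rfl).add (cross.const_mul (2 * j + 2))).add tail)
    fun ω => add_pow_even_le (X ω) (Y ω) j).trans_eq ?_
  rw [integral_add' ((iX _ le_rfl).add (cross.const_mul _)) tail,
    integral_add' (iX _ le_rfl) (cross.const_mul _), integral_const_mul, integral_const_mul, cross0,
    integral_add' sq (iY _ le_rfl),
    (ind _ _).integral_fun_mul_eq_mul_integral (iX _ (by omega)).1 (iY _ (by omega)).1]
  ring

lemma integral_sum_pow_even_succ_le {ξ : κ → Ω → ℝ} (hind : iIndepFun ξ μ)
    (hm : ∀ α, Measurable (ξ α)) {j : ℕ} {s : Finset κ}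
    (hL : ∀ α ∈ s, MemLp (ξ α) (2 * (j + 1) : ℕ) μ) (h0 : ∀ α ∈ s, ∫ ω, ξ α ω ∂μ = 0) {B : ℝ}
    (hB : ∀ t ⊆ s, ∫ ω, (∑ α ∈ t, ξ α ω) ^ (2 * j) ∂μ ≤ B) :
    ∫ ω, (∑ α ∈ s, ξ α ω) ^ (2 * (j + 1)) ∂μ
      ≤ 4 ^ (j + 1) * (B * (∑ α ∈ s, ∫ ω, ξ α ω ^ 2 ∂μ)
        + ∑ α ∈ s, ∫ ω, ξ α ω ^ (2 * (j + 1)) ∂μ) := by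
  classical
  induction s using Finset.induction_on with
  | empty => simp
  | insert a t ha ih =>
    have hLt : ∀ α ∈ t, MemLp (ξ α) (2 * (j + 1) : ℕ) μ := fun α hα =>
      hL α (Finset.mem_insert_of_mem hα)
    have hI : IndepFun (fun ω => ∑ α ∈ t, ξ α ω) (ξ a) μ := by
      simpa only [Finset.sum_fn] using hind.indepFun_finsetSum_of_notMem hm ha
    have step := integral_add_pow_even_le hI (memLp_finsetSum t hLt)
      (hL a (Finset.mem_insert_self a t)) (h0 a (Finset.mem_insert_self a t))
    have hsq : (∫ ω, (∑ α ∈ t, ξ α ω) ^ (2 * j) ∂μ) * (∫ ω, ξ a ω ^ 2 ∂μ)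
        ≤ B * ∫ ω, ξ a ω ^ 2 ∂μ := mul_le_mul_of_nonneg_right
      (hB t (Finset.subset_insert a t)) (integral_nonneg fun ω => sq_nonneg _)
    have ih' := ih hLt (fun α hα => h0 α (Finset.mem_insert_of_mem hα))
      fun t' ht' => hB t' (ht'.trans (Finset.subset_insert a t))
    simp only [Finset.sum_insert ha, add_comm (ξ a _)]
    have := mul_le_mul_of_nonneg_left hsq (by positivity : (0 : ℝ) ≤ 4 ^ (j + 1))
    linarith

lemma integral_sum_pow_even_le {ξ : κ → Ω → ℝ} (hind : iIndepFun ξ μ)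
    (hm : ∀ α, Measurable (ξ α)) {J : ℕ} {s : Finset κ}
    (hL : ∀ α ∈ s, MemLp (ξ α) (2 * J : ℕ) μ) (h0 : ∀ α ∈ s, ∫ ω, ξ α ω ∂μ = 0) {V : ℝ}
    (hV0 : 0 ≤ V)
    (hV : ∀ j, 1 ≤ j → j ≤ J → ∑ α ∈ s, ∫ ω, ξ α ω ^ (2 * j) ∂μ ≤ V ^ j) :
    ∀ j ≤ J, ∀ t ⊆ s, ∫ ω, (∑ α ∈ t, ξ α ω) ^ (2 * j) ∂μ ≤ momentConst j * V ^ j := by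
  intro j
  induction j with
  | zero => intro _ t _; simp [momentConst]
  | succ j ih =>
    intro hj t ht
    have hVt : ∀ i, 1 ≤ i → i ≤ J → ∑ α ∈ t, ∫ ω, ξ α ω ^ (2 * i) ∂μ ≤ V ^ i := fun i h1 hi =>
      (Finset.sum_le_sum_of_subset_of_nonneg ht fun α _ _ =>
        integral_nonneg fun ω => (even_two_mul i).pow_nonneg _).trans (hV i h1 hi)
    have hV₂ := hVt 1 le_rfl (by omega)
    rw [mul_one, pow_one] at hV₂
    have hC := momentConst_nonneg j
    calc _ ≤ 4 ^ (j + 1) * (momentConst j * V ^ j * (∑ α ∈ t, ∫ ω, ξ α ω ^ 2 ∂μ)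
          + ∑ α ∈ t, ∫ ω, ξ α ω ^ (2 * (j + 1)) ∂μ) :=
          integral_sum_pow_even_succ_le hind hm
            (fun α hα => (hL α (ht hα)).mono_exponent (by exact_mod_cast (by omega)))
            (fun α hα => h0 α (ht hα)) fun t' ht' => ih (by omega) t' (ht'.trans ht)
      _ ≤ 4 ^ (j + 1) * (momentConst j * V ^ j * V + V ^ (j + 1)) := by
          gcongr
          exact hVt (j + 1) (by omega) hj
      _ = momentConst (j + 1) * V ^ (j + 1) := by
          rw [momentConst]
          ring

end Moments

section SoftRisk

variable {W ι I : Type*} [Fintype ι] [Fintype I] [DecidableEq I]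

/-- The Gibbs weight of `w` in the soft risk, with the row of the block `j` removed. -/
noncomputable def cavityWeight (N b : ℝ) (f : I → ℝ → ℝ) (row : ι → I) (R : W → ℝ) (j : ι)
    (z : ι → W → ℝ) (w : W) : ℝ :=
  Real.exp (-b * (∑ i ∈ Finset.univ.erase (row j), f i (∑ α with row α = i, z α w))
    - N * b * R w)

lemma measurable_cavityWeight {N b : ℝ} {f : I → ℝ → ℝ} (hf : ∀ i, Measurable (f i))
    (row : ι → I) (R : W → ℝ) (j : ι) (w : W) :
    Measurable fun z : ι → W → ℝ => cavityWeight N b f row R j z w := by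
  unfold cavityWeight
  fun_prop

lemma cavityWeight_pos (N b : ℝ) (f : I → ℝ → ℝ) (row : ι → I) (R : W → ℝ) (j : ι)
    (z : ι → W → ℝ) (w : W) : 0 < cavityWeight N b f row R j z w :=
  Real.exp_pos _

lemma dependsOn_cavityWeight (N b : ℝ) (f : I → ℝ → ℝ) (row : ι → I) (R : W → ℝ) (j : ι) :
    DependsOn (cavityWeight N b f row R j)
      (Finset.univ.filter fun α : ι => row α ≠ row j) := by
  intro z z' h
  ext w
  have hrow : ∀ i ∈ Finset.univ.erase (row j),
      f i (∑ α with row α = i, z α w) = f i (∑ α with row α = i, z' α w) := fun i hi => by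
    congr 1
    refine Finset.sum_congr rfl fun α hα => ?_
    rw [h α (by simpa [(Finset.mem_filter.1 hα).2] using hi)]
  simp only [cavityWeight, Finset.sum_congr rfl hrow]

variable [Fintype W]

/-- The soft minimum over `w` of the risk `N⁻¹ ∑ i, f i (row i at w) + R w`, at inverse
temperature `N b`; the `i`-th row is the sum of the blocks `z α` with `row α = i`. -/
noncomputable def softRisk (N b : ℝ) (f : I → ℝ → ℝ) (row : ι → I) (R : W → ℝ)
    (z : ι → W → ℝ) : ℝ :=
  -(1 / (N * b)) * Real.log (∑ w, Real.exp
    (-b * (∑ i, f i (∑ α with row α = i, z α w)) - N * b * R w))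

lemma measurable_softRisk {N b : ℝ} {f : I → ℝ → ℝ} (hf : ∀ i, Measurable (f i)) (row : ι → I)
    (R : W → ℝ) : Measurable (softRisk N b f row R) := by
  unfold softRisk
  fun_prop

variable [DecidableEq ι]

/-- The blocks other than `j` in the row of the block `j`. -/
def siblings (row : ι → I) (j : ι) : Finset ι :=
  (Finset.univ.filter fun α => row α = row j).erase j

lemma softRisk_update (N b : ℝ) (f : I → ℝ → ℝ) (row : ι → I) (R : W → ℝ) (j : ι)
    (z : ι → W → ℝ) (y : W → ℝ) :
    softRisk N b f row R (Function.update z j y)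
      = -(1 / (N * b)) * Real.log (∑ w, cavityWeight N b f row R j z w
        * Real.exp (-b * f (row j) ((∑ α ∈ siblings row j, z α w) + y w))) := by
  unfold softRisk cavityWeight siblings
  congr 2
  refine Finset.sum_congr rfl fun w _ => ?_
  have row_j : ∑ α with row α = row j, Function.update z j y α w
      = (∑ α ∈ (Finset.univ.filter (fun α => row α = row j)).erase j, z α w) + y w := by
    rw [← Finset.add_sum_erase _ _ (by simp : j ∈ Finset.univ.filter (fun α => row α = row j)),
      add_comm, Function.update_self]
    congr 1
    exact Finset.sum_congr rfl fun α hα => by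
      rw [Function.update_of_ne (Finset.ne_of_mem_erase hα)]
  have other_rows :
      ∑ i ∈ Finset.univ.erase (row j), f i (∑ α with row α = i, Function.update z j y α w)
        = ∑ i ∈ Finset.univ.erase (row j), f i (∑ α with row α = i, z α w) := by
    refine Finset.sum_congr rfl fun i hi => congrArg _ (Finset.sum_congr rfl fun α hα => ?_)
    have : α ≠ j := fun h => Finset.ne_of_mem_erase hi (by rw [← (Finset.mem_filter.1 hα).2, h])
    rw [Function.update_of_ne this]
  rw [← Real.exp_add, ← Finset.add_sum_erase _ _ (Finset.mem_univ (row j)), row_j, other_rows]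
  congr 1
  ring

end SoftRisk

section MatchingMoments

variable {W : Type*} [Fintype W] {P Q : Measure (W → ℝ)} [IsProbabilityMeasure P]
  [IsProbabilityMeasure Q]

lemma integral_quadratic (hP : ∀ w, Integrable (fun y => y w) P)
    (hP₂ : ∀ w w', Integrable (fun y => y w * y w') P) (Φ₀ : ℝ) (α : W → ℝ) (γ : W → W → ℝ) :
    Integrable (fun y => Φ₀ + ∑ w, α w * y w + ∑ w, ∑ w', γ w w' * (y w * y w')) P ∧
      ∫ y, (Φ₀ + ∑ w, α w * y w + ∑ w, ∑ w', γ w w' * (y w * y w')) ∂P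
        = Φ₀ + ∑ w, α w * ∫ y, y w ∂P + ∑ w, ∑ w', γ w w' * ∫ y, y w * y w' ∂P := by
  have iα : ∀ w, Integrable (fun y : W → ℝ => α w * y w) P := fun w => (hP w).const_mul _
  have iγ : ∀ w w', Integrable (fun y : W → ℝ => γ w w' * (y w * y w')) P := fun w w' =>
    (hP₂ w w').const_mul _
  have iγ_sum : ∀ w, Integrable (fun y : W → ℝ => ∑ w', γ w w' * (y w * y w')) P := fun w =>
    integrable_finsetSum _ fun w' _ => iγ w w'
  have linear : Integrable (fun y : W → ℝ => Φ₀ + ∑ w, α w * y w) P :=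
    (integrable_const _).add (integrable_finsetSum _ fun w _ => iα w)
  have bilinear : Integrable (fun y : W → ℝ => ∑ w, ∑ w', γ w w' * (y w * y w')) P :=
    integrable_finsetSum _ fun w _ => iγ_sum w
  refine ⟨linear.add bilinear, ?_⟩
  rw [integral_add linear bilinear, integral_add (integrable_const _)
    (integrable_finsetSum _ fun w _ => iα w), integral_finsetSum _ fun w _ => iα w,
    integral_finsetSum _ fun w _ => iγ_sum w]
  simp only [integral_finsetSum _ fun w' _ => iγ _ w', integral_const_mul, integral_const,
    probReal_univ, one_smul]

lemma abs_integral_sub_integral_le_of_expansion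
    (iP : ∀ w, Integrable (fun y => y w) P) (iQ : ∀ w, Integrable (fun y => y w) Q)
    (iP₂ : ∀ w w', Integrable (fun y => y w * y w') P)
    (iQ₂ : ∀ w w', Integrable (fun y => y w * y w') Q)
    (h₁ : ∀ w, ∫ y, y w ∂P = ∫ y, y w ∂Q)
    (h₂ : ∀ w w', ∫ y, y w * y w' ∂P = ∫ y, y w * y w' ∂Q)
    {Φ ρ : (W → ℝ) → ℝ} (iΦP : Integrable Φ P) (iΦQ : Integrable Φ Q) (iρP : Integrable ρ P)
    (iρQ : Integrable ρ Q) {Φ₀ : ℝ} {α : W → ℝ} {γ : W → W → ℝ}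
    (h : ∀ y, |Φ y - (Φ₀ + ∑ w, α w * y w + ∑ w, ∑ w', γ w w' * (y w * y w'))| ≤ ρ y) :
    |∫ y, Φ y ∂P - ∫ y, Φ y ∂Q| ≤ ∫ y, ρ y ∂P + ∫ y, ρ y ∂Q := by
  obtain ⟨tP, eP⟩ := integral_quadratic iP iP₂ Φ₀ α γ
  obtain ⟨tQ, eQ⟩ := integral_quadratic iQ iQ₂ Φ₀ α γ
  simp only [h₁, h₂] at eP
  have bP := (abs_integral_le_integral_abs).trans (integral_mono (iΦP.sub tP).abs iρP h)
  have bQ := (abs_integral_le_integral_abs).trans (integral_mono (iΦQ.sub tQ).abs iρQ h)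
  rw [integral_sub' iΦP tP, eP] at bP
  rw [integral_sub' iΦQ tQ, eQ] at bQ
  rw [abs_le] at *
  constructor <;> linarith [bP.1, bP.2, bQ.1, bQ.2]

lemma integrable_norm_pow {k l : ℕ} (hP : Integrable (fun y : W → ℝ => ‖y‖ ^ k) P) (hl : l ≤ k) :
    Integrable (fun y : W → ℝ => ‖y‖ ^ l) P :=
  integrable_norm_pow_of_le (f := fun y : W → ℝ => y) (by fun_prop) hl hP

lemma integrable_coord_of_norm_pow {k : ℕ} (hP : Integrable (fun y : W → ℝ => ‖y‖ ^ k) P)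
    (hk : 1 ≤ k) (w : W) : Integrable (fun y => y w) P :=
  (integrable_norm_pow hP hk).mono' (by fun_prop : Measurable _).aestronglyMeasurable
    (Filter.Eventually.of_forall fun y => by simpa using norm_le_pi_norm y w)

lemma integrable_coord_mul_coord_of_norm_pow {k : ℕ}
    (hP : Integrable (fun y : W → ℝ => ‖y‖ ^ k) P) (hk : 2 ≤ k) (w w' : W) :
    Integrable (fun y => y w * y w') P := by
  refine (integrable_norm_pow hP hk).mono' (by fun_prop) (Filter.Eventually.of_forall fun y => ?_)
  rw [norm_mul, pow_two]
  exact mul_le_mul (norm_le_pi_norm y w) (norm_le_pi_norm y w') (norm_nonneg _) (norm_nonneg _)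

end MatchingMoments

section Swap

lemma SelfBounded.continuous {f : ℝ → ℝ} {D : ℝ} {G : Fin 4 → ℝ → ℝ} (hf : SelfBounded f D G) :
    Continuous f :=
  hf.contDiff.continuous

lemma integral_pi_update {ι E : Type*} [Fintype ι] [DecidableEq ι] [MeasurableSpace E]
    (m : ι → Measure E) [∀ i, IsProbabilityMeasure (m i)] (Q : Measure E)
    [IsProbabilityMeasure Q] (j : ι) {F : (ι → E) → ℝ} (hF : Measurable F) {K : ℝ}
    (hK : ∀ x, |F x| ≤ K) :
    Integrable (fun x => ∫ y, F (Function.update x j y) ∂Q) (Measure.pi m) ∧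
    ∫ x, F x ∂(Measure.pi (Function.update m j Q))
      = ∫ x, ∫ y, F (Function.update x j y) ∂Q ∂(Measure.pi m) := by
  have hmeas : Measurable (fun z : (ι → E) × E => Function.update z.1 j z.2) :=
    measurable_update'
  have hi : Integrable (fun z : (ι → E) × E => F (Function.update z.1 j z.2))
      ((Measure.pi m).prod Q) :=
    Integrable.of_bound (hF.comp hmeas).aestronglyMeasurable K
      (Filter.Eventually.of_forall fun z => hK _)
  refine ⟨hi.integral_prod_left, ?_⟩
  rw [← map_update_prod_pi m j Q, integral_map hmeas.aemeasurable hF.aestronglyMeasurable,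
    integral_prod _ hi]

/-- Weights that do not see the averaged quantities factor out of the expectation. -/
lemma integral_wavg_le_of_indepFun {Ω W : Type*} [Fintype W] [Nonempty W] [MeasurableSpace Ω]
    {μ : Measure Ω} [IsProbabilityMeasure μ] {c : Ω → W → ℝ} (hc : ∀ ω w, 0 < c ω w)
    (hcm : ∀ w, Measurable fun ω => c ω w) {a : W → Ω → ℝ} (ha : ∀ w, Integrable (a w) μ)
    (hind : ∀ w, IndepFun c (a w) μ) {κ : ℝ} (hκ : ∀ w, ∫ ω, a w ω ∂μ ≤ κ) :
    Integrable (fun ω => wavg (c ω) (fun w => a w ω)) μ ∧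
      ∫ ω, wavg (c ω) (fun w => a w ω) ∂μ ≤ κ := by
  set π : W → Ω → ℝ := fun w ω => c ω w / ∑ w', c ω w'
  have π_meas : ∀ w, Measurable (π w) := fun w =>
    (hcm w).div (Finset.measurable_fun_sum _ fun w' _ => hcm w')
  have π_nonneg : ∀ w ω, 0 ≤ π w ω := fun w ω => div_nonneg (hc ω w).le
    (Finset.sum_nonneg fun w' _ => (hc ω w').le)
  have π_sum : ∀ ω, ∑ w, π w ω = 1 := fun ω => by
    simp only [π, ← Finset.sum_div]
    exact div_self (sum_weights_pos (hc ω)).ne'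
  have π_int : ∀ w, Integrable (π w) μ := fun w =>
    Integrable.of_bound (π_meas w).aestronglyMeasurable 1 (Filter.Eventually.of_forall fun ω => by
      rw [Real.norm_eq_abs, abs_of_nonneg (π_nonneg w ω), ← π_sum ω]
      exact Finset.single_le_sum (f := fun w => π w ω) (fun w' _ => π_nonneg w' ω)
        (Finset.mem_univ w))
  have π_ind : ∀ w, IndepFun (π w) (a w) μ := fun w =>
    (hind w).comp (φ := fun c : W → ℝ => c w / ∑ w', c w') (by fun_prop) measurable_id
  have wavg_eq : ∀ ω, wavg (c ω) (fun w => a w ω) = ∑ w, π w ω * a w ω := fun ω => by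
    simp only [wavg, π, Finset.sum_div]
    exact Finset.sum_congr rfl fun w _ => by ring
  have prod_int : ∀ w, Integrable (fun ω => π w ω * a w ω) μ := fun w =>
    (π_ind w).integrable_mul (π_int w) (ha w)
  simp only [wavg_eq]
  refine ⟨integrable_finsetSum _ fun w _ => prod_int w, ?_⟩
  calc ∫ ω, ∑ w, π w ω * a w ω ∂μ = ∑ w, (∫ ω, π w ω ∂μ) * ∫ ω, a w ω ∂μ := by
        rw [integral_finsetSum _ fun w _ => prod_int w]
        exact Finset.sum_congr rfl fun w _ => (π_ind w).integral_fun_mul_eq_mul_integral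
          (π_meas w).aestronglyMeasurable (ha w).aestronglyMeasurable
    _ ≤ ∑ w, (∫ ω, π w ω ∂μ) * κ := Finset.sum_le_sum fun w _ =>
        mul_le_mul_of_nonneg_left (hκ w) (integral_nonneg (π_nonneg w))
    _ = κ := by
        rw [← Finset.sum_mul, ← integral_finsetSum _ fun w _ => π_int w]
        simp [π_sum]

lemma indepFun_cavityWeight_siblings {W ι I : Type*} [Fintype ι] [Fintype I] [DecidableEq I]
    [DecidableEq ι] {N b : ℝ} {f : I → ℝ → ℝ} {m : ι → Measure (W → ℝ)}
    [∀ i, IsProbabilityMeasure (m i)] (hf : ∀ i, Measurable (f i)) (row : ι → I) (R : W → ℝ)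
    (j : ι) (k : ℕ) (w : W) :
    IndepFun (cavityWeight N b f row R j) (fun x => |∑ α ∈ siblings row j, x α w| ^ k)
      (Measure.pi m) := by
  refine indepFun_pi_of_dependsOn m
    (measurable_pi_iff.2 fun w => measurable_cavityWeight hf row R j w) (by fun_prop)
    ?_ (dependsOn_cavityWeight N b f row R j) (T := siblings row j) ?_
  · rw [Finset.disjoint_left]
    intro α h h'
    exact (Finset.mem_filter.1 h).2 (Finset.mem_filter.1 (Finset.mem_of_mem_erase h')).2
  · intro x x' hx
    simp only [Finset.sum_congr rfl fun α hα => congrFun (hx α hα) w]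

variable {W ι I : Type*} [Fintype W] [Nonempty W] [Fintype ι] [Fintype I] [DecidableEq I]
  [DecidableEq ι] {N b K D Λ : ℝ} {g : ℝ → ℝ} {G : Fin 4 → ℝ → ℝ} {Ψ : ℝ → ℝ} {f : I → ℝ → ℝ}
  {P Q : Measure (W → ℝ)} [IsProbabilityMeasure P] [IsProbabilityMeasure Q]

lemma abs_integral_softRisk_update_sub_le (hN : 1 ≤ N) (hb : 1 ≤ b) (hD : 1 ≤ D)
    (hg : BoundedDerivs g K) (hG : DominatedWeights G Ψ) (hf : ∀ i, SelfBounded (f i) D G)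
    (row : ι → I) (R : W → ℝ) (j : ι) {k : ℕ}
    (iP : Integrable (fun y : W → ℝ => ‖y‖ ^ (k + 3)) P)
    (iQ : Integrable (fun y : W → ℝ => ‖y‖ ^ (k + 3)) Q)
    (h₁ : ∀ w, ∫ y, y w ∂P = ∫ y, y w ∂Q)
    (h₂ : ∀ w w', ∫ y, y w * y w' ∂P = ∫ y, y w * y w' ∂Q) (hΛ0 : 0 ≤ Λ)
    (hΛ : ∀ r y t : ℝ, t ∈ Icc (0 : ℝ) 1 → Ψ (f (row j) (r + t * y)) ≤ Λ * (1 + |r| ^ k + |y| ^ k))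
    (x : ι → W → ℝ) :
    |∫ y, g (softRisk N b f row R (Function.update x j y)) ∂P
        - ∫ y, g (softRisk N b f row R (Function.update x j y)) ∂Q|
      ≤ 23 * K * b ^ 2 * D ^ 3 / N * Λ *
        ((1 + wavg (cavityWeight N b f row R j x) fun w => |∑ α ∈ siblings row j, x α w| ^ k)
            * (∫ y, ‖y‖ ^ 3 ∂P + ∫ y, ‖y‖ ^ 3 ∂Q)
          + (∫ y, ‖y‖ ^ (k + 3) ∂P + ∫ y, ‖y‖ ^ (k + 3) ∂Q)) := by
  have cpos := cavityWeight_pos N b f row R j x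
  set c := cavityWeight N b f row R j x
  set v := wavg c fun w => |∑ α ∈ siblings row j, x α w| ^ k
  set C : ℝ := 23 * K * b ^ 2 * D ^ 3 / N * Λ with hC
  obtain ⟨Φ₀, α, γ, expansion⟩ := exists_softmin_expansion hg (hf (row j)) hG hD hN hb cpos
    fun w => ∑ α ∈ siblings row j, x α w
  have hFm : Measurable fun y => g (softRisk N b f row R (Function.update x j y)) :=
    hg.continuous.measurable.comp ((measurable_softRisk
      (fun i => (hf i).continuous.measurable) row R).comp (measurable_update x))
  have iΦ : ∀ (μ : Measure (W → ℝ)) [IsProbabilityMeasure μ],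
      Integrable (fun y => g (softRisk N b f row R (Function.update x j y))) μ := fun μ _ =>
    Integrable.of_bound hFm.aestronglyMeasurable K (Filter.Eventually.of_forall fun z =>
      hg.abs_le _)
  have remainder : ∀ y, _ ≤ C * ((1 + v) * ‖y‖ ^ 3 + ‖y‖ ^ (k + 3)) := fun y => by
    refine (expansion y ‖y‖ (Λ * ((1 + ‖y‖ ^ k) + v)) (norm_le_pi_norm y) ?_).trans_eq ?_
    · intro t ht
      rw [← wavg_const_add cpos, ← wavg_const_mul]
      refine wavg_mono cpos fun w => (hΛ _ _ t ht).trans ?_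
      have : |y w| ^ k ≤ ‖y‖ ^ k := pow_le_pow_left₀ (abs_nonneg _) (norm_le_pi_norm y w) k
      exact mul_le_mul_of_nonneg_left (by linarith) hΛ0
    · rw [hC]
      ring
  have iρ : ∀ {μ : Measure (W → ℝ)} [IsProbabilityMeasure μ],
      Integrable (fun y : W → ℝ => ‖y‖ ^ (k + 3)) μ →
      Integrable (fun y : W → ℝ => C * ((1 + v) * ‖y‖ ^ 3 + ‖y‖ ^ (k + 3))) μ ∧
      ∫ y, C * ((1 + v) * ‖y‖ ^ 3 + ‖y‖ ^ (k + 3)) ∂μ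
        = C * ((1 + v) * ∫ y, ‖y‖ ^ 3 ∂μ + ∫ y, ‖y‖ ^ (k + 3) ∂μ) := fun {μ} _ hμ => by
    have i₃ := (integrable_norm_pow hμ (by lia : 3 ≤ k + 3)).const_mul (1 + v)
    exact ⟨(i₃.add hμ).const_mul C, by
      rw [integral_const_mul, integral_add i₃ hμ, integral_const_mul]⟩
  simp only [softRisk_update] at iΦ ⊢
  refine (abs_integral_sub_integral_le_of_expansion
    (integrable_coord_of_norm_pow iP (by lia)) (integrable_coord_of_norm_pow iQ (by lia))
    (integrable_coord_mul_coord_of_norm_pow iP (by lia))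
    (integrable_coord_mul_coord_of_norm_pow iQ (by lia))
    h₁ h₂ (iΦ P) (iΦ Q) (iρ iP).1 (iρ iQ).1 remainder).trans_eq ?_
  rw [(iρ iP).2, (iρ iQ).2]
  ring

/-- The row of the swapped block does not enter the cavity weights, which are therefore independent
of its other blocks. -/
lemma abs_integral_softRisk_swap_le (hN : 1 ≤ N) (hb : 1 ≤ b) (hD : 1 ≤ D)
    (hg : BoundedDerivs g K) (hG : DominatedWeights G Ψ) (hf : ∀ i, SelfBounded (f i) D G)
    (row : ι → I) (R : W → ℝ) (m : ι → Measure (W → ℝ)) [∀ i, IsProbabilityMeasure (m i)] (j : ι)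
    {k : ℕ} (iP : Integrable (fun y : W → ℝ => ‖y‖ ^ (k + 3)) P)
    (iQ : Integrable (fun y : W → ℝ => ‖y‖ ^ (k + 3)) Q)
    (h₁ : ∀ w, ∫ y, y w ∂P = ∫ y, y w ∂Q)
    (h₂ : ∀ w w', ∫ y, y w * y w' ∂P = ∫ y, y w * y w' ∂Q) (hΛ0 : 0 ≤ Λ)
    (hΛ : ∀ r y t : ℝ, t ∈ Icc (0 : ℝ) 1 → Ψ (f (row j) (r + t * y)) ≤ Λ * (1 + |r| ^ k + |y| ^ k))
    {κ : ℝ} (iκ : ∀ w, Integrable (fun x : ι → W → ℝ => |∑ α ∈ siblings row j, x α w| ^ k)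
      (Measure.pi m))
    (hκ : ∀ w, ∫ x, |∑ α ∈ siblings row j, x α w| ^ k ∂(Measure.pi m) ≤ κ) :
    |∫ x, g (softRisk N b f row R x) ∂(Measure.pi (Function.update m j P))
      - ∫ x, g (softRisk N b f row R x) ∂(Measure.pi (Function.update m j Q))|
    ≤ 23 * K * b ^ 2 * D ^ 3 / N * Λ * ((1 + κ) * (∫ y, ‖y‖ ^ 3 ∂P + ∫ y, ‖y‖ ^ 3 ∂Q)
      + (∫ y, ‖y‖ ^ (k + 3) ∂P + ∫ y, ‖y‖ ^ (k + 3) ∂Q)) := by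
  have hfm : ∀ i, Measurable (f i) := fun i => (hf i).continuous.measurable
  have hFm : Measurable (fun x => g (softRisk N b f row R x)) :=
    hg.continuous.measurable.comp (measurable_softRisk hfm row R)
  obtain ⟨jP, eP⟩ := integral_pi_update m P j hFm (fun x => hg.abs_le _)
  obtain ⟨jQ, eQ⟩ := integral_pi_update m Q j hFm (fun x => hg.abs_le _)
  obtain ⟨iw, hw⟩ := integral_wavg_le_of_indepFun (cavityWeight_pos N b f row R j)
    (measurable_cavityWeight hfm row R j) iκ
    (indepFun_cavityWeight_siblings hfm row R j k) hκ
  have pointwise := abs_integral_softRisk_update_sub_le hN hb hD hg hG hf row R j iP iQ h₁ h₂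
    hΛ0 hΛ
  set A : ℝ := ∫ y, ‖y‖ ^ 3 ∂P + ∫ y, ‖y‖ ^ 3 ∂Q
  set B : ℝ := ∫ y, ‖y‖ ^ (k + 3) ∂P + ∫ y, ‖y‖ ^ (k + 3) ∂Q
  set C : ℝ := 23 * K * b ^ 2 * D ^ 3 / N * Λ
  have hA0 : 0 ≤ A := add_nonneg (integral_nonneg fun y => by positivity)
    (integral_nonneg fun y => by positivity)
  have hK := hg.nonneg
  have hC0 : 0 ≤ C := by positivity
  have i₁ := (integrable_const (1 : ℝ)).add iw
  have iA := i₁.mul_const A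
  have iB := iA.add (integrable_const B)
  rw [eP, eQ, ← integral_sub jP jQ]
  refine (abs_integral_le_integral_abs).trans
    ((integral_mono (jP.sub jQ).abs (iB.const_mul C) pointwise).trans ?_)
  rw [integral_const_mul, integral_add' iA (integrable_const B), integral_mul_const,
    integral_add' (integrable_const (1 : ℝ)) iw]
  simp only [integral_const, probReal_univ, one_smul]
  exact mul_le_mul_of_nonneg_left
    (add_le_add (mul_le_mul_of_nonneg_right (by linarith) hA0) le_rfl) hC0

end Swap

section SoftRiskUniversality

/-- A centred law on `W → ℝ` of scale `s`, with coordinate variances at most `v`. -/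
structure BlockLaw {W : Type*} [Fintype W] (μ : Measure (W → ℝ)) (k : ℕ) (s v : ℝ) : Prop where
  memLp : MemLp (fun y : W → ℝ => y) (k + 3 : ℕ) μ
  mean : ∀ w, ∫ y, y w ∂μ = 0
  moment : ∀ l ≤ k + 3, ∫ y, ‖y‖ ^ l ∂μ ≤ s ^ l
  var : ∀ w, ∫ y, y w ^ 2 ∂μ ≤ v

variable {W ι I : Type*} [Fintype W] [Fintype ι] [Fintype I] [DecidableEq I]

lemma BlockLaw.integrable {μ : Measure (W → ℝ)} [IsProbabilityMeasure μ] {k : ℕ} {s v : ℝ}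
    (h : BlockLaw μ k s v) : Integrable (fun y : W → ℝ => ‖y‖ ^ (k + 3)) μ :=
  h.memLp.integrable_norm_pow'

lemma BlockLaw.memLp_coord {μ : Measure (W → ℝ)} [IsProbabilityMeasure μ] {k : ℕ} {s v : ℝ}
    (h : BlockLaw μ k s v) (w : W) : MemLp (fun y : W → ℝ => y w) (k : ℕ) μ := by
  have : MemLp (fun y : W → ℝ => y w) (k + 3 : ℕ) μ :=
    h.memLp.mono (by fun_prop : Measurable _).aestronglyMeasurable
      (Filter.Eventually.of_forall fun y => norm_le_pi_norm y w)
  exact this.mono_exponent (by exact_mod_cast (by lia : k ≤ k + 3))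

lemma BlockLaw.integral_coord_pow_le {μ : Measure (W → ℝ)} [IsProbabilityMeasure μ] {k : ℕ}
    {s v : ℝ} (h : BlockLaw μ k s v) (w : W) {j : ℕ} (hj : 2 * j ≤ k + 3) :
    ∫ y, y w ^ (2 * j) ∂μ ≤ s ^ (2 * j) := by
  refine le_trans ?_ (h.moment (2 * j) hj)
  refine integral_mono_of_nonneg (Filter.Eventually.of_forall fun y =>
    (even_two_mul j).pow_nonneg _) (integrable_norm_pow h.integrable hj)
    (Filter.Eventually.of_forall fun y => ?_)
  simp only
  rw [← (even_two_mul j).pow_abs]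
  exact pow_le_pow_left₀ (abs_nonneg _) (norm_le_pi_norm y w) _

lemma integral_row_pow_le (m : ι → Measure (W → ℝ)) [∀ i, IsProbabilityMeasure (m i)] {J : ℕ}
    {s v : ι → ℝ} (h : ∀ α, BlockLaw (m α) (2 * J) (s α) (v α)) {V : ℝ} (hV0 : 0 ≤ V)
    (T : Finset ι) (hv : ∑ α ∈ T, v α ≤ V)
    (hs : ∀ j, 2 ≤ j → j ≤ J → ∑ α ∈ T, s α ^ (2 * j) ≤ V ^ j) (w : W) {T' : Finset ι}
    (hT' : T' ⊆ T) :
    Integrable (fun x : ι → W → ℝ => |∑ α ∈ T', x α w| ^ (2 * J)) (Measure.pi m) ∧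
    ∫ x, |∑ α ∈ T', x α w| ^ (2 * J) ∂(Measure.pi m) ≤ momentConst J * V ^ J := by
  have hind : iIndepFun (fun α (x : ι → W → ℝ) => x α w) (Measure.pi m) :=
    iIndepFun_pi (X := fun _ (y : W → ℝ) => y w) (fun _ => (measurable_pi_apply w).aemeasurable)
  have hmp : ∀ α, MeasurePreserving (fun x : ι → W → ℝ => x α) (Measure.pi m) (m α) := fun α =>
    measurePreserving_eval m α
  have hL : ∀ α, MemLp (fun x : ι → W → ℝ => x α w) (2 * J : ℕ) (Measure.pi m) := fun α =>
    ((h α).memLp_coord w).comp_measurePreserving (hmp α)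
  have integral_eval : ∀ α j, ∫ x, (x α w) ^ j ∂(Measure.pi m) = ∫ y, y w ^ j ∂(m α) := by
    intro α j
    rw [← (hmp α).map_eq, integral_map (hmp α).measurable.aemeasurable
      (by fun_prop : Measurable _).aestronglyMeasurable]
  have mean : ∀ α, ∫ x, x α w ∂(Measure.pi m) = 0 := fun α => by
    simpa [(h α).mean w] using integral_eval α 1
  have moments : ∀ j, 1 ≤ j → j ≤ J →
      ∑ α ∈ T, ∫ x, (x α w) ^ (2 * j) ∂(Measure.pi m) ≤ V ^ j := fun j hj1 hj => by
    simp only [integral_eval]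
    rcases hj1.lt_or_eq with h2 | rfl
    · exact (Finset.sum_le_sum fun α _ => (h α).integral_coord_pow_le w (by lia)).trans
        (hs j h2 hj)
    · simpa using (Finset.sum_le_sum fun α _ => (h α).var w).trans hv
  simp only [(even_two_mul J).pow_abs]
  exact ⟨integrable_pow_of_memLp (memLp_finsetSum T' fun α _ => hL α) le_rfl,
    integral_sum_pow_even_le hind (fun α => by fun_prop) (fun α _ => hL α) (fun α _ => mean α) hV0
      moments J le_rfl T' hT'⟩

theorem abs_integral_softRisk_pi_sub_le [Nonempty W] {N b K D : ℝ} (hN : 1 ≤ N)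
    (hb : 1 ≤ b) (hD : 1 ≤ D) {g : ℝ → ℝ} (hg : BoundedDerivs g K) {G : Fin 4 → ℝ → ℝ}
    {Ψ : ℝ → ℝ} (hG : DominatedWeights G Ψ) {f : I → ℝ → ℝ} (hf : ∀ i, SelfBounded (f i) D G)
    (row : ι → I) (R : W → ℝ) (P Q : ι → Measure (W → ℝ)) [∀ i, IsProbabilityMeasure (P i)]
    [∀ i, IsProbabilityMeasure (Q i)] {J : ℕ} {s v : ι → ℝ}
    (hP : ∀ α, BlockLaw (P α) (2 * J) (s α) (v α)) (hQ : ∀ α, BlockLaw (Q α) (2 * J) (s α) (v α))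
    (h₂ : ∀ α w w', ∫ y, y w * y w' ∂(P α) = ∫ y, y w * y w' ∂(Q α)) {Λ : I → ℝ}
    (hΛ0 : ∀ i, 0 ≤ Λ i)
    (hΛ : ∀ i, ∀ r y t : ℝ, t ∈ Icc (0 : ℝ) 1 →
      Ψ (f i (r + t * y)) ≤ Λ i * (1 + |r| ^ (2 * J) + |y| ^ (2 * J)))
    {V : ℝ} (hV0 : 0 ≤ V) (hv : ∀ i, ∑ α with row α = i, v α ≤ V)
    (hs : ∀ i j, 2 ≤ j → j ≤ J → ∑ α with row α = i, s α ^ (2 * j) ≤ V ^ j) :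
    |∫ x, g (softRisk N b f row R x) ∂(Measure.pi P)
      - ∫ x, g (softRisk N b f row R x) ∂(Measure.pi Q)|
    ≤ ∑ α, 23 * K * b ^ 2 * D ^ 3 / N * Λ (row α) *
      ((1 + momentConst J * V ^ J) * (2 * s α ^ 3) + 2 * s α ^ (2 * J + 3)) := by
  classical
  have hK : 0 ≤ K := hg.nonneg
  have hC : 0 ≤ momentConst J := momentConst_nonneg J
  refine abs_integral_pi_sub_le_sum P Q _ _ fun m hm j => ?_
  have hprob : ∀ i, IsProbabilityMeasure (m i) := fun i => by
    rcases hm i with h | h <;> rw [h] <;> infer_instance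
  have hB : ∀ α, BlockLaw (m α) (2 * J) (s α) (v α) := fun α => by
    rcases hm α with h | h <;> rw [h]
    exacts [hP α, hQ α]
  have hr := fun w => integral_row_pow_le m hB hV0 _ (hv (row j)) (hs (row j)) w
    (Finset.erase_subset j _)
  refine (abs_integral_softRisk_swap_le hN hb hD hg hG hf row R m j (hP j).integrable
    (hQ j).integrable (fun w => ((hP j).mean w).trans ((hQ j).mean w).symm) (h₂ j) (hΛ0 (row j))
    (hΛ (row j)) (fun w => (hr w).1) (fun w => (hr w).2)).trans ?_
  have hΛj := hΛ0 (row j)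
  gcongr
  · linarith [(hP j).moment 3 (by lia), (hQ j).moment 3 (by lia)]
  · linarith [(hP j).moment _ le_rfl, (hQ j).moment _ le_rfl]

end SoftRiskUniversality

section Losses

lemma rpow_le_one_add_rpow {u a b : ℝ} (hu : 0 ≤ u) (ha : 0 ≤ a) (hab : a ≤ b) :
    u ^ a ≤ 1 + u ^ b := by
  rcases le_total u 1 with h | h
  · linarith [Real.rpow_le_one hu h ha, Real.rpow_nonneg hu b]
  · linarith [Real.rpow_le_rpow_of_exponent_le h hab]

lemma max_one_abs_pow_le {x r y : ℝ} (h : |x| ≤ |r| + |y|) (k : ℕ) :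
    max 1 |x| ^ k ≤ 2 ^ k * (1 + |r| ^ k + |y| ^ k) := by
  have two_pow : (2 : ℝ) ^ (k - 1) ≤ 2 ^ k := pow_le_pow_right₀ (by norm_num) (Nat.sub_le k 1)
  have one_le : (1 : ℝ) ≤ 2 ^ k := one_le_pow₀ (by norm_num)
  have hr : 0 ≤ |r| ^ k := by positivity
  have hy : 0 ≤ |y| ^ k := by positivity
  rcases le_total 1 |x| with hx | hx
  · rw [max_eq_right hx]
    calc |x| ^ k ≤ (|r| + |y|) ^ k := pow_le_pow_left₀ (abs_nonneg _) h k
      _ ≤ 2 ^ (k - 1) * (|r| ^ k + |y| ^ k) := add_pow_le (abs_nonneg _) (abs_nonneg _) k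
      _ ≤ 2 ^ k * (1 + |r| ^ k + |y| ^ k) := by gcongr; linarith
  · rw [max_eq_left hx, one_pow]
    nlinarith

variable {q : Fin 4 → ℝ}

lemma three_mul_le_bq (q : Fin 4 → ℝ) : 3 * q 1 ≤ bq q := le_max_left _ _

lemma add_le_bq (q : Fin 4 → ℝ) : q 1 + q 2 ≤ bq q := (le_max_left _ _).trans (le_max_right _ _)

lemma le_bq_three (q : Fin 4 → ℝ) : q 3 ≤ bq q := (le_max_right _ _).trans (le_max_right _ _)

lemma bq_nonneg (hq : ∀ k, 0 ≤ q k) : 0 ≤ bq q := by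
  linarith [hq 1, three_mul_le_bq q]

lemma le_bq_one (hq : ∀ k, 0 ≤ q k) : q 1 ≤ bq q := by
  linarith [hq 1, three_mul_le_bq q]

lemma mul_bq_le_bq0 (q : Fin 4 → ℝ) : q 0 * bq q ≤ bq0 q := by
  have := Nat.le_ceil (q 0 * bq q / 2)
  unfold bq0
  push_cast
  linarith

lemma mul_one_le_bq0 (hq : ∀ k, 0 ≤ q k) : q 0 * q 1 ≤ bq0 q :=
  (mul_le_mul_of_nonneg_left (le_bq_one hq) (hq 0)).trans (mul_bq_le_bq0 q)

/-- The weights `1 + u ^ q k` that bound the derivatives of a smoothed loss by its values. -/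
noncomputable def lossWeight (q : Fin 4 → ℝ) (k : Fin 4) (u : ℝ) : ℝ := 1 + u ^ q k

lemma one_le_lossWeight (q : Fin 4 → ℝ) (k : Fin 4) {u : ℝ} (hu : 0 ≤ u) :
    1 ≤ lossWeight q k u :=
  le_add_of_nonneg_right (Real.rpow_nonneg hu _)

lemma dominatedWeights_lossWeight (hq : ∀ k, 0 ≤ q k) :
    DominatedWeights (lossWeight q) (fun u => 8 * (1 + u ^ bq q)) := by
  have mono : ∀ a : ℝ, 0 ≤ a → MonotoneOn (fun u : ℝ => 1 + u ^ a) (Ici 0) := fun a ha u hu v _ h =>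
    add_le_add_right (Real.rpow_le_rpow hu h ha) 1
  have nonneg : ∀ k u, 0 ≤ u → 0 ≤ lossWeight q k u := fun k u hu =>
    zero_le_one.trans (one_le_lossWeight q k hu)
  refine ⟨mono _ (hq 1), mono _ (hq 2), fun u hu v hv h => ?_, nonneg 1, nonneg 2,
    fun u hu => ?_, fun u hu => ?_, fun u hu => ?_⟩
  · exact mul_le_mul_of_nonneg_left (mono _ (bq_nonneg hq) hu hv h) (by norm_num)
  · have h₁ := Real.rpow_nonneg hu (q 1)
    have cube := rpow_le_one_add_rpow hu (by linarith [hq 1]) (three_mul_le_bq q)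
    rw [mul_comm, Real.rpow_mul hu, Real.rpow_ofNat] at cube
    unfold lossWeight
    nlinarith [mul_nonneg (sq_nonneg (u ^ q 1 - 1)) (by linarith : 0 ≤ u ^ q 1 + 1),
      Real.rpow_nonneg hu (bq q)]
  · have h₁ := rpow_le_one_add_rpow hu (hq 1) (le_bq_one hq)
    have h₂ := rpow_le_one_add_rpow hu (hq 2) (by linarith [hq 1, add_le_bq q] : q 2 ≤ bq q)
    have h₁₂ := rpow_le_one_add_rpow hu (by linarith [hq 1, hq 2]) (add_le_bq q)
    rw [Real.rpow_add_of_nonneg hu (hq 1) (hq 2)] at h₁₂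
    unfold lossWeight
    nlinarith [Real.rpow_nonneg hu (bq q)]
  · have h₃ := rpow_le_one_add_rpow hu (hq 3) (le_bq_three q)
    unfold lossWeight
    linarith [Real.rpow_nonneg hu (bq q)]

lemma boundedDerivs_of_Kg {g : ℝ → ℝ} (hg : ContDiff ℝ 3 g) (hK : Kg g ≠ ⊤) :
    BoundedDerivs g (Kg g).toReal where
  contDiff := hg
  bound k x := by
    rw [← ENNReal.ofReal_le_iff_le_toReal hK]
    exact (le_iSup₂_of_le (f := fun (k : Fin 4) x => ENNReal.ofReal |iteratedDeriv k g x|) k x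
      le_rfl).trans le_add_self

/-- A smoothed loss: it grows like `|x| ^ q 0`, with constant `A`, and is self-bounded with the
weights `1 + u ^ q k`. The factor `4` makes room for the distance to the loss it smooths. -/
structure SmoothedLoss (q : Fin 4 → ℝ) (A D : ℝ) (f : ℝ → ℝ) : Prop where
  one_le : 1 ≤ A
  growth : ∀ x, f x ≤ 4 * A * max 1 |x| ^ q 0
  selfBounded : SelfBounded f D (lossWeight q)

lemma smoothedLoss_of_abs_sub_le {f ℓ : ℝ → ℝ} {A D ε : ℝ} (hq : 0 ≤ q 0) (hA : 1 ≤ A)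
    (hε : ε ≤ 1) (hℓ : ∀ x, |ℓ x| / (1 + |x| ^ q 0) ≤ A) (hf0 : ∀ x, 0 ≤ f x)
    (hf : ContDiff ℝ 3 f) (hfℓ : ∀ x, |f x - ℓ x| ≤ ε)
    (hD : ∀ k : Fin 4, k ≠ 0 → ∀ x, |iteratedDeriv k f x| / (1 + |f x| ^ q k) ≤ D) :
    SmoothedLoss q A D f where
  one_le := hA
  growth x := by
    have hx := hℓ x
    rw [div_le_iff₀ (by positivity)] at hx
    have mono : |x| ^ q 0 ≤ max 1 |x| ^ q 0 :=
      Real.rpow_le_rpow (abs_nonneg _) (le_max_right _ _) hq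
    have one_le : 1 ≤ max 1 |x| ^ q 0 := Real.one_le_rpow (le_max_left _ _) hq
    have : A * (1 + |x| ^ q 0) ≤ A * (2 * max 1 |x| ^ q 0) := by gcongr; linarith
    nlinarith [(abs_le.1 (hfℓ x)).2, le_abs_self (ℓ x)]
  selfBounded :=
    { nonneg := hf0
      contDiff := hf
      bound := fun k hk x => by
        have := hD k hk x
        rw [abs_of_nonneg (hf0 x)] at this
        exact (div_le_iff₀ (zero_lt_one.trans_le (one_le_lossWeight q k (hf0 x)))).1 this }

namespace SmoothedLoss

variable {A D : ℝ} {f : ℝ → ℝ} (hf : SmoothedLoss q A D f)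

include hf

lemma rpow_le {x a : ℝ} (ha : 0 ≤ a) :
    f x ^ a ≤ 4 ^ a * A ^ a * max 1 |x| ^ (q 0 * a) := by
  have hA := hf.one_le
  have h := Real.rpow_le_rpow (hf.selfBounded.nonneg x) (hf.growth x) ha
  rwa [Real.mul_rpow (by positivity) (by positivity), Real.mul_rpow (by norm_num) (by linarith),
    ← Real.rpow_mul (by positivity)] at h

lemma dominatingWeight_le (hq : ∀ k, 0 ≤ q k) {r y t : ℝ} (ht : t ∈ Icc (0 : ℝ) 1) :
    8 * (1 + f (r + t * y) ^ bq q)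
      ≤ 16 * 4 ^ bq q * 2 ^ bq0 q * A ^ bq q * (1 + |r| ^ bq0 q + |y| ^ bq0 q) := by
  have hb := bq_nonneg hq
  have hA : 1 ≤ A ^ bq q := Real.one_le_rpow hf.one_le hb
  have h4 : (1 : ℝ) ≤ 4 ^ bq q := Real.one_le_rpow (by norm_num) hb
  have segment : |r + t * y| ≤ |r| + |y| := by
    refine (abs_add_le _ _).trans (add_le_add_right ?_ _)
    rw [abs_mul, abs_of_nonneg ht.1]
    exact mul_le_of_le_one_left (abs_nonneg y) ht.2
  have rpow_bq : max 1 |r + t * y| ^ (q 0 * bq q) ≤ 2 ^ bq0 q * (1 + |r| ^ bq0 q + |y| ^ bq0 q) :=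
    calc max 1 |r + t * y| ^ (q 0 * bq q) ≤ max 1 |r + t * y| ^ bq0 q := by
          rw [← Real.rpow_natCast]
          exact Real.rpow_le_rpow_of_exponent_le (le_max_left _ _) (mul_bq_le_bq0 q)
      _ ≤ _ := max_one_abs_pow_le segment (bq0 q)
  have one_le : 1 ≤ 4 ^ bq q * A ^ bq q * (2 ^ bq0 q * (1 + |r| ^ bq0 q + |y| ^ bq0 q)) :=
    one_le_mul_of_one_le_of_one_le (one_le_mul_of_one_le_of_one_le h4 hA)
      (one_le_mul_of_one_le_of_one_le (one_le_pow₀ (by norm_num))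
        (by rw [add_assoc]; exact le_add_of_nonneg_right (by positivity)))
  have := (hf.rpow_le (x := r + t * y) hb).trans
    (mul_le_mul_of_nonneg_left rpow_bq (by positivity))
  linarith

lemma abs_sub_le (hq : ∀ k, 0 ≤ q k) (hD : 0 ≤ D) {x x' T : ℝ} (hT : 1 ≤ T) (hx : |x| ≤ T)
    (hx' : |x'| ≤ T) :
    |f x - f x'| ≤ D * (2 * 4 ^ q 1 * A ^ q 1 * T ^ (q 0 * q 1)) * |x - x'| := by
  have hderiv : ∀ s ∈ Icc (-T) T,
      HasDerivWithinAt f (iteratedDeriv 1 f s) (Icc (-T) T) s := fun s _ => by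
    simpa using (hasDerivAt_iteratedDeriv_of_contDiff hf.selfBounded.contDiff (k := 0)
      (by norm_num) s).hasDerivWithinAt
  have hbound : ∀ s ∈ Icc (-T) T,
      ‖iteratedDeriv 1 f s‖ ≤ D * (2 * 4 ^ q 1 * A ^ q 1 * T ^ (q 0 * q 1)) := fun s hs => by
    have hA : 1 ≤ A ^ q 1 := Real.one_le_rpow hf.one_le (hq 1)
    have rpow_s : f s ^ q 1 ≤ 4 ^ q 1 * A ^ q 1 * T ^ (q 0 * q 1) :=
      (hf.rpow_le (hq 1)).trans (mul_le_mul_of_nonneg_left (Real.rpow_le_rpow (by positivity)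
        (max_le hT (abs_le.2 hs)) (mul_nonneg (hq 0) (hq 1))) (by positivity))
    have one_le : 1 ≤ 4 ^ q 1 * A ^ q 1 * T ^ (q 0 * q 1) :=
      one_le_mul_of_one_le_of_one_le
        (one_le_mul_of_one_le_of_one_le (Real.one_le_rpow (by norm_num) (hq 1)) hA)
        (Real.one_le_rpow hT (mul_nonneg (hq 0) (hq 1)))
    refine (hf.selfBounded.bound 1 (by decide) s).trans (mul_le_mul_of_nonneg_left ?_ hD)
    unfold lossWeight
    linarith
  simpa using (convex_Icc (-T) T).norm_image_sub_le_of_norm_hasDerivWithin_le hderiv hbound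
    (abs_le.1 hx') (abs_le.1 hx)

end SmoothedLoss

end Losses

section RowLaws

variable {p : ℕ}

open scoped MatrixOrder in
lemma quadForm_le_of_eigenvalues_le {A : Matrix (Fin p) (Fin p) ℝ} (hA : A.IsHermitian)
    {M : ℝ} (h : ∀ k, hA.eigenvalues k ≤ M) (x : Fin p → ℝ) :
    ∑ j, ∑ k, x j * x k * A j k ≤ M * ∑ j, x j ^ 2 := by
  have le_smul_one : A ≤ algebraMap ℝ _ M := by
    rw [le_algebraMap_iff_spectrum_le (ha := hA.isSelfAdjoint)]
    intro y hy
    rw [hA.spectrum_real_eq_range_eigenvalues] at hy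
    obtain ⟨k, rfl⟩ := hy
    exact h k
  have form_le := (Matrix.le_iff.1 le_smul_one).dotProduct_mulVec_nonneg x
  rw [Matrix.sub_mulVec, dotProduct_sub, sub_nonneg] at form_le
  calc ∑ j, ∑ k, x j * x k * A j k = star x ⬝ᵥ A.mulVec x := by
        simp only [dotProduct, Matrix.mulVec, Finset.mul_sum]
        refine Finset.sum_congr rfl fun j _ => Finset.sum_congr rfl fun k _ => ?_
        rw [Pi.star_apply, star_trivial]
        ring
    _ ≤ star x ⬝ᵥ (algebraMap ℝ (Matrix (Fin p) (Fin p) ℝ) M).mulVec x := form_le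
    _ = M * ∑ j, x j ^ 2 := by
        rw [Algebra.algebraMap_eq_smul_one, Matrix.smul_mulVec, Matrix.one_mulVec, dotProduct_smul,
          smul_eq_mul]
        simp [dotProduct, pow_two]

lemma quadForm_finset_le {A : Matrix (Fin p) (Fin p) ℝ} {M L : ℝ} (hM : 0 ≤ M)
    (hA : ∀ x : Fin p → ℝ, ∑ j, ∑ k, x j * x k * A j k ≤ M * ∑ j, x j ^ 2)
    {w : Fin p → ℝ} (hw : ∀ j, |w j| ≤ L) (B : Finset (Fin p)) :
    ∑ j ∈ B, ∑ k ∈ B, w j * w k * A j k ≤ M * (B.card * L ^ 2) := by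
  set u : Fin p → ℝ := fun j => if j ∈ B then w j else 0
  calc ∑ j ∈ B, ∑ k ∈ B, w j * w k * A j k = ∑ j, ∑ k, u j * u k * A j k := by
        refine Finset.sum_subset_zero_on_sdiff (Finset.subset_univ B) (fun j hj => ?_)
          fun j hj => Finset.sum_subset_zero_on_sdiff (Finset.subset_univ B) (fun k hk => ?_)
            fun k hk => ?_ <;> simp_all [u]
    _ ≤ M * ∑ j, u j ^ 2 := hA u
    _ = M * ∑ j ∈ B, w j ^ 2 := by simp [u, ite_pow]
    _ ≤ M * (B.card * L ^ 2) := by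
        rw [← nsmul_eq_mul]
        gcongr
        exact Finset.sum_le_card_nsmul _ _ _ fun j _ => sq_le_sq.2 ((hw j).trans (le_abs_self L))

lemma abs_sum_mul_le {L : ℝ} {w : Fin p → ℝ} (hw : ∀ j, |w j| ≤ L) (x : Fin p → ℝ)
    (B : Finset (Fin p)) : |∑ j ∈ B, x j * w j| ≤ L * ∑ j ∈ B, |x j| := by
  rw [Finset.mul_sum]
  refine (Finset.abs_sum_le_sum_abs _ _).trans (Finset.sum_le_sum fun j _ => ?_)
  rw [abs_mul, mul_comm]
  exact mul_le_mul_of_nonneg_right (hw j) (abs_nonneg _)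

lemma integral_abs_pow_le_of_eLpNorm_le {Ω : Type*} [MeasurableSpace Ω] {μ : Measure Ω}
    [IsProbabilityMeasure μ] {f : Ω → ℝ} {M : ℝ} (hM : 0 ≤ M) {l Q : ℕ} (hl : l ≤ Q)
    (hf : AEStronglyMeasurable f μ) (h : eLpNorm f Q μ ≤ ENNReal.ofReal M) :
    ∫ ω, |f ω| ^ l ∂μ ≤ M ^ l := by
  rcases Nat.eq_zero_or_pos l with rfl | hl0
  · simp
  have norm_le : eLpNorm f l μ ≤ ENNReal.ofReal M :=
    (eLpNorm_le_eLpNorm_of_exponent_le (by exact_mod_cast hl) hf).trans h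
  have memLp : MemLp f l μ := ⟨hf, norm_le.trans_lt ENNReal.ofReal_lt_top⟩
  rw [memLp.eLpNorm_eq_integral_rpow_norm (by exact_mod_cast hl0.ne') (ENNReal.natCast_ne_top l),
    ENNReal.ofReal_le_ofReal_iff hM] at norm_le
  simp only [ENNReal.toReal_natCast, Real.rpow_natCast, Real.norm_eq_abs] at norm_le
  have nonneg : 0 ≤ ∫ ω, |f ω| ^ l ∂μ := integral_nonneg fun ω => by positivity
  rw [← Real.rpow_natCast]
  exact (Real.rpow_inv_le_iff_of_pos nonneg hM (by exact_mod_cast hl0)).1 norm_le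

lemma pow_sum_le_card_pow_mul_sum_pow {κ : Type*} (s : Finset κ) {a : κ → ℝ}
    (ha : ∀ i ∈ s, 0 ≤ a i) (l : ℕ) :
    (∑ i ∈ s, a i) ^ (l + 1) ≤ (s.card : ℝ) ^ l * ∑ i ∈ s, a i ^ (l + 1) := by
  rcases s.eq_empty_or_nonempty with rfl | hs
  · simp
  have : (0 : ℝ) < s.card := by exact_mod_cast hs.card_pos
  have := pow_sum_div_card_le_sum_pow ha l
  rw [div_le_iff₀ (by positivity)] at this
  linarith

/-- The law of a row of the design matrix: centred with second moments `Cov / n`, and with moments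
of order `Q` at most `M` at the scale `1 / √n`. -/
structure RowLaw (n Q : ℕ) (M : ℝ) (Cov : Matrix (Fin p) (Fin p) ℝ)
    (P : Measure (EuclideanSpace ℝ (Fin p))) : Prop where
  mean : ∀ j, ∫ x, x j ∂P = 0
  cov : ∀ j k, ∫ x, x j * x k ∂P = Cov j k / n
  moment : ∀ j, eLpNorm (fun x => √(n : ℝ) * x j) Q P ≤ ENNReal.ofReal M

namespace RowLaw

variable {n Q : ℕ} {M : ℝ} {Cov : Matrix (Fin p) (Fin p) ℝ}
  {P : Measure (EuclideanSpace ℝ (Fin p))} (h : RowLaw n Q M Cov P)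

include h

lemma memLp_sqrt_mul (j : Fin p) :
    MemLp (fun x : EuclideanSpace ℝ (Fin p) => √(n : ℝ) * x j) Q P :=
  ⟨(by fun_prop : Measurable _).aestronglyMeasurable, (h.moment j).trans_lt ENNReal.ofReal_lt_top⟩

lemma memLp (hn : 0 < n) (j : Fin p) :
    MemLp (fun x : EuclideanSpace ℝ (Fin p) => x j) Q P := by
  have ne_zero : √(n : ℝ) ≠ 0 := by positivity
  simpa only [inv_mul_cancel_left₀ ne_zero] using (h.memLp_sqrt_mul j).const_mul (√(n : ℝ))⁻¹

variable [IsProbabilityMeasure P]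

lemma integral_abs_pow_le (hn : 0 < n) (hM : 0 ≤ M) {l : ℕ} (hl : l ≤ Q) (j : Fin p) :
    ∫ x, |x j| ^ l ∂P ≤ (M / √(n : ℝ)) ^ l := by
  have scaled := integral_abs_pow_le_of_eLpNorm_le hM hl (h.memLp_sqrt_mul j).1 (h.moment j)
  have sqrt_pos : 0 < √(n : ℝ) := by positivity
  simp only [abs_mul, mul_pow, abs_of_pos sqrt_pos] at scaled
  rw [integral_const_mul] at scaled
  rw [div_pow, le_div_iff₀ (by positivity)]
  linarith

lemma integrable_sum_abs_pow (hn : 0 < n) {l : ℕ} (hl : l ≤ Q) (B : Finset (Fin p)) :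
    Integrable (fun x : EuclideanSpace ℝ (Fin p) => (∑ j ∈ B, |x j|) ^ l) P :=
  integrable_pow_of_memLp (memLp_finsetSum B fun j _ => (h.memLp hn j).abs) hl

lemma integral_sum_abs_pow_le (hn : 0 < n) (hM : 0 ≤ M) {l : ℕ} (hl : l ≤ Q)
    (B : Finset (Fin p)) :
    ∫ x, (∑ j ∈ B, |x j|) ^ l ∂P ≤ (B.card * (M / √(n : ℝ))) ^ l := by
  rcases l with _ | l
  · simp
  have integrable : ∀ j, Integrable (fun x : EuclideanSpace ℝ (Fin p) => |x j| ^ (l + 1)) P :=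
    fun j => integrable_pow_of_memLp (h.memLp hn j).abs hl
  calc ∫ x, (∑ j ∈ B, |x j|) ^ (l + 1) ∂P
      ≤ ∫ x, (B.card : ℝ) ^ l * ∑ j ∈ B, |x j| ^ (l + 1) ∂P :=
        integral_mono (h.integrable_sum_abs_pow hn hl B)
          ((integrable_finsetSum _ fun j _ => integrable j).const_mul _)
          (fun x => pow_sum_le_card_pow_mul_sum_pow B (fun j _ => abs_nonneg _) l)
    _ = (B.card : ℝ) ^ l * ∑ j ∈ B, ∫ x, |x j| ^ (l + 1) ∂P := by
        rw [integral_const_mul, integral_finsetSum _ fun j _ => integrable j]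
    _ ≤ (B.card : ℝ) ^ l * ∑ _j ∈ B, (M / √(n : ℝ)) ^ (l + 1) := by
        gcongr with j _
        exact h.integral_abs_pow_le hn hM hl j
    _ = (B.card * (M / √(n : ℝ))) ^ (l + 1) := by
        rw [Finset.sum_const, nsmul_eq_mul]
        ring

end RowLaw

variable {W : Type*}

/-- The contribution of the coordinates in `B` to the inner products of a row with the points
`pts w`: the block swapped in one step of the Lindeberg argument. -/
noncomputable def blockMap (pts : W → EuclideanSpace ℝ (Fin p)) (B : Finset (Fin p))
    (x : EuclideanSpace ℝ (Fin p)) (w : W) : ℝ :=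
  ∑ j ∈ B, x j * pts w j

lemma measurable_blockMap (pts : W → EuclideanSpace ℝ (Fin p)) (B : Finset (Fin p)) :
    Measurable (blockMap pts B) :=
  measurable_pi_iff.2 fun _ => Finset.measurable_fun_sum _ fun _ _ => by fun_prop

lemma norm_blockMap_le [Fintype W] {pts : W → EuclideanSpace ℝ (Fin p)} {L : ℝ} (hL : 0 ≤ L)
    (hpts : ∀ w, pts w ∈ cube p L) (B : Finset (Fin p)) (x : EuclideanSpace ℝ (Fin p)) :
    ‖blockMap pts B x‖ ≤ L * ∑ j ∈ B, |x j| :=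
  (pi_norm_le_iff_of_nonneg (mul_nonneg hL (Finset.sum_nonneg fun _ _ => abs_nonneg _))).2
    fun w => abs_sum_mul_le (hpts w) x B

namespace RowLaw

variable {n Q : ℕ} {M : ℝ} {Cov : Matrix (Fin p) (Fin p) ℝ}
  {P : Measure (EuclideanSpace ℝ (Fin p))} [IsProbabilityMeasure P] (h : RowLaw n Q M Cov P)

include h

lemma integral_blockMap (hn : 0 < n) (hQ : 1 ≤ Q) (pts : W → EuclideanSpace ℝ (Fin p))
    (B : Finset (Fin p)) (w : W) : ∫ y, y w ∂(P.map (blockMap pts B)) = 0 := by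
  rw [integral_map (measurable_blockMap pts B).aemeasurable
    (measurable_pi_apply w).aestronglyMeasurable]
  have integrable : ∀ j, Integrable (fun x : EuclideanSpace ℝ (Fin p) => x j) P := fun j =>
    (h.memLp hn j).integrable (by exact_mod_cast hQ)
  simp only [blockMap]
  rw [integral_finsetSum _ fun j _ => (integrable j).mul_const _]
  refine Finset.sum_eq_zero fun j _ => ?_
  rw [integral_mul_const, h.mean, zero_mul]

lemma integral_blockMap_mul (hn : 0 < n) (hQ : 2 ≤ Q) (pts : W → EuclideanSpace ℝ (Fin p))
    (B : Finset (Fin p)) (w w' : W) :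
    ∫ y, y w * y w' ∂(P.map (blockMap pts B))
      = (∑ j ∈ B, ∑ k ∈ B, pts w j * pts w' k * Cov j k) / n := by
  have memLp_two : ∀ j, MemLp (fun x : EuclideanSpace ℝ (Fin p) => x j) 2 P := fun j =>
    (h.memLp hn j).mono_exponent (by exact_mod_cast hQ)
  have integrable : ∀ j k, Integrable
      (fun x : EuclideanSpace ℝ (Fin p) => pts w j * pts w' k * (x j * x k)) P := fun j k =>
    ((memLp_two j).integrable_mul (memLp_two k)).const_mul _
  have expand : ∀ x : EuclideanSpace ℝ (Fin p), blockMap pts B x w * blockMap pts B x w'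
      = ∑ j ∈ B, ∑ k ∈ B, pts w j * pts w' k * (x j * x k) := fun x => by
    rw [blockMap, blockMap, Finset.sum_mul_sum]
    exact Finset.sum_congr rfl fun j _ => Finset.sum_congr rfl fun k _ => by ring
  rw [integral_map (measurable_blockMap pts B).aemeasurable
    (by fun_prop : Measurable fun y : W → ℝ => y w * y w').aestronglyMeasurable]
  simp only [expand, Finset.sum_div]
  rw [integral_finsetSum _ fun j _ => integrable_finsetSum _ fun k _ => integrable j k]
  refine Finset.sum_congr rfl fun j _ => ?_
  rw [integral_finsetSum _ fun k _ => integrable j k]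
  refine Finset.sum_congr rfl fun k _ => ?_
  rw [integral_const_mul, h.cov, mul_div_assoc]

variable [Fintype W] {pts : W → EuclideanSpace ℝ (Fin p)} {L : ℝ}

lemma integral_norm_blockMap_pow_le (hn : 0 < n) (hM : 0 ≤ M) (hL : 0 ≤ L)
    (hpts : ∀ w, pts w ∈ cube p L) (B : Finset (Fin p)) {l : ℕ} (hl : l ≤ Q) :
    ∫ y, ‖y‖ ^ l ∂(P.map (blockMap pts B)) ≤ (L * (B.card * (M / √(n : ℝ)))) ^ l := by
  rw [integral_map (measurable_blockMap pts B).aemeasurable (by fun_prop), mul_pow L]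
  calc ∫ x, ‖blockMap pts B x‖ ^ l ∂P ≤ ∫ x, L ^ l * (∑ j ∈ B, |x j|) ^ l ∂P := by
        refine integral_mono_of_nonneg (Filter.Eventually.of_forall fun x => by positivity)
          ((h.integrable_sum_abs_pow hn hl B).const_mul _)
          (Filter.Eventually.of_forall fun x => ?_)
        simp only [← mul_pow]
        exact pow_le_pow_left₀ (norm_nonneg _) (norm_blockMap_le hL hpts B x) l
    _ ≤ L ^ l * (B.card * (M / √(n : ℝ))) ^ l := by
        rw [integral_const_mul]
        gcongr
        exact h.integral_sum_abs_pow_le hn hM hl B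

lemma blockLaw (hn : 0 < n) (hM : 0 ≤ M) {k : ℕ} (hk : k + 3 ≤ Q) {M₀ : ℝ} (hM₀ : 0 ≤ M₀)
    (hCov : ∀ x : Fin p → ℝ, ∑ j, ∑ k, x j * x k * Cov j k ≤ M₀ * ∑ j, x j ^ 2)
    (hL : 0 ≤ L) (hpts : ∀ w, pts w ∈ cube p L) (B : Finset (Fin p)) :
    BlockLaw (P.map (blockMap pts B)) k (L * (B.card * (M / √(n : ℝ))))
      (M₀ * (B.card * L ^ 2) / n) where
  memLp := by
    have hm := measurable_blockMap pts B
    rw [memLp_map_measure_iff (by fun_prop) hm.aemeasurable]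
    have : MemLp (fun x : EuclideanSpace ℝ (Fin p) => L * ∑ j ∈ B, |x j|) (k + 3 : ℕ) P :=
      (memLp_finsetSum B fun j _ =>
        ((h.memLp hn j).mono_exponent (by exact_mod_cast hk)).abs).const_mul L
    exact this.mono hm.aestronglyMeasurable (Filter.Eventually.of_forall fun x =>
      (norm_blockMap_le hL hpts B x).trans (le_abs_self _))
  mean := h.integral_blockMap hn (by omega) pts B
  moment l hl := h.integral_norm_blockMap_pow_le hn hM hL hpts B (hl.trans hk)
  var w := by
    simp only [pow_two (_ : ℝ)]
    rw [h.integral_blockMap_mul hn (by omega) pts B w w, ← pow_two]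
    gcongr
    exact quadForm_finset_le hM₀ hCov (hpts w) B

end RowLaw

lemma pi_map_piCurry_symm {I : Type*} [Fintype I] {κ : I → Type*} [∀ i, Fintype (κ i)]
    {X : (i : I) → κ i → Type*} [∀ i a, MeasurableSpace (X i a)] (μ : ∀ i a, Measure (X i a))
    [∀ i a, IsProbabilityMeasure (μ i a)] :
    (Measure.pi fun i => Measure.pi (μ i)).map (MeasurableEquiv.piCurry X).symm
      = Measure.pi fun α : (i : I) × κ i => μ α.1 α.2 := by
  simpa only [Measure.infinitePi_eq_pi] using Measure.infinitePi_map_piCurry_symm μ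

lemma map_blockMap_eq_pi {P : Measure (EuclideanSpace ℝ (Fin p))} {κ : Type*} [Fintype κ]
    {B : κ → Finset (Fin p)}
    (hB : iIndepFun (fun a (x : EuclideanSpace ℝ (Fin p)) (j : B a) => x j) P)
    (pts : W → EuclideanSpace ℝ (Fin p)) :
    P.map (fun x a => blockMap pts (B a) x) = Measure.pi fun a => P.map (blockMap pts (B a)) := by
  have := hB.isProbabilityMeasure
  refine (iIndepFun_iff_map_fun_eq_pi_map
    fun a => (measurable_blockMap pts (B a)).aemeasurable).1 ?_
  convert hB.comp (fun a (u : B a → ℝ) w => ∑ j : B a, u j * pts w j)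
    (fun a => measurable_pi_iff.2 fun w => Finset.measurable_fun_sum _ fun j _ =>
      (measurable_pi_apply j).mul_const _) using 2 with a
  ext x w
  exact (Finset.sum_coe_sort (B a) fun j => x j * pts w j).symm

lemma pi_map_blockMap {I : Type*} [Fintype I] (P : I → Measure (EuclideanSpace ℝ (Fin p)))
    [∀ i, IsProbabilityMeasure (P i)] {κ : I → Type*} [∀ i, Fintype (κ i)]
    {B : (i : I) → κ i → Finset (Fin p)}
    (hB : ∀ i, iIndepFun (fun a (x : EuclideanSpace ℝ (Fin p)) (j : B i a) => x j) (P i))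
    (pts : W → EuclideanSpace ℝ (Fin p)) :
    (Measure.pi P).map (fun x (α : (i : I) × κ i) => blockMap pts (B α.1 α.2) (x α.1))
      = Measure.pi fun α : (i : I) × κ i => (P α.1).map (blockMap pts (B α.1 α.2)) := by
  have hm : ∀ i, Measurable fun (x : EuclideanSpace ℝ (Fin p)) a => blockMap pts (B i a) x :=
    fun i => measurable_pi_iff.2 fun a => measurable_blockMap pts (B i a)
  have (i : I) (a : κ i) : IsProbabilityMeasure ((P i).map (blockMap pts (B i a))) :=
    Measure.isProbabilityMeasure_map (measurable_blockMap pts (B i a)).aemeasurable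
  have (i : I) : IsProbabilityMeasure ((P i).map fun x a => blockMap pts (B i a) x) :=
    Measure.isProbabilityMeasure_map (hm i).aemeasurable
  calc _ = ((Measure.pi P).map fun x i a => blockMap pts (B i a) (x i)).map
        (MeasurableEquiv.piCurry fun _ _ => W → ℝ).symm :=
        (Measure.map_map (MeasurableEquiv.measurable _)
          (measurable_pi_iff.2 fun i => (hm i).comp (measurable_pi_apply i))).symm
    _ = (Measure.pi fun i => Measure.pi fun a => (P i).map (blockMap pts (B i a))).map
        (MeasurableEquiv.piCurry fun _ _ => W → ℝ).symm := by
        rw [Measure.pi_map_pi fun i => (hm i).aemeasurable]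
        simp only [map_blockMap_eq_pi (hB _)]
    _ = _ := pi_map_piCurry_symm fun i a => (P i).map (blockMap pts (B i a))

end RowLaws

section GaussianRows

variable {p n Q : ℕ} {M : ℝ} {Cov : Matrix (Fin p) (Fin p) ℝ}

/-- The `L^Q` norm of a standard Gaussian variable. -/
noncomputable def gaussianNorm (Q : ℕ) : ℝ := (eLpNorm id Q (gaussianReal 0 1)).toReal

lemma gaussianNorm_nonneg (Q : ℕ) : 0 ≤ gaussianNorm Q := ENNReal.toReal_nonneg

lemma eLpNorm_id_gaussianReal (Q : ℕ) (v : NNReal) :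
    eLpNorm id Q (gaussianReal 0 v) = ENNReal.ofReal (√v * gaussianNorm Q) := by
  have map_eq : (gaussianReal 0 1).map (fun x => √(v : ℝ) * x) = gaussianReal 0 v := by
    rw [gaussianReal_map_const_mul]
    congr 1
    · simp
    · ext
      simp
  have ne_top : eLpNorm id Q (gaussianReal 0 1) ≠ ⊤ := by
    simpa using (memLp_id_gaussianReal (μ := 0) (v := 1) (Q : NNReal)).2.ne
  have comp_eq : (id ∘ fun x : ℝ => √(v : ℝ) * x) = √(v : ℝ) • (id : ℝ → ℝ) := rfl
  rw [← map_eq, eLpNorm_map_measure (by fun_prop) (by fun_prop), comp_eq, eLpNorm_const_smul,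
    ENNReal.ofReal_mul (Real.sqrt_nonneg _), gaussianNorm, ENNReal.ofReal_toReal ne_top,
    Real.enorm_eq_ofReal (Real.sqrt_nonneg _)]

lemma eLpNorm_eval_multivariateGaussian {S : Matrix (Fin p) (Fin p) ℝ} (hS : S.PosSemidef)
    (Q : ℕ) (j : Fin p) :
    eLpNorm (fun x => x j) Q (multivariateGaussian 0 S)
      = ENNReal.ofReal (√(S j j) * gaussianNorm Q) := by
  have hmp := measurePreserving_eval_multivariateGaussian (μ := 0) hS (i := j)
  have := eLpNorm_comp_measurePreserving (p := Q) (g := id) (by fun_prop) hmp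
  rw [Function.id_comp] at this
  rw [this, PiLp.zero_apply, eLpNorm_id_gaussianReal, Real.coe_toNNReal _ hS.diag_nonneg]

lemma integral_eval_multivariateGaussian {S : Matrix (Fin p) (Fin p) ℝ} (hS : S.PosSemidef)
    (j : Fin p) : ∫ x, x j ∂(multivariateGaussian 0 S) = 0 := by
  have hmp := measurePreserving_eval_multivariateGaussian (μ := 0) hS (i := j)
  have := integral_map (μ := multivariateGaussian 0 S) hmp.measurable.aemeasurable
    (f := fun y : ℝ => y) (by fun_prop)
  rw [← this, hmp.map_eq, integral_id_gaussianReal, PiLp.zero_apply]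

lemma rowLaw_multivariateGaussian (hCov : Cov.PosSemidef) (hn : 0 < n)
    (hM : ∀ x : Fin p → ℝ, ∑ j, ∑ k, x j * x k * Cov j k ≤ M * ∑ j, x j ^ 2) (Q : ℕ) :
    RowLaw n Q (√M * gaussianNorm Q) Cov (multivariateGaussian 0 ((1 / (n : ℝ)) • Cov)) := by
  have hS : ((1 / (n : ℝ)) • Cov).PosSemidef := hCov.smul (by positivity)
  refine ⟨integral_eval_multivariateGaussian hS, fun j k => ?_, fun j => ?_⟩
  · have h := covariance_eval_multivariateGaussian (μ := 0) hS j k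
    simp only [covariance, integral_eval_multivariateGaussian hS, sub_zero] at h
    rw [h, Matrix.smul_apply, smul_eq_mul, one_div_mul_eq_div]
  · have diag_le : Cov j j ≤ M := by simpa [Pi.single_apply] using hM (Pi.single j 1)
    have diag_eq : (n : ℝ) * ((1 / (n : ℝ)) • Cov) j j = Cov j j := by
      have : (n : ℝ) ≠ 0 := by positivity
      rw [Matrix.smul_apply, smul_eq_mul]
      field_simp
    change eLpNorm (√(n : ℝ) • fun x : EuclideanSpace ℝ (Fin p) => x j) Q _ ≤ _
    rw [eLpNorm_const_smul, eLpNorm_eval_multivariateGaussian hS,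
      Real.enorm_eq_ofReal (Real.sqrt_nonneg _), ← ENNReal.ofReal_mul (Real.sqrt_nonneg _),
      ← mul_assoc, ← Real.sqrt_mul (Nat.cast_nonneg n), diag_eq]
    have := gaussianNorm_nonneg Q
    gcongr

lemma RowLaw.cov_eq_zero {P : Measure (EuclideanSpace ℝ (Fin p))} (h : RowLaw n Q M Cov P)
    (hn : 0 < n) {j k : Fin p}
    (hjk : IndepFun (fun x : EuclideanSpace ℝ (Fin p) => x j) (fun x => x k) P) :
    Cov j k = 0 := by
  have product := hjk.integral_fun_mul_eq_mul_integral
    (by fun_prop : Measurable _).aestronglyMeasurable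
    (by fun_prop : Measurable _).aestronglyMeasurable
  rw [h.cov, h.mean, zero_mul, div_eq_zero_iff] at product
  exact product.resolve_right (by positivity)

lemma iIndepFun_blocks_multivariateGaussian {S : Matrix (Fin p) (Fin p) ℝ} (hS : S.PosSemidef)
    {κ : Type*} [Finite κ] {B : κ → Finset (Fin p)}
    (h : ∀ a b, a ≠ b → ∀ j ∈ B a, ∀ k ∈ B b, S j k = 0) :
    iIndepFun (fun a (x : EuclideanSpace ℝ (Fin p)) (j : B a) => x j)
      (multivariateGaussian 0 S) := by
  have := Fintype.ofFinite κ
  refine HasGaussianLaw.iIndepFun_of_covariance_eval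
    (X := fun a (j : B a) (x : EuclideanSpace ℝ (Fin p)) => x j) ?_ fun a b hab j k => ?_
  · have : HasGaussianLaw (id : EuclideanSpace ℝ (Fin p) → EuclideanSpace ℝ (Fin p))
        (multivariateGaussian 0 S) := ⟨by rw [Measure.map_id]; infer_instance⟩
    exact this.map (ContinuousLinearMap.pi fun a => ContinuousLinearMap.pi
      fun j : B a => (EuclideanSpace.proj (j : Fin p) : EuclideanSpace ℝ (Fin p) →L[ℝ] ℝ))
  · rw [covariance_eval_multivariateGaussian hS]
    exact h a b hab j j.2 k k.2

end GaussianRows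

section Designs

variable {n p d Q : ℕ}

/-- A partition of `Fin p` into cells of size at most `d`. -/
structure IsBlockPartition {κ : Type*} (d : ℕ) (B : κ → Finset (Fin p)) : Prop where
  disjoint : Pairwise (fun a b => Disjoint (B a) (B b))
  cover : ∀ j, ∃ a, j ∈ B a
  card_le : ∀ a, (B a).card ≤ d

/-- A random design matrix with independent rows `X i` in the sense of `RowLaw`, where the cells of
the family `B i` split the coordinates of `X i` into independent subvectors. -/
structure BlockDesign {Ω : Type*} [MeasurableSpace Ω] {κ : Fin n → Type*} (Q : ℕ) (M : ℝ)
    (Cov : Fin n → Matrix (Fin p) (Fin p) ℝ) (B : ∀ i, κ i → Finset (Fin p))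
    (X : Fin n → Ω → EuclideanSpace ℝ (Fin p)) (μ : Measure Ω) : Prop where
  aemeasurable : ∀ i, AEMeasurable (X i) μ
  iIndepFun : iIndepFun X μ
  rowLaw : ∀ i, RowLaw n Q M (Cov i) (μ.map (X i))
  blocks : ∀ i, ProbabilityTheory.iIndepFun
    (fun a (x : EuclideanSpace ℝ (Fin p)) (j : B i a) => x j) (μ.map (X i))

lemma RowLaw.mono {M M' : ℝ} {Q' : ℕ} {Cov : Matrix (Fin p) (Fin p) ℝ}
    {P : Measure (EuclideanSpace ℝ (Fin p))} [IsProbabilityMeasure P] (h : RowLaw n Q M Cov P)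
    (hQ : Q' ≤ Q) (hM : M ≤ M') : RowLaw n Q' M' Cov P where
  mean := h.mean
  cov := h.cov
  moment j := (eLpNorm_le_eLpNorm_of_exponent_le (by exact_mod_cast hQ)
    (h.memLp_sqrt_mul j).1).trans ((h.moment j).trans (ENNReal.ofReal_le_ofReal hM))

variable {Ω : Type*} [MeasurableSpace Ω] {μ : Measure Ω} {M M' : ℝ}

lemma rowLaw_map {Cov : Matrix (Fin p) (Fin p) ℝ} {X : Ω → EuclideanSpace ℝ (Fin p)}
    (hX : AEMeasurable X μ) (mean : ∀ j, ∫ ω, X ω j ∂μ = 0)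
    (cov : ∀ j k, ∫ ω, X ω j * X ω k ∂μ = Cov j k / n)
    (moment : ∀ j, eLpNorm (fun ω => √(n : ℝ) * X ω j) Q μ ≤ ENNReal.ofReal M) :
    RowLaw n Q M Cov (μ.map X) where
  mean j := by
    rw [integral_map hX (by fun_prop : Measurable _).aestronglyMeasurable]
    exact mean j
  cov j k := by
    rw [integral_map hX (by fun_prop : Measurable _).aestronglyMeasurable]
    exact cov j k
  moment j := by
    rw [eLpNorm_map_measure (by fun_prop : Measurable _).aestronglyMeasurable hX]
    exact moment j

lemma iIndepFun_map_of_comp {E ι : Type*} [MeasurableSpace E] [Finite ι] {β : ι → Type*}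
    [∀ i, MeasurableSpace (β i)] {X : Ω → E} (hX : AEMeasurable X μ) {f : (i : ι) → E → β i}
    (hf : ∀ i, Measurable (f i)) (h : iIndepFun (fun i ω => f i (X ω)) μ) :
    iIndepFun f (μ.map X) := by
  have := Fintype.ofFinite ι
  have := h.isProbabilityMeasure
  have := Measure.isProbabilityMeasure_map hX
  have map_map : ∀ i, (μ.map X).map (f i) = μ.map fun ω => f i (X ω) := fun i =>
    AEMeasurable.map_map_of_aemeasurable (hf i).aemeasurable hX
  rw [iIndepFun_iff_map_fun_eq_pi_map fun i => (hf i).aemeasurable,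
    AEMeasurable.map_map_of_aemeasurable (measurable_pi_iff.2 hf).aemeasurable hX]
  simp only [map_map]
  exact (iIndepFun_iff_map_fun_eq_pi_map fun i => (hf i).comp_aemeasurable hX).1 h

lemma integral_comp_eq_integral_pi {ι E : Type*} [Fintype ι] [MeasurableSpace E]
    {X : ι → Ω → E} (hX : ∀ i, AEMeasurable (X i) μ) (hi : iIndepFun X μ) {F : (ι → E) → ℝ}
    (hF : Measurable F) :
    ∫ ω, F (fun i => X i ω) ∂μ = ∫ x, F x ∂(Measure.pi fun i => μ.map (X i)) := by
  have := hi.isProbabilityMeasure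
  rw [← (iIndepFun_iff_map_fun_eq_pi_map hX).1 hi, integral_map (aemeasurable_pi_lambda _ hX)
    hF.aestronglyMeasurable]

variable {κ : Fin n → Type*} {Cov : Fin n → Matrix (Fin p) (Fin p) ℝ}
  {B : ∀ i, κ i → Finset (Fin p)} {X : Fin n → Ω → EuclideanSpace ℝ (Fin p)}

lemma BlockDesign.isProbabilityMeasure_map (h : BlockDesign Q M Cov B X μ) (i : Fin n) :
    IsProbabilityMeasure (μ.map (X i)) :=
  have := h.iIndepFun.isProbabilityMeasure
  Measure.isProbabilityMeasure_map (h.aemeasurable i)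

lemma BlockDesign.mono {Q' : ℕ} (h : BlockDesign Q M Cov B X μ) (hQ : Q' ≤ Q) (hM : M ≤ M') :
    BlockDesign Q' M' Cov B X μ where
  aemeasurable := h.aemeasurable
  iIndepFun := h.iIndepFun
  rowLaw i := have := h.isProbabilityMeasure_map i; (h.rowLaw i).mono hQ hM
  blocks := h.blocks

lemma blockDesign_of_moments [∀ i, Finite (κ i)] (hX : ∀ i, AEMeasurable (X i) μ)
    (hind : iIndepFun X μ) (mean : ∀ i j, ∫ ω, X i ω j ∂μ = 0)
    (cov : ∀ i j k, ∫ ω, X i ω j * X i ω k ∂μ = Cov i j k / n)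
    (moment : ∀ i j, eLpNorm (fun ω => √(n : ℝ) * X i ω j) Q μ ≤ ENNReal.ofReal M)
    (hB : ∀ i, iIndepFun (fun a ω (j : B i a) => X i ω j) μ) :
    BlockDesign Q M Cov B X μ where
  aemeasurable := hX
  iIndepFun := hind
  rowLaw i := rowLaw_map (hX i) (mean i) (cov i) (moment i)
  blocks i := iIndepFun_map_of_comp (hX i) (fun a => by fun_prop) (hB i)

lemma exists_blockDesign_of_blockDependent (hX : ∀ i, AEMeasurable (X i) μ)
    (hind : iIndepFun X μ) (mean : ∀ i j, ∫ ω, X i ω j ∂μ = 0)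
    (cov : ∀ i j k, ∫ ω, X i ω j * X i ω k ∂μ = Cov i j k / n)
    (moment : ∀ i j, eLpNorm (fun ω => √(n : ℝ) * X i ω j) Q μ ≤ ENNReal.ofReal M)
    (hblock : ∀ i, BlockDependent d (X i) μ) :
    ∃ (k : Fin n → ℕ) (B : ∀ i, Fin (k i) → Finset (Fin p)),
      (∀ i, IsBlockPartition d (B i)) ∧ BlockDesign Q M Cov B X μ := by
  choose k _ B disjoint cover card_le hB using hblock
  exact ⟨k, B, fun i => ⟨disjoint i, cover i, card_le i⟩,
    blockDesign_of_moments hX hind mean cov moment hB⟩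

/-- Independent cells are uncorrelated, and uncorrelated Gaussian cells are independent. -/
lemma BlockDesign.of_multivariateGaussian [∀ i, Finite (κ i)] (hX : BlockDesign Q M Cov B X μ)
    (hn : 0 < n) {Ω' : Type*} [MeasurableSpace Ω'] {ν : Measure Ω'}
    {G : Fin n → Ω' → EuclideanSpace ℝ (Fin p)} (hG : ProbabilityTheory.iIndepFun G ν)
    (hlaw : ∀ i, HasLaw (G i) (multivariateGaussian 0 ((1 / (n : ℝ)) • Cov i)) ν)
    (hCov : ∀ i, (Cov i).PosSemidef)
    (hM : ∀ i, ∀ x : Fin p → ℝ, ∑ j, ∑ k, x j * x k * Cov i j k ≤ M' * ∑ j, x j ^ 2) :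
    BlockDesign Q (√M' * gaussianNorm Q) Cov B G ν where
  aemeasurable i := (hlaw i).aemeasurable
  iIndepFun := hG
  rowLaw i := by
    rw [(hlaw i).map_eq]
    exact rowLaw_multivariateGaussian (hCov i) hn (hM i) Q
  blocks i := by
    rw [(hlaw i).map_eq]
    refine iIndepFun_blocks_multivariateGaussian ((hCov i).smul (by positivity))
      fun a b hab j hj k hk => ?_
    have indep : IndepFun (fun x : EuclideanSpace ℝ (Fin p) => x j) (fun x => x k)
        (μ.map (X i)) :=
      ((hX.blocks i).indepFun hab).comp (φ := fun u : B i a → ℝ => u ⟨j, hj⟩)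
        (ψ := fun u : B i b → ℝ => u ⟨k, hk⟩) (by fun_prop) (by fun_prop)
    rw [Matrix.smul_apply, (hX.rowLaw i).cov_eq_zero hn indep, smul_zero]

end Designs

section BlockSums

variable {p d : ℕ}

lemma IsBlockPartition.one_le {κ : Type*} {B : κ → Finset (Fin p)}
    (h : IsBlockPartition d B) (hp : 0 < p) : 1 ≤ d := by
  obtain ⟨a, ha⟩ := h.cover ⟨0, hp⟩
  exact (Finset.card_pos.2 ⟨_, ha⟩).trans_le (h.card_le a)

variable {κ : Type*} [Fintype κ] {B : κ → Finset (Fin p)}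

namespace IsBlockPartition

lemma sum_sum (h : IsBlockPartition d B) (F : Fin p → ℝ) : ∑ a, ∑ j ∈ B a, F j = ∑ j, F j := by
  classical
  rw [← Finset.sum_biUnion fun a _ b _ hab => h.disjoint hab]
  congr 1
  ext j
  simpa using h.cover j

lemma sum_card (h : IsBlockPartition d B) : ∑ a, ((B a).card : ℝ) = p := by
  simpa using h.sum_sum fun _ => 1

lemma sum_card_pow_le (h : IsBlockPartition d B) (l : ℕ) :
    ∑ a, ((B a).card : ℝ) ^ (l + 1) ≤ p * (d : ℝ) ^ l := by
  rw [← h.sum_card, Finset.sum_mul]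
  refine Finset.sum_le_sum fun a _ => ?_
  rw [pow_succ, mul_comm]
  have : ((B a).card : ℝ) ≤ d := by exact_mod_cast h.card_le a
  gcongr

end IsBlockPartition

lemma sum_filter_sigma_fst {I : Type*} [Fintype I] [DecidableEq I] {κ : I → Type*}
    [∀ i, Fintype (κ i)] (F : ((i : I) × κ i) → ℝ) (i : I) :
    ∑ α with Sigma.fst α = i, F α = ∑ a, F ⟨i, a⟩ := by
  rw [Finset.sum_filter, Fintype.sum_sigma, Finset.sum_eq_single i]
  · simp
  · intro i' _ hi'
    simp [hi']
  · simp

end BlockSums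

section Nets

variable {p : ℕ}

/-- `W` is a finite `δ`-net of `S` in the uniform norm, made of points of `S`. -/
structure IsUniformNet (δ : ℝ) (S : Set (EuclideanSpace ℝ (Fin p)))
    (W : Finset (EuclideanSpace ℝ (Fin p))) : Prop where
  subset : ∀ w ∈ W, w ∈ S
  exists_close : ∀ w ∈ S, ∃ w' ∈ W, ∀ j, |w j - w' j| ≤ δ

lemma IsUniformNet.nonempty {δ : ℝ} {S : Set (EuclideanSpace ℝ (Fin p))}
    {W : Finset (EuclideanSpace ℝ (Fin p))} (h : IsUniformNet δ S W) (hS : S.Nonempty) :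
    W.Nonempty :=
  let ⟨w, hw⟩ := hS
  let ⟨w', hw', _⟩ := h.exists_close w hw
  ⟨w', hw'⟩

lemma abs_sub_le_of_floor_div_eq {a b δ : ℝ} (hδ : 0 < δ) (h : ⌊a / δ⌋ = ⌊b / δ⌋) :
    |a - b| ≤ δ := by
  have hd := (Int.abs_sub_lt_one_of_floor_eq_floor h).le
  rwa [← sub_div, abs_div, abs_of_pos hδ, div_le_one hδ] at hd

lemma card_Icc_floor_le {L δ : ℝ} (hδ : 0 < δ) (hδL : δ ≤ L) :
    ((Finset.Icc 0 ⌊2 * L / δ⌋).card : ℝ) ≤ 3 * L / δ := by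
  have hL : 1 ≤ L / δ := (one_le_div hδ).2 hδL
  have hfloor : (0 : ℤ) ≤ ⌊2 * L / δ⌋ := Int.floor_nonneg.2 (div_nonneg (by linarith) hδ.le)
  have hcard : ((Finset.Icc 0 ⌊2 * L / δ⌋).card : ℤ) = ⌊2 * L / δ⌋ + 1 := by
    rw [Int.card_Icc, sub_zero, Int.toNat_of_nonneg (by lia)]
  calc ((Finset.Icc 0 ⌊2 * L / δ⌋).card : ℝ) = (⌊2 * L / δ⌋ : ℝ) + 1 := by exact_mod_cast hcard
    _ ≤ 2 * L / δ + L / δ := add_le_add (Int.floor_le _) hL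
    _ = 3 * L / δ := by ring

lemma exists_isUniformNet {S : Set (EuclideanSpace ℝ (Fin p))} {L δ : ℝ} (hδ : 0 < δ)
    (hδL : δ ≤ L) (hS : S ⊆ cube p L) :
    ∃ W, IsUniformNet δ S W ∧ (W.card : ℝ) ≤ (3 * L / δ) ^ p := by
  classical
  -- Sort the points of `S` by the grid cell of side `δ` they lie in and keep one in each cell.
  let cell (w : EuclideanSpace ℝ (Fin p)) (j : Fin p) : ℤ := ⌊(w j + L) / δ⌋
  let cells : Finset (Fin p → ℤ) := Fintype.piFinset fun _ => Finset.Icc 0 ⌊2 * L / δ⌋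
  have cell_mem : MapsTo cell S cells := fun w hw => by
    simp only [cells, cell, Finset.mem_coe, Fintype.mem_piFinset, Finset.mem_Icc]
    intro j
    obtain ⟨hl, hu⟩ := abs_le.1 (hS hw j)
    exact ⟨Int.floor_nonneg.2 (div_nonneg (by linarith) hδ.le),
      Int.floor_le_floor (div_le_div_of_nonneg_right (by linarith) hδ.le)⟩
  obtain ⟨T, hTS, hT⟩ := exists_subset_bijOn S cell
  have hTfin : T.Finite := Finite.of_finite_image
    ((cells.finite_toSet.subset cell_mem.image_subset).subset hT.image_eq.subset) hT.injOn
  refine ⟨hTfin.toFinset, ⟨fun w hw => hTS (hTfin.mem_toFinset.1 hw), fun w hw => ?_⟩, ?_⟩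
  · obtain ⟨w', hw', hcell⟩ := hT.surjOn (mem_image_of_mem cell hw)
    refine ⟨w', hTfin.mem_toFinset.2 hw', fun j => ?_⟩
    simpa using abs_sub_le_of_floor_div_eq hδ (congrFun hcell j).symm
  · have hcard : hTfin.toFinset.card ≤ cells.card := Finset.card_le_card_of_injOn cell
      (fun w hw => cell_mem (hTS (hTfin.mem_toFinset.1 hw))) (by simpa using hT.injOn)
    calc (hTfin.toFinset.card : ℝ) ≤ cells.card := by exact_mod_cast hcard
      _ = ((Finset.Icc 0 ⌊2 * L / δ⌋).card : ℝ) ^ p := by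
        simp [cells, Fintype.card_piFinset]
      _ ≤ (3 * L / δ) ^ p := pow_le_pow_left₀ (by positivity) (card_Icc_floor_le hδ hδL) p

lemma log_card_le_mul_logPlus {m p : ℕ} {L δ : ℝ} (hδ : 0 < δ) (hδL : δ ≤ L) (hm : 0 < m)
    (h : (m : ℝ) ≤ (3 * L / δ) ^ p) : Real.log m ≤ p * (3 * logPlus (L / δ)) := by
  have hL : 0 < L := hδ.trans_le hδL
  have hlog := Real.log_le_log (by exact_mod_cast hm) h
  rw [Real.log_pow, mul_div_assoc, Real.log_mul (by norm_num) (by positivity)] at hlog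
  refine hlog.trans (mul_le_mul_of_nonneg_left ?_ (Nat.cast_nonneg p))
  have hlog3 := Real.log_le_sub_one_of_pos (by norm_num : (0 : ℝ) < 3)
  have hone : 1 ≤ logPlus (L / δ) := le_max_left _ _
  have hle : Real.log (L / δ) ≤ logPlus (L / δ) := le_max_right _ _
  linarith

end Nets

section SoftMin

/-- The soft minimum of `h` over a finite type at inverse temperature `β`. -/
noncomputable def softMin {W : Type*} [Fintype W] (β : ℝ) (h : W → ℝ) : ℝ :=
  -(1 / β) * Real.log (∑ w, Real.exp (-β * h w))

variable {W : Type*} [Fintype W] {β : ℝ}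

lemma softMin_le (hβ : 0 < β) (h : W → ℝ) (w : W) : softMin β h ≤ h w := by
  have hexp : Real.exp (-β * h w) ≤ ∑ w, Real.exp (-β * h w) :=
    Finset.single_le_sum (f := fun w => Real.exp (-β * h w))
      (fun w _ => (Real.exp_pos _).le) (Finset.mem_univ w)
  have hlog := Real.log_le_log (Real.exp_pos _) hexp
  rw [Real.log_exp] at hlog
  rw [softMin, neg_mul, one_div_mul_eq_div, ← neg_div, div_le_iff₀ hβ]
  linarith

lemma exists_le_softMin_add [Nonempty W] (hβ : 0 < β) (h : W → ℝ) :
    ∃ w, h w ≤ softMin β h + Real.log (Fintype.card W) / β := by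
  obtain ⟨w, hw⟩ := Finite.exists_min h
  have hpos : 0 < ∑ w, Real.exp (-β * h w) :=
    Finset.sum_pos (fun w _ => Real.exp_pos _) Finset.univ_nonempty
  have hsum : ∑ w, Real.exp (-β * h w) ≤ Fintype.card W * Real.exp (-β * h w) := by
    rw [← nsmul_eq_mul, ← Finset.card_univ]
    refine Finset.sum_le_card_nsmul _ _ _ fun v _ => Real.exp_le_exp.2 ?_
    nlinarith [hw v]
  have hlog := Real.log_le_log hpos hsum
  rw [Real.log_mul (by exact_mod_cast Fintype.card_ne_zero) (Real.exp_pos _).ne',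
    Real.log_exp] at hlog
  refine ⟨w, ?_⟩
  rw [softMin, neg_mul, one_div_mul_eq_div, ← neg_div, ← add_div, le_div_iff₀ hβ]
  linarith

lemma abs_ciInf_sub_softMin_le {E : Type*} {S : Set E} {W : Finset E} (hWS : ∀ w ∈ W, w ∈ S)
    (hW : W.Nonempty) (hβ : 0 < β) {h h' : E → ℝ} {η : ℝ}
    (hnear : ∀ w ∈ S, ∃ w' ∈ W, |h w - h' w'| ≤ η) (hself : ∀ w ∈ W, |h w - h' w| ≤ η) :
    |(⨅ w : S, h w) - softMin β (fun w : W => h' w)| ≤ η + Real.log W.card / β := by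
  have : Nonempty W := hW.to_subtype
  obtain ⟨w₀, hw₀⟩ := exists_le_softMin_add hβ (fun w : W => h' w)
  rw [Fintype.card_coe] at hw₀
  have : Nonempty S := ⟨⟨w₀, hWS _ w₀.2⟩⟩
  have hlower (w : S) : softMin β (fun w : W => h' w) - η ≤ h w := by
    obtain ⟨w', hw', hclose⟩ := hnear w w.2
    linarith [(abs_le.1 hclose).1, softMin_le hβ (fun w : W => h' w) ⟨w', hw'⟩]
  have hinf : (⨅ w : S, h w) ≤ h w₀ :=
    ciInf_le ⟨_, forall_mem_range.2 hlower⟩ (⟨w₀, hWS _ w₀.2⟩ : S)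
  have hlog : 0 ≤ Real.log W.card / β := div_nonneg
    (Real.log_nonneg (by exact_mod_cast hW.card_pos)) hβ.le
  rw [abs_le]
  constructor
  · linarith [le_ciInf hlower]
  · linarith [(abs_le.1 (hself w₀ w₀.2)).2]

end SoftMin

section Measurability

variable {n p : ℕ}

lemma continuous_empRisk {ℓ : Fin n → ℝ → ℝ} (hℓ : ∀ i, Continuous (ℓ i))
    (R : EuclideanSpace ℝ (Fin p) → ℝ) (w : EuclideanSpace ℝ (Fin p)) :
    Continuous (empRisk ℓ R w) :=
  (continuous_const.mul (continuous_finsetSum _ fun i _ => (hℓ i).comp (by fun_prop))).add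
    continuous_const

lemma isCompact_cube (p : ℕ) (L : ℝ) : IsCompact (cube p L) := by
  have hpre : cube p L =
      (EuclideanSpace.equiv (Fin p) ℝ) ⁻¹' (Set.univ.pi fun _ => Icc (-L) L) := by
    ext w
    simp only [cube, mem_ofPred_eq, mem_preimage, mem_univ_pi, mem_Icc, abs_le]
    rfl
  rw [hpre]
  exact (EuclideanSpace.equiv (Fin p) ℝ).toHomeomorph.isCompact_preimage.2
    (isCompact_univ_pi fun _ => isCompact_Icc)

lemma exists_abs_loss_le {ℓ : Fin n → ℝ → ℝ} (hℓ : ∀ i, Continuous (ℓ i)) (L : ℝ)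
    (A : Fin n → EuclideanSpace ℝ (Fin p)) :
    ∃ C, ∀ w ∈ cube p L, |(1 / (n : ℝ)) * ∑ i, ℓ i (∑ j, A i j * w j)| ≤ C := by
  have hc : Continuous fun w : EuclideanSpace ℝ (Fin p) =>
      (1 / (n : ℝ)) * ∑ i, ℓ i (∑ j, A i j * w j) :=
    continuous_const.mul (continuous_finsetSum _ fun i _ => (hℓ i).comp (by fun_prop))
  exact (isCompact_cube p L).exists_bound_of_continuousOn hc.continuousOn

lemma bddBelow_range_of_abs_sub_le {ι : Type*} {u v : ι → ℝ} {C : ℝ}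
    (h : ∀ w, |u w - v w| ≤ C) (hv : BddBelow (range v)) : BddBelow (range u) := by
  obtain ⟨m, hm⟩ := hv
  refine ⟨m - C, forall_mem_range.2 fun w => ?_⟩
  linarith [(abs_le.1 (h w)).1, hm (mem_range_self w)]

lemma bddBelow_range_empRisk_iff {ℓ : Fin n → ℝ → ℝ} (hℓ : ∀ i, Continuous (ℓ i))
    (R : EuclideanSpace ℝ (Fin p) → ℝ) {S : Set (EuclideanSpace ℝ (Fin p))} {L : ℝ}
    (hS : S ⊆ cube p L) (A : Fin n → EuclideanSpace ℝ (Fin p)) :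
    BddBelow (range fun w : S => empRisk ℓ R w A) ↔ BddBelow (range fun w : S => R w) := by
  obtain ⟨C, hC⟩ := exists_abs_loss_le hℓ L A
  have hdiff (w : S) : |empRisk ℓ R w A - R w| ≤ C := by
    simpa only [empRisk, add_sub_cancel_right] using hC w (hS w.2)
  exact ⟨bddBelow_range_of_abs_sub_le fun w => abs_sub_comm (R w) _ ▸ hdiff w,
    bddBelow_range_of_abs_sub_le hdiff⟩

lemma measurable_minRisk {ℓ : Fin n → ℝ → ℝ} (hℓ : ∀ i, Continuous (ℓ i))
    (R : EuclideanSpace ℝ (Fin p) → ℝ) {S : Set (EuclideanSpace ℝ (Fin p))} {L : ℝ}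
    (hS : S ⊆ cube p L) : Measurable (minRisk ℓ R S) := by
  by_cases hR : BddBelow (range fun w : S => R w)
  · exact UpperSemicontinuous.measurable (upperSemicontinuous_ciInf
      (fun A => (bddBelow_range_empRisk_iff hℓ R hS A).2 hR)
      fun w => (continuous_empRisk hℓ R w).upperSemicontinuous)
  · have hzero : minRisk ℓ R S = fun _ => 0 := funext fun A =>
      Real.iInf_of_not_bddBelow fun h => hR ((bddBelow_range_empRisk_iff hℓ R hS A).1 h)
    rw [hzero]
    exact measurable_const

end Measurability

section Discretization

variable {n p : ℕ}

lemma softRisk_eq_softMin {ι W : Type*} [Fintype ι] [Fintype W] (hn : 0 < n) {b : ℝ} (hb : 0 < b)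
    (f : Fin n → ℝ → ℝ) (row : ι → Fin n) (R : EuclideanSpace ℝ (Fin p) → ℝ)
    {pts : W → EuclideanSpace ℝ (Fin p)} {z : ι → W → ℝ} {A : Fin n → EuclideanSpace ℝ (Fin p)}
    (hz : ∀ i w, ∑ α with row α = i, z α w = ∑ j, A i j * pts w j) :
    softRisk n b f row (fun w => R (pts w)) z
      = softMin (n * b) (fun w => empRisk f R (pts w) A) := by
  simp only [softRisk, softMin, empRisk, hz]
  refine congrArg (fun s => -(1 / (n * b)) * Real.log s) (Finset.sum_congr rfl fun w _ => ?_)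
  congr 1
  field_simp
  ring

lemma abs_empRisk_sub_le (hn : 0 < n) {ℓ f : Fin n → ℝ → ℝ} {ε : ℝ}
    (hfℓ : ∀ i x, |f i x - ℓ i x| ≤ ε) {R : EuclideanSpace ℝ (Fin p) → ℝ}
    {w w' : EuclideanSpace ℝ (Fin p)} {r : ℝ} (hR : |R w - R w'| ≤ r)
    {A : Fin n → EuclideanSpace ℝ (Fin p)} {Δ : Fin n → ℝ}
    (hΔ : ∀ i, |f i (∑ j, A i j * w j) - f i (∑ j, A i j * w' j)| ≤ Δ i) :
    |empRisk ℓ R w A - empRisk f R w' A| ≤ ε + r + (1 / (n : ℝ)) * ∑ i, Δ i := by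
  have hn0 : (0 : ℝ) < n := by exact_mod_cast hn
  have hterm (i : Fin n) :
      |ℓ i (∑ j, A i j * w j) - f i (∑ j, A i j * w' j)| ≤ ε + Δ i := by
    refine (abs_sub_le _ (f i (∑ j, A i j * w j)) _).trans (add_le_add ?_ (hΔ i))
    rw [abs_sub_comm]
    exact hfℓ i _
  have hsum : |(1 / (n : ℝ)) * ∑ i, ℓ i (∑ j, A i j * w j)
      - (1 / (n : ℝ)) * ∑ i, f i (∑ j, A i j * w' j)| ≤ ε + (1 / (n : ℝ)) * ∑ i, Δ i := by
    rw [← mul_sub, ← Finset.sum_sub_distrib, abs_mul, abs_of_pos (by positivity)]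
    calc (1 / (n : ℝ)) * |∑ i, (ℓ i (∑ j, A i j * w j) - f i (∑ j, A i j * w' j))|
        ≤ (1 / (n : ℝ)) * ∑ i, (ε + Δ i) := by
          gcongr
          exact (Finset.abs_sum_le_sum_abs _ _).trans (Finset.sum_le_sum fun i _ => hterm i)
      _ = ε + (1 / (n : ℝ)) * ∑ i, Δ i := by
          rw [Finset.sum_add_distrib, mul_add]
          simp [hn0.ne']
  simp only [empRisk, add_sub_add_comm]
  refine (abs_add_le _ _).trans ?_
  linarith

lemma abs_minRisk_sub_softRisk_le {ι : Type*} [Fintype ι] {row : ι → Fin n} (hn : 0 < n) {b : ℝ}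
    (hb : 0 < b) {ℓ f : Fin n → ℝ → ℝ} {ε : ℝ} (hfℓ : ∀ i x, |f i x - ℓ i x| ≤ ε)
    {R : EuclideanSpace ℝ (Fin p) → ℝ} {S : Set (EuclideanSpace ℝ (Fin p))} {L δ : ℝ}
    (hδ : 0 ≤ δ) (hS : S ⊆ cube p L) {W : Finset (EuclideanSpace ℝ (Fin p))}
    (hnet : IsUniformNet δ S W) (hW : W.Nonempty) {r : ℝ}
    (hR : ∀ w ∈ cube p L, ∀ w' ∈ cube p L, (∀ j, |w j - w' j| ≤ δ) → |R w - R w'| ≤ r)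
    {A : Fin n → EuclideanSpace ℝ (Fin p)} {z : ι → W → ℝ}
    (hz : ∀ i (w : W), ∑ α with row α = i, z α w = ∑ j, A i j * w.1 j) {Δ : Fin n → ℝ}
    (hΔ : ∀ i, ∀ w ∈ cube p L, ∀ w' ∈ cube p L, (∀ j, |w j - w' j| ≤ δ) →
      |f i (∑ j, A i j * w j) - f i (∑ j, A i j * w' j)| ≤ Δ i) :
    |minRisk ℓ R S A - softRisk n b f row (fun w : W => R w) z|
      ≤ ε + r + (1 / (n : ℝ)) * ∑ i, Δ i + Real.log W.card / (n * b) := by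
  have hclose {w w' : EuclideanSpace ℝ (Fin p)} (hw : w ∈ cube p L) (hw' : w' ∈ cube p L)
      (hww' : ∀ j, |w j - w' j| ≤ δ) :
      |empRisk ℓ R w A - empRisk f R w' A| ≤ ε + r + (1 / (n : ℝ)) * ∑ i, Δ i :=
    abs_empRisk_sub_le hn hfℓ (hR w hw w' hw' hww') fun i => hΔ i w hw w' hw' hww'
  rw [softRisk_eq_softMin hn hb f row R hz]
  refine abs_ciInf_sub_softMin_le hnet.subset hW (by positivity)
    (h := fun w => empRisk ℓ R w A) (h' := fun w => empRisk f R w A) (fun w hw => ?_)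
    fun w hw => ?_
  · obtain ⟨w', hw', hww'⟩ := hnet.exists_close w hw
    exact ⟨w', hw', hclose (hS hw) (hS (hnet.subset w' hw')) hww'⟩
  · have hwc := hS (hnet.subset w hw)
    exact hclose hwc hwc fun j => by rwa [sub_self, abs_zero]

end Discretization

section Oscillation

variable {n p : ℕ} {q : Fin 4 → ℝ}

lemma rpow_mul_sqrt_mul_max_le (hq : ∀ k, 0 ≤ q k) {L U : ℝ} (hL : 0 ≤ L) (hU : 0 ≤ U) :
    (L * √(n : ℝ) * max 1 U) ^ (q 0 * q 1)
      ≤ L ^ (q 0 * q 1) * (n : ℝ) ^ (q 0 * q 1 / 2) * (1 + U ^ bq0 q) := by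
  rw [Real.mul_rpow (by positivity) (by positivity), Real.mul_rpow hL (by positivity),
    Real.sqrt_eq_rpow, ← Real.rpow_mul (Nat.cast_nonneg n), one_div_mul_eq_div]
  refine mul_le_mul_of_nonneg_left ?_ (by positivity)
  calc max 1 U ^ (q 0 * q 1) ≤ max 1 U ^ (bq0 q : ℝ) :=
        Real.rpow_le_rpow_of_exponent_le (le_max_left _ _) (mul_one_le_bq0 hq)
    _ = max 1 U ^ bq0 q := Real.rpow_natCast _ _
    _ ≤ 1 + U ^ bq0 q := by
      rcases le_total 1 U with h | h
      · rw [max_eq_right h]; linarith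
      · rw [max_eq_left h, one_pow]; linarith [pow_nonneg hU (bq0 q)]

/-- Bound on the oscillation, at scale `δ` on the cube `[-L, L]^p`, of `w ↦ f (x ⬝ w)` for a loss
`f` satisfying `SmoothedLoss q A D`, in terms of the scaled `ℓ¹` norm of the row `x`. -/
noncomputable def lossOsc (n : ℕ) (q : Fin 4 → ℝ) (A D L δ : ℝ)
    (x : EuclideanSpace ℝ (Fin p)) : ℝ :=
  D * (2 * 4 ^ q 1 * A ^ q 1) * L ^ (q 0 * q 1) * (δ * (n : ℝ) ^ ((q 0 * q 1 + 1) / 2))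
    * ((∑ j, |x j|) / √(n : ℝ) + ((∑ j, |x j|) / √(n : ℝ)) ^ (bq0 q + 1))

-- Both arguments lie in `[-T, T]` with `T = L √n max(1, U)`, and they differ by at most `δ √n U`.
lemma SmoothedLoss.abs_sub_le_of_close {A D : ℝ} {f : ℝ → ℝ} (hf : SmoothedLoss q A D f)
    (hq : ∀ k, 0 ≤ q k) (hn : 0 < n) (hD : 0 ≤ D) {L δ : ℝ} (hL : 1 ≤ L)
    {w w' : EuclideanSpace ℝ (Fin p)} (hw : w ∈ cube p L) (hw' : w' ∈ cube p L)
    (hδ : ∀ j, |w j - w' j| ≤ δ) (x : EuclideanSpace ℝ (Fin p)) :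
    |f (∑ j, x j * w j) - f (∑ j, x j * w' j)| ≤ lossOsc n q A D L δ x := by
  have hA : 0 ≤ A := zero_le_one.trans hf.one_le
  have hn1 : (1 : ℝ) ≤ √(n : ℝ) := by
    rw [Real.one_le_sqrt]; exact_mod_cast hn
  set U : ℝ := (∑ j, |x j|) / √(n : ℝ) with hU
  have hU0 : 0 ≤ U := by positivity
  have hsum : ∑ j, |x j| = √(n : ℝ) * U := by rw [hU]; field_simp
  set T : ℝ := L * √(n : ℝ) * max 1 U
  have hT1 : 1 ≤ T := one_le_mul_of_one_le_of_one_le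
    (one_le_mul_of_one_le_of_one_le hL hn1) (le_max_left _ _)
  have hdot {v : EuclideanSpace ℝ (Fin p)} (hv : v ∈ cube p L) : |∑ j, x j * v j| ≤ T := by
    refine (abs_sum_mul_le hv x _).trans ?_
    rw [hsum, ← mul_assoc]
    exact mul_le_mul_of_nonneg_left (le_max_right _ _) (by positivity)
  have hdiff : |∑ j, x j * w j - ∑ j, x j * w' j| ≤ δ * (√(n : ℝ) * U) := by
    simp only [← hsum, ← Finset.sum_sub_distrib, ← mul_sub]
    exact abs_sum_mul_le (w := fun j => w j - w' j) hδ x _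
  have hsqrt : (n : ℝ) ^ (q 0 * q 1 / 2) * √(n : ℝ) = (n : ℝ) ^ ((q 0 * q 1 + 1) / 2) := by
    rw [Real.sqrt_eq_rpow, ← Real.rpow_add (by exact_mod_cast hn), add_div]
  calc |f (∑ j, x j * w j) - f (∑ j, x j * w' j)|
      ≤ D * (2 * 4 ^ q 1 * A ^ q 1 * T ^ (q 0 * q 1))
          * |∑ j, x j * w j - ∑ j, x j * w' j| := hf.abs_sub_le hq hD hT1 (hdot hw) (hdot hw')
    _ ≤ D * (2 * 4 ^ q 1 * A ^ q 1
          * (L ^ (q 0 * q 1) * (n : ℝ) ^ (q 0 * q 1 / 2) * (1 + U ^ bq0 q)))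
          * (δ * (√(n : ℝ) * U)) := by
        gcongr
        exact rpow_mul_sqrt_mul_max_le hq (by positivity) hU0
    _ = D * (2 * 4 ^ q 1 * A ^ q 1) * L ^ (q 0 * q 1)
          * (δ * ((n : ℝ) ^ (q 0 * q 1 / 2) * √(n : ℝ))) * (U + U ^ (bq0 q + 1)) := by ring
    _ = lossOsc n q A D L δ x := by rw [hsqrt, lossOsc]

namespace RowLaw

variable {Q l : ℕ} {M : ℝ} {Cov : Matrix (Fin p) (Fin p) ℝ}
  {P : Measure (EuclideanSpace ℝ (Fin p))} [IsProbabilityMeasure P] (h : RowLaw n Q M Cov P)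
  (hn : 0 < n) (hl : l ≤ Q)

include h hn hl

lemma integrable_scaled_l1_pow :
    Integrable (fun x : EuclideanSpace ℝ (Fin p) => ((∑ j, |x j|) / √(n : ℝ)) ^ l) P := by
  simp only [div_pow]
  exact (h.integrable_sum_abs_pow hn hl Finset.univ).div_const _

lemma integral_scaled_l1_pow_le (hM : 0 ≤ M) {τ : ℝ} (hp : (p : ℝ) / n ≤ 1 / τ) :
    ∫ x, ((∑ j, |x j|) / √(n : ℝ)) ^ l ∂P ≤ (M / τ) ^ l := by
  have : 0 < √(n : ℝ) := by positivity
  have hratio : (p : ℝ) * (M / √(n : ℝ)) / √(n : ℝ) ≤ M / τ := by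
    calc (p : ℝ) * (M / √(n : ℝ)) / √(n : ℝ) = (p : ℝ) / (√(n : ℝ) * √(n : ℝ)) * M := by
          field_simp
      _ ≤ 1 / τ * M := by
          rw [Real.mul_self_sqrt (Nat.cast_nonneg n)]
          exact mul_le_mul_of_nonneg_right hp hM
      _ = M / τ := one_div_mul_eq_div _ _
  simp only [div_pow _ √(n : ℝ), integral_div]
  calc (∫ x, (∑ j, |x j|) ^ l ∂P) / √(n : ℝ) ^ l
      ≤ (p * (M / √(n : ℝ))) ^ l / √(n : ℝ) ^ l := by
        gcongr
        simpa using h.integral_sum_abs_pow_le hn hM hl Finset.univ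
    _ = (p * (M / √(n : ℝ)) / √(n : ℝ)) ^ l := (div_pow _ _ _).symm
    _ ≤ (M / τ) ^ l := pow_le_pow_left₀ (by positivity) hratio l

end RowLaw

end Oscillation

section Rates

variable {n p d : ℕ} {q : Fin 4 → ℝ}

lemma sqrt_pow_eq_rpow (n l : ℕ) : √(n : ℝ) ^ l = (n : ℝ) ^ ((l : ℝ) / 2) := by
  rw [Real.sqrt_eq_rpow, ← Real.rpow_natCast, ← Real.rpow_mul (Nat.cast_nonneg n),
    one_div_mul_eq_div]

lemma sigmaN_cube_term_le (n p d : ℕ) (q : Fin 4 → ℝ) :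
    (p : ℝ) * (d : ℝ) ^ 2 / √(n : ℝ) ^ 3 ≤ sigmaN n p d q := by
  rw [sqrt_pow_eq_rpow, Nat.cast_ofNat, sigmaN, add_right_comm]
  exact le_add_of_nonneg_left (by positivity)

lemma sigmaN_pow_term_le (n p d : ℕ) (q : Fin 4 → ℝ) :
    (p : ℝ) * (d : ℝ) ^ (bq0 q + 2) / √(n : ℝ) ^ (bq0 q + 3) ≤ sigmaN n p d q := by
  rw [sqrt_pow_eq_rpow, Nat.cast_add, Nat.cast_ofNat, sigmaN]
  exact le_add_of_nonneg_left (by positivity)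

lemma sigmaN_nonneg (n p d : ℕ) (q : Fin 4 → ℝ) : 0 ≤ sigmaN n p d q := by
  unfold sigmaN
  positivity

lemma sigmaN_pos (hn : 0 < n) (hp : 0 < p) (hd : 0 < d) : 0 < sigmaN n p d q :=
  lt_of_lt_of_le (by positivity) (sigmaN_cube_term_le n p d q)

lemma pow_four_le_of_sigmaN_le_one (hn : 0 < n) {τ : ℝ} (hτ : 0 < τ) (hp : τ ≤ (p : ℝ) / n)
    (hσ : sigmaN n p d q ≤ 1) : (d : ℝ) ^ 4 ≤ n / τ ^ 2 := by
  have hsq : √(n : ℝ) ^ 2 = n := Real.sq_sqrt (Nat.cast_nonneg n)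
  have hcube := (sigmaN_cube_term_le n p d q).trans hσ
  rw [div_le_one (by positivity)] at hcube
  rw [le_div_iff₀ (by exact_mod_cast hn)] at hp
  have hd : τ * (d : ℝ) ^ 2 ≤ √(n : ℝ) := by
    refine le_of_mul_le_mul_left ?_ (by positivity : 0 < √(n : ℝ) ^ 2)
    calc √(n : ℝ) ^ 2 * (τ * (d : ℝ) ^ 2) = τ * n * (d : ℝ) ^ 2 := by rw [hsq]; ring
      _ ≤ p * (d : ℝ) ^ 2 := by gcongr
      _ ≤ √(n : ℝ) ^ 3 := hcube
      _ = √(n : ℝ) ^ 2 * √(n : ℝ) := pow_succ _ 2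
  rw [le_div_iff₀ (by positivity)]
  calc (d : ℝ) ^ 4 * τ ^ 2 = (τ * (d : ℝ) ^ 2) ^ 2 := by ring
    _ ≤ √(n : ℝ) ^ 2 := by gcongr
    _ = n := hsq

lemma omegaN_le_sigmaN (hn : 0 < n) (hq : ∀ k, 0 ≤ q k) :
    omegaN n p d q ≤ sigmaN n p d q := by
  refine mul_le_of_le_one_left (sigmaN_nonneg n p d q)
    (Real.rpow_le_one_of_one_le_of_nonpos (by exact_mod_cast hn) ?_)
  linarith [mul_nonneg (hq 0) (hq 1)]

lemma mul_rpow_le_of_lt_omegaN (hn : 0 < n) {δ : ℝ} (hδ : δ < omegaN n p d q) :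
    δ * (n : ℝ) ^ ((q 0 * q 1 + 1) / 2) ≤ sigmaN n p d q := by
  have hn1 : (1 : ℝ) ≤ n := by exact_mod_cast hn
  calc δ * (n : ℝ) ^ ((q 0 * q 1 + 1) / 2)
      ≤ omegaN n p d q * (n : ℝ) ^ ((q 0 * q 1 + 1) / 2) := by gcongr
    _ = (n : ℝ) ^ (-1 : ℝ) * sigmaN n p d q := by
        rw [omegaN, mul_right_comm, ← Real.rpow_add (by linarith)]
        congr 2
        ring
    _ ≤ sigmaN n p d q := mul_le_of_le_one_left (sigmaN_nonneg n p d q)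
        (Real.rpow_le_one_of_one_le_of_nonpos hn1 (by norm_num))

lemma one_le_avL {Lℓ : Fin n → ℝ} (hn : 0 < n) (hq : ∀ k, 0 ≤ q k) (hL : ∀ i, 1 ≤ Lℓ i) :
    1 ≤ avL q Lℓ := by
  have hsum : (n : ℝ) ≤ ∑ i, Lℓ i ^ bq q := by
    simpa using Finset.card_nsmul_le_sum Finset.univ (fun i => Lℓ i ^ bq q) 1
      fun i _ => Real.one_le_rpow (hL i) (bq_nonneg hq)
  rwa [avL, one_div_mul_eq_div, one_le_div (by exact_mod_cast hn)]

end Rates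

section SmoothingError

variable {n p d Q : ℕ} {M : ℝ} {q : Fin 4 → ℝ}

lemma abs_integral_pi_sub_le_of_le_sum {ι E : Type*} [Fintype ι] [MeasurableSpace E]
    (P : ι → Measure E) [∀ i, IsProbabilityMeasure (P i)] {F G : (ι → E) → ℝ}
    (hF : Integrable F (Measure.pi P)) (hG : Integrable G (Measure.pi P)) {Δ : ι → E → ℝ}
    (hΔ : ∀ i, Integrable (Δ i) (P i)) {c a : ℝ} (h : ∀ x, |F x - G x| ≤ c + a * ∑ i, Δ i (x i)) :
    |∫ x, F x ∂(Measure.pi P) - ∫ x, G x ∂(Measure.pi P)| ≤ c + a * ∑ i, ∫ x, Δ i x ∂(P i) := by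
  have hΔpi (i : ι) : Integrable (fun x : ι → E => Δ i (x i)) (Measure.pi P) :=
    (measurePreserving_eval P i).integrable_comp_of_integrable (hΔ i)
  have hsum : Integrable (fun x : ι → E => a * ∑ i, Δ i (x i)) (Measure.pi P) :=
    (integrable_finsetSum Finset.univ fun i _ => hΔpi i).const_mul a
  rw [← integral_sub hF hG]
  calc |∫ x, F x - G x ∂(Measure.pi P)|
      ≤ ∫ x, |F x - G x| ∂(Measure.pi P) := abs_integral_le_integral_abs
    _ ≤ ∫ x, c + a * ∑ i, Δ i (x i) ∂(Measure.pi P) :=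
        integral_mono (hF.sub hG).abs ((integrable_const c).add hsum) h
    _ = c + a * ∑ i, ∫ x, Δ i x ∂(P i) := by
        rw [integral_add (integrable_const c) hsum, integral_const_mul,
          integral_finsetSum _ fun i _ => hΔpi i]
        simp only [integral_const, probReal_univ, one_smul]
        congr! 3 with i
        exact integral_comp_eval (hΔ i).aestronglyMeasurable

/-- The constant in the bound on the mean oscillation of the losses over the net, for rows with
scaled `ℓ¹` norm of size `A`. -/
noncomputable def discConst (q : Fin 4 → ℝ) (A : ℝ) : ℝ :=
  2 * 4 ^ q 1 * (A + A ^ (bq0 q + 1))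

namespace RowLaw

variable {Cov : Matrix (Fin p) (Fin p) ℝ} {P : Measure (EuclideanSpace ℝ (Fin p))}
  [IsProbabilityMeasure P] (h : RowLaw n Q M Cov P) (hn : 0 < n) (hQ : bq0 q + 1 ≤ Q)

include h hn hQ

lemma integrable_lossOsc (A D L δ : ℝ) : Integrable (lossOsc n q A D L δ) P := by
  have hone := h.integrable_scaled_l1_pow hn (l := 1) (by omega)
  simp only [pow_one] at hone
  exact (hone.add (h.integrable_scaled_l1_pow hn hQ)).const_mul _

lemma integral_lossOsc_le (hq : ∀ k, 0 ≤ q k) (hM : 0 ≤ M) {τ : ℝ} (hτ : 0 < τ)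
    (hp : (p : ℝ) / n ≤ 1 / τ) {A D L δ : ℝ} (hA : 1 ≤ A) (hD : 0 ≤ D) (hL : 1 ≤ L)
    (hδ0 : 0 ≤ δ) (hδ : δ < omegaN n p d q) :
    ∫ x, lossOsc n q A D L δ x ∂P
      ≤ D * discConst q (M / τ) * (A ^ bq q * L ^ (bq0 q + 3) * sigmaN n p d q) := by
  have hone := h.integrable_scaled_l1_pow hn (l := 1) (by omega)
  have hone_le := h.integral_scaled_l1_pow_le hn (l := 1) (by omega) hM hp
  simp only [pow_one] at hone hone_le
  have hA_le : A ^ q 1 ≤ A ^ bq q := Real.rpow_le_rpow_of_exponent_le hA (le_bq_one hq)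
  have hL_le : L ^ (q 0 * q 1) ≤ L ^ (bq0 q + 3) := by
    rw [← Real.rpow_natCast]
    refine Real.rpow_le_rpow_of_exponent_le hL ((mul_one_le_bq0 hq).trans ?_)
    exact_mod_cast Nat.le_add_right _ 3
  have := sigmaN_nonneg n p d q
  simp only [lossOsc]
  rw [integral_const_mul, integral_add hone (h.integrable_scaled_l1_pow hn hQ)]
  calc _ ≤ D * (2 * 4 ^ q 1 * A ^ q 1) * L ^ (q 0 * q 1) * (δ * (n : ℝ) ^ ((q 0 * q 1 + 1) / 2))
          * (M / τ + (M / τ) ^ (bq0 q + 1)) := by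
        gcongr
        exact h.integral_scaled_l1_pow_le hn hQ hM hp
    _ ≤ D * (2 * 4 ^ q 1 * A ^ bq q) * L ^ (bq0 q + 3) * sigmaN n p d q
          * (M / τ + (M / τ) ^ (bq0 q + 1)) := by
        gcongr ?_ * ?_ * ?_ * _
        · gcongr
        · exact mul_rpow_le_of_lt_omegaN hn hδ
    _ = D * discConst q (M / τ) * (A ^ bq q * L ^ (bq0 q + 3) * sigmaN n p d q) := by
        rw [discConst]; ring

end RowLaw

lemma abs_integral_minRisk_sub_softRisk_le (hn : 0 < n) {τ : ℝ} (hτ : 0 < τ)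
    (hp : (p : ℝ) / n ≤ 1 / τ) (hq : ∀ k, 0 ≤ q k) {ε D : ℝ} (hD : 0 ≤ D) {Lℓ : Fin n → ℝ}
    {ℓ f : Fin n → ℝ → ℝ} (hℓ : ∀ i, Continuous (ℓ i))
    (hf : ∀ i, SmoothedLoss q (Lℓ i) D (f i)) (hfℓ : ∀ i x, |f i x - ℓ i x| ≤ ε) {K : ℝ}
    {g : ℝ → ℝ} (hg : BoundedDerivs g K) {Cov : Fin n → Matrix (Fin p) (Fin p) ℝ}
    (P : Fin n → Measure (EuclideanSpace ℝ (Fin p))) [∀ i, IsProbabilityMeasure (P i)]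
    (hP : ∀ i, RowLaw n Q M (Cov i) (P i)) (hM : 0 ≤ M) (hQ : bq0 q + 1 ≤ Q)
    {κ : Fin n → Type*} [∀ i, Fintype (κ i)] {B : (i : Fin n) → κ i → Finset (Fin p)}
    (hB : ∀ i, IsBlockPartition d (B i))
    (hind : ∀ i, iIndepFun (fun a (x : EuclideanSpace ℝ (Fin p)) (j : B i a) => x j) (P i))
    {R : EuclideanSpace ℝ (Fin p) → ℝ} {S : Set (EuclideanSpace ℝ (Fin p))} {L δ : ℝ}
    (hL : 1 ≤ L) (hδ0 : 0 ≤ δ) (hδ : δ < omegaN n p d q) (hS : S ⊆ cube p L)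
    {W : Finset (EuclideanSpace ℝ (Fin p))} (hnet : IsUniformNet δ S W) (hW : W.Nonempty) {r : ℝ}
    (hR : ∀ w ∈ cube p L, ∀ w' ∈ cube p L, (∀ j, |w j - w' j| ≤ δ) → |R w - R w'| ≤ r)
    {b : ℝ} (hb : 0 < b) :
    |∫ x, g (minRisk ℓ R S x) ∂(Measure.pi P)
      - ∫ z, g (softRisk n b f Sigma.fst (fun w : W => R w) z)
        ∂(Measure.pi fun α : (i : Fin n) × κ i =>
          (P α.1).map (blockMap (fun w : W => w.1) (B α.1 α.2)))|
    ≤ K * (ε + r + D * discConst q (M / τ) * (avL q Lℓ * L ^ (bq0 q + 3) * sigmaN n p d q)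
      + Real.log W.card / (n * b)) := by
  have hK : 0 ≤ K := hg.nonneg
  let blocks (x : Fin n → EuclideanSpace ℝ (Fin p)) (α : (i : Fin n) × κ i) : W → ℝ :=
    blockMap (fun w : W => w.1) (B α.1 α.2) (x α.1)
  have hblocks : Measurable blocks := measurable_pi_iff.2 fun α =>
    (measurable_blockMap _ _).comp (measurable_pi_apply α.1)
  have hsoft : Measurable (softRisk n b f (Sigma.fst : ((i : Fin n) × κ i) → Fin n)
      (fun w : W => R w)) :=
    measurable_softRisk (fun i => (hf i).selfBounded.continuous.measurable) _ _
  have integrable_comp {F : (Fin n → EuclideanSpace ℝ (Fin p)) → ℝ} (hF : Measurable F) :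
      Integrable (fun x => g (F x)) (Measure.pi P) :=
    Integrable.of_bound (hg.continuous.measurable.comp hF).aestronglyMeasurable K
      (Filter.Eventually.of_forall fun x => hg.abs_le _)
  have hrow (x : Fin n → EuclideanSpace ℝ (Fin p)) (i : Fin n) (w : W) :
      ∑ α with Sigma.fst α = i, blocks x α w = ∑ j, x i j * w.1 j := by
    rw [sum_filter_sigma_fst (fun α => blocks x α w) i]
    exact (hB i).sum_sum fun j => x i j * w.1 j
  have hgsoft : Measurable fun z => g (softRisk n b f Sigma.fst (fun w : W => R w) z) :=
    hg.continuous.measurable.comp hsoft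
  rw [← pi_map_blockMap P hind,
    integral_map (φ := blocks) hblocks.aemeasurable hgsoft.aestronglyMeasurable]
  refine (abs_integral_pi_sub_le_of_le_sum P (integrable_comp (measurable_minRisk hℓ R hS))
    (integrable_comp (hsoft.comp hblocks)) (Δ := fun i => lossOsc n q (Lℓ i) D L δ)
    (fun i => (hP i).integrable_lossOsc hn hQ _ _ _ _)
    (c := K * (ε + r + Real.log W.card / (n * b))) (a := K / n) fun x => ?_).trans ?_
  · refine (hg.abs_sub_le _ _).trans ((mul_le_mul_of_nonneg_left
      (abs_minRisk_sub_softRisk_le hn hb hfℓ hδ0 hS hnet hW hR (hrow x)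
        fun i w hw w' hw' hww' => (hf i).abs_sub_le_of_close hq hn hD hL hw hw' hww' (x i))
      hK).trans_eq ?_)
    ring
  · have hsum : ∑ i, ∫ x, lossOsc n q (Lℓ i) D L δ x ∂(P i)
        ≤ ∑ i, D * discConst q (M / τ) * (Lℓ i ^ bq q * L ^ (bq0 q + 3) * sigmaN n p d q) :=
      Finset.sum_le_sum fun i _ =>
        (hP i).integral_lossOsc_le hn hQ hq hM hτ hp (hf i).one_le hD hL hδ0 hδ
    rw [← Finset.mul_sum, ← Finset.sum_mul, ← Finset.sum_mul] at hsum
    refine (add_le_add_right (mul_le_mul_of_nonneg_left hsum (by positivity)) _).trans_eq ?_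
    rw [avL]
    ring

end SmoothingError

section Comparison

variable {n p d Q : ℕ} {M M₀ τ L : ℝ} {q : Fin 4 → ℝ}

lemma two_mul_bq0_half (q : Fin 4 → ℝ) : 2 * (bq0 q / 2) = bq0 q :=
  Nat.mul_div_cancel' ⟨_, rfl⟩

lemma mul_pow_div_sqrt_pow_le (hn : 0 < n) (hτ : τ ∈ Ioo (0 : ℝ) 1) (hp : (p : ℝ) / n ≤ 1 / τ)
    (hd1 : 1 ≤ d) (hd : (d : ℝ) ^ 4 ≤ n / τ ^ 2) {l : ℕ} (hl : 1 ≤ l) :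
    (p : ℝ) * (d : ℝ) ^ (2 * l + 1) / √(n : ℝ) ^ (2 * (l + 1)) ≤ (1 / τ ^ 2) ^ (l + 1) := by
  obtain ⟨hτ0, hτ1⟩ := hτ
  have hn0 : (0 : ℝ) < n := by exact_mod_cast hn
  have hd1' : (1 : ℝ) ≤ d := by exact_mod_cast hd1
  have hpn : (p : ℝ) ≤ n / τ := by
    rw [div_le_iff₀ hn0] at hp
    exact hp.trans_eq (by ring)
  have hd_pow : (d : ℝ) ^ (2 * l + 1) ≤ (n / τ ^ 2) ^ l := by
    refine (pow_le_pow_right₀ hd1' (by omega : 2 * l + 1 ≤ 4 * l)).trans ?_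
    rw [pow_mul]
    gcongr
  rw [pow_mul, Real.sq_sqrt hn0.le, div_le_iff₀ (by positivity)]
  calc (p : ℝ) * (d : ℝ) ^ (2 * l + 1) ≤ n / τ * (n / τ ^ 2) ^ l := by gcongr
    _ ≤ n / τ ^ 2 * (n / τ ^ 2) ^ l := by
        gcongr
        exact pow_le_of_le_one hτ0.le hτ1.le two_ne_zero
    _ = (1 / τ ^ 2) ^ (l + 1) * (n : ℝ) ^ (l + 1) := by
        rw [← pow_succ', ← mul_pow, one_div_mul_eq_div]

/-- The size, for `L = 1`, of the sum over the blocks of a row of the variances of the block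
contributions, and of the corresponding sums of even moments. -/
noncomputable def varConst (τ M₀ M : ℝ) : ℝ := (M₀ + M ^ 2) / τ ^ 2

/-- The constant in the Lindeberg comparison of the expected soft risks of two designs. -/
noncomputable def lindebergConst (q : Fin 4 → ℝ) (τ M₀ M : ℝ) : ℝ :=
  23 * (16 * 4 ^ bq q * 2 ^ bq0 q)
    * (2 * (1 + momentConst (bq0 q / 2) * varConst τ M₀ M ^ (bq0 q / 2)) * M ^ 3
      + 2 * M ^ (bq0 q + 3))

lemma varConst_nonneg (hM₀ : 0 ≤ M₀) : 0 ≤ varConst τ M₀ M := by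
  unfold varConst
  positivity

lemma lindebergConst_nonneg (hM₀ : 0 ≤ M₀) (hM : 0 ≤ M) : 0 ≤ lindebergConst q τ M₀ M := by
  have := varConst_nonneg (τ := τ) (M := M) hM₀
  have := momentConst_nonneg (bq0 q / 2)
  unfold lindebergConst
  positivity

namespace IsBlockPartition

variable {κ : Type*} [Fintype κ] {B : κ → Finset (Fin p)} (hB : IsBlockPartition d B)

include hB

lemma sum_scale_pow_le (hM : 0 ≤ M) (hL : 0 ≤ L) (l : ℕ) :
    ∑ a, (L * ((B a).card * (M / √(n : ℝ)))) ^ (l + 1)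
      ≤ L ^ (l + 1) * M ^ (l + 1) * ((p : ℝ) * (d : ℝ) ^ l / √(n : ℝ) ^ (l + 1)) := by
  calc ∑ a, (L * ((B a).card * (M / √(n : ℝ)))) ^ (l + 1)
      = L ^ (l + 1) * M ^ (l + 1) / √(n : ℝ) ^ (l + 1) * ∑ a, ((B a).card : ℝ) ^ (l + 1) := by
        rw [Finset.mul_sum]
        refine Finset.sum_congr rfl fun a _ => ?_
        rw [mul_pow, mul_pow, div_pow]
        ring
    _ ≤ L ^ (l + 1) * M ^ (l + 1) / √(n : ℝ) ^ (l + 1) * (p * (d : ℝ) ^ l) := by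
        gcongr
        exact hB.sum_card_pow_le l
    _ = _ := by ring

lemma sum_variance_le (hτ : τ ∈ Ioo (0 : ℝ) 1) (hp : (p : ℝ) / n ≤ 1 / τ) (hM₀ : 0 ≤ M₀) :
    ∑ a, M₀ * ((B a).card * L ^ 2) / n ≤ L ^ 2 * varConst τ M₀ M := by
  obtain ⟨hτ0, hτ1⟩ := hτ
  calc ∑ a, M₀ * ((B a).card * L ^ 2) / n = M₀ * L ^ 2 * ((p : ℝ) / n) := by
        rw [← Finset.sum_div, ← Finset.mul_sum, ← Finset.sum_mul, hB.sum_card]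
        ring
    _ ≤ M₀ * L ^ 2 * (1 / τ ^ 2) := mul_le_mul_of_nonneg_left
        (hp.trans (one_div_le_one_div_of_le (by positivity)
          (pow_le_of_le_one hτ0.le hτ1.le two_ne_zero))) (by positivity)
    _ = L ^ 2 * (M₀ / τ ^ 2) := by ring
    _ ≤ L ^ 2 * varConst τ M₀ M := by
        unfold varConst
        gcongr
        exact le_add_of_nonneg_right (sq_nonneg M)

lemma sum_scale_pow_even_le (hn : 0 < n) (hτ : τ ∈ Ioo (0 : ℝ) 1) (hp : (p : ℝ) / n ≤ 1 / τ)
    (hd1 : 1 ≤ d) (hd : (d : ℝ) ^ 4 ≤ n / τ ^ 2) (hM₀ : 0 ≤ M₀) (hM : 0 ≤ M) (hL : 0 ≤ L) {j : ℕ}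
    (hj : 2 ≤ j) :
    ∑ a, (L * ((B a).card * (M / √(n : ℝ)))) ^ (2 * j) ≤ (L ^ 2 * varConst τ M₀ M) ^ j := by
  obtain ⟨l, rfl⟩ : ∃ l, j = l + 1 := ⟨j - 1, by omega⟩
  calc ∑ a, (L * ((B a).card * (M / √(n : ℝ)))) ^ (2 * (l + 1))
      ≤ L ^ (2 * (l + 1)) * M ^ (2 * (l + 1))
          * ((p : ℝ) * (d : ℝ) ^ (2 * l + 1) / √(n : ℝ) ^ (2 * (l + 1))) :=
        hB.sum_scale_pow_le hM hL (2 * l + 1)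
    _ ≤ L ^ (2 * (l + 1)) * M ^ (2 * (l + 1)) * (1 / τ ^ 2) ^ (l + 1) := by
        gcongr
        exact mul_pow_div_sqrt_pow_le hn hτ hp hd1 hd (by omega)
    _ = (L ^ 2 * (M ^ 2 / τ ^ 2)) ^ (l + 1) := by
        rw [pow_mul, pow_mul, ← mul_pow, ← mul_pow]
        congr 1
        ring
    _ ≤ (L ^ 2 * varConst τ M₀ M) ^ (l + 1) := by
        unfold varConst
        gcongr
        exact le_add_of_nonneg_left hM₀

lemma sum_remainder_le (hM₀ : 0 ≤ M₀) (hM : 0 ≤ M) (hL : 1 ≤ L) :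
    ∑ a, ((1 + momentConst (bq0 q / 2) * (L ^ 2 * varConst τ M₀ M) ^ (bq0 q / 2))
          * (2 * (L * ((B a).card * (M / √(n : ℝ)))) ^ 3)
        + 2 * (L * ((B a).card * (M / √(n : ℝ)))) ^ (bq0 q + 3))
      ≤ (2 * (1 + momentConst (bq0 q / 2) * varConst τ M₀ M ^ (bq0 q / 2)) * M ^ 3
          + 2 * M ^ (bq0 q + 3)) * (L ^ (bq0 q + 3) * sigmaN n p d q) := by
  have hL0 : 0 ≤ L := by linarith
  have hV := varConst_nonneg (τ := τ) (M := M) hM₀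
  have hC := momentConst_nonneg (bq0 q / 2)
  have := sigmaN_nonneg n p d q
  have hcube : ∑ a, (L * ((B a).card * (M / √(n : ℝ)))) ^ 3 ≤ L ^ 3 * M ^ 3 * sigmaN n p d q :=
    (hB.sum_scale_pow_le hM hL0 2).trans
      (mul_le_mul_of_nonneg_left (sigmaN_cube_term_le n p d q) (by positivity))
  have hpow : ∑ a, (L * ((B a).card * (M / √(n : ℝ)))) ^ (bq0 q + 3)
      ≤ L ^ (bq0 q + 3) * M ^ (bq0 q + 3) * sigmaN n p d q :=
    (hB.sum_scale_pow_le hM hL0 (bq0 q + 2)).trans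
      (mul_le_mul_of_nonneg_left (sigmaN_pow_term_le n p d q) (by positivity))
  have hfactor : 1 + momentConst (bq0 q / 2) * (L ^ 2 * varConst τ M₀ M) ^ (bq0 q / 2)
      ≤ (1 + momentConst (bq0 q / 2) * varConst τ M₀ M ^ (bq0 q / 2)) * L ^ bq0 q := by
    rw [mul_pow, ← pow_mul, two_mul_bq0_half]
    linarith [one_le_pow₀ hL (n := bq0 q)]
  rw [Finset.sum_add_distrib, ← Finset.mul_sum, ← Finset.mul_sum, ← Finset.mul_sum]
  calc _ ≤ (1 + momentConst (bq0 q / 2) * varConst τ M₀ M ^ (bq0 q / 2)) * L ^ bq0 q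
          * (2 * (L ^ 3 * M ^ 3 * sigmaN n p d q))
        + 2 * (L ^ (bq0 q + 3) * M ^ (bq0 q + 3) * sigmaN n p d q) := by gcongr
    _ = _ := by ring

end IsBlockPartition

lemma sum_row_remainder_le (hM₀ : 0 ≤ M₀) (hM : 0 ≤ M) (hL : 1 ≤ L) {K b D : ℝ} (hD : 0 ≤ D)
    (hK : 0 ≤ K) {Lℓ : Fin n → ℝ}
    (hLℓ : ∀ i, 0 ≤ 16 * 4 ^ bq q * 2 ^ bq0 q * Lℓ i ^ bq q)
    {κ : Fin n → Type*} [∀ i, Fintype (κ i)] {B : (i : Fin n) → κ i → Finset (Fin p)}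
    (hB : ∀ i, IsBlockPartition d (B i)) :
    ∑ i, 23 * K * b ^ 2 * D ^ 3 / n * (16 * 4 ^ bq q * 2 ^ bq0 q * Lℓ i ^ bq q)
        * ∑ a, ((1 + momentConst (bq0 q / 2) * (L ^ 2 * varConst τ M₀ M) ^ (bq0 q / 2))
            * (2 * (L * ((B i a).card * (M / √(n : ℝ)))) ^ 3)
          + 2 * (L * ((B i a).card * (M / √(n : ℝ)))) ^ (bq0 q + 3))
      ≤ K * (lindebergConst q τ M₀ M * b ^ 2 * D ^ 3
        * (avL q Lℓ * L ^ (bq0 q + 3) * sigmaN n p d q)) :=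
  calc _ ≤ ∑ i, 23 * K * b ^ 2 * D ^ 3 / n * (16 * 4 ^ bq q * 2 ^ bq0 q * Lℓ i ^ bq q)
          * ((2 * (1 + momentConst (bq0 q / 2) * varConst τ M₀ M ^ (bq0 q / 2)) * M ^ 3
            + 2 * M ^ (bq0 q + 3)) * (L ^ (bq0 q + 3) * sigmaN n p d q)) :=
        Finset.sum_le_sum fun i _ => mul_le_mul_of_nonneg_left
          ((hB i).sum_remainder_le hM₀ hM hL) (mul_nonneg (by positivity) (hLℓ i))
    _ = _ := by
        rw [← Finset.sum_mul, ← Finset.mul_sum, ← Finset.mul_sum, lindebergConst, avL]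
        ring

lemma abs_integral_softRisk_blocks_sub_le (hn : 0 < n) (hτ : τ ∈ Ioo (0 : ℝ) 1)
    (hp : (p : ℝ) / n ≤ 1 / τ) (hd1 : 1 ≤ d) (hd : (d : ℝ) ^ 4 ≤ n / τ ^ 2) (hq : ∀ k, 0 ≤ q k)
    {D : ℝ} (hD : 1 ≤ D) {Lℓ : Fin n → ℝ} {f : Fin n → ℝ → ℝ}
    (hf : ∀ i, SmoothedLoss q (Lℓ i) D (f i)) {K : ℝ} {g : ℝ → ℝ} (hg : BoundedDerivs g K)
    {Cov : Fin n → Matrix (Fin p) (Fin p) ℝ} (P P' : Fin n → Measure (EuclideanSpace ℝ (Fin p)))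
    [∀ i, IsProbabilityMeasure (P i)] [∀ i, IsProbabilityMeasure (P' i)]
    (hP : ∀ i, RowLaw n Q M (Cov i) (P i)) (hP' : ∀ i, RowLaw n Q M (Cov i) (P' i)) (hM : 0 ≤ M)
    (hQ : bq0 q + 3 ≤ Q) (hM₀ : 0 ≤ M₀)
    (hCov : ∀ i, ∀ x : Fin p → ℝ, ∑ j, ∑ k, x j * x k * Cov i j k ≤ M₀ * ∑ j, x j ^ 2)
    {κ : Fin n → Type*} [∀ i, Fintype (κ i)] {B : (i : Fin n) → κ i → Finset (Fin p)}
    (hB : ∀ i, IsBlockPartition d (B i)) {W : Type*} [Fintype W] [Nonempty W]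
    {pts : W → EuclideanSpace ℝ (Fin p)} (hL : 1 ≤ L) (hpts : ∀ w, pts w ∈ cube p L)
    (R : W → ℝ) {b : ℝ} (hb : 1 ≤ b) :
    |∫ z, g (softRisk n b f Sigma.fst R z) ∂(Measure.pi fun α : (i : Fin n) × κ i =>
          (P α.1).map (blockMap pts (B α.1 α.2)))
      - ∫ z, g (softRisk n b f Sigma.fst R z) ∂(Measure.pi fun α : (i : Fin n) × κ i =>
          (P' α.1).map (blockMap pts (B α.1 α.2)))|
    ≤ K * (lindebergConst q τ M₀ M * b ^ 2 * D ^ 3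
      * (avL q Lℓ * L ^ (bq0 q + 3) * sigmaN n p d q)) := by
  have hK : 0 ≤ K := hg.nonneg
  have hL0 : 0 ≤ L := by linarith
  have hweight (i : Fin n) : 0 ≤ 16 * 4 ^ bq q * 2 ^ bq0 q * Lℓ i ^ bq q := by
    have := (hf i).one_le
    positivity
  have hprob (P : Fin n → Measure (EuclideanSpace ℝ (Fin p))) [∀ i, IsProbabilityMeasure (P i)]
      (α : (i : Fin n) × κ i) : IsProbabilityMeasure ((P α.1).map (blockMap pts (B α.1 α.2))) :=
    Measure.isProbabilityMeasure_map (measurable_blockMap pts _).aemeasurable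
  have := hprob P
  have := hprob P'
  refine (abs_integral_softRisk_pi_sub_le (N := n) (by exact_mod_cast hn) hb hD hg
    (dominatedWeights_lossWeight hq) (fun i => (hf i).selfBounded)
    (Sigma.fst : ((i : Fin n) × κ i) → Fin n) R
    _ _ (J := bq0 q / 2)
    (s := fun α => L * ((B α.1 α.2).card * (M / √(n : ℝ))))
    (v := fun α => M₀ * ((B α.1 α.2).card * L ^ 2) / n)
    (fun α => (hP α.1).blockLaw hn hM (by rwa [two_mul_bq0_half]) hM₀ (hCov _) hL0 hpts _)
    (fun α => (hP' α.1).blockLaw hn hM (by rwa [two_mul_bq0_half]) hM₀ (hCov _) hL0 hpts _)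
    (fun α w w' => by
      rw [(hP α.1).integral_blockMap_mul hn (by omega),
        (hP' α.1).integral_blockMap_mul hn (by omega)])
    (Λ := fun i => 16 * 4 ^ bq q * 2 ^ bq0 q * Lℓ i ^ bq q) hweight
    (fun i r y t ht => by
      rw [two_mul_bq0_half]
      exact (hf i).dominatingWeight_le hq ht)
    (V := L ^ 2 * varConst τ M₀ M) (mul_nonneg (sq_nonneg L) (varConst_nonneg hM₀))
    (fun i => by
      rw [sum_filter_sigma_fst]
      exact (hB i).sum_variance_le hτ hp hM₀)
    fun i j hj _ => by
      rw [sum_filter_sigma_fst (fun α => (L * ((B α.1 α.2).card * (M / √(n : ℝ)))) ^ (2 * j))]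
      exact (hB i).sum_scale_pow_even_le hn hτ hp hd1 hd hM₀ hM hL0 hj).trans ?_
  rw [Fintype.sum_sigma, two_mul_bq0_half]
  simp only [← Finset.mul_sum]
  exact sum_row_remainder_le hM₀ hM hL (by linarith) hK hweight hB

end Comparison

section MainEstimate

variable {n p d Q : ℕ} {M M₀ τ L δ : ℝ} {q : Fin 4 → ℝ}

lemma discConst_nonneg {A : ℝ} (hA : 0 ≤ A) : 0 ≤ discConst q A := by
  unfold discConst
  positivity

/-- The constant of the universality bound. -/
noncomputable def univConst (q : Fin 4 → ℝ) (τ M₀ M : ℝ) : ℝ :=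
  2 + 2 * discConst q (M / τ) + 6 / τ + lindebergConst q τ M₀ M

lemma two_le_univConst (hτ : 0 < τ) (hM₀ : 0 ≤ M₀) (hM : 0 ≤ M) : 2 ≤ univConst q τ M₀ M := by
  have hdisc := discConst_nonneg (q := q) (div_nonneg hM hτ.le)
  have hlind := lindebergConst_nonneg (q := q) (τ := τ) hM₀ hM
  have : 0 < 6 / τ := by positivity
  unfold univConst
  linarith

lemma total_error_le_univConst_mul (hτ : 0 < τ) (hM₀ : 0 ≤ M₀) (hM : 0 ≤ M) {ε r D T Y b : ℝ}
    (hε : 0 ≤ ε) (hr : 0 ≤ r) (hD : 1 ≤ D) (hT : 0 ≤ T) (hTY : T ≤ Y) (hb : b ^ 2 * T = Y) :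
    2 * (ε + r + D * discConst q (M / τ) * T + 3 / τ * Y)
        + lindebergConst q τ M₀ M * b ^ 2 * D ^ 3 * T
      ≤ univConst q τ M₀ M * (ε + D ^ 3 * (r + Y)) := by
  have hdisc := discConst_nonneg (q := q) (div_nonneg hM hτ.le)
  have := lindebergConst_nonneg (q := q) (τ := τ) hM₀ hM
  have hD1 : 1 ≤ D ^ 3 := one_le_pow₀ hD
  have hY : 0 ≤ Y := hT.trans hTY
  calc 2 * (ε + r + D * discConst q (M / τ) * T + 3 / τ * Y)
        + lindebergConst q τ M₀ M * b ^ 2 * D ^ 3 * T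
      = 2 * (ε + r + D * discConst q (M / τ) * T + 3 / τ * Y)
        + lindebergConst q τ M₀ M * (D ^ 3 * Y) := by rw [← hb]; ring
    _ ≤ 2 * (ε + D ^ 3 * r + D ^ 3 * discConst q (M / τ) * Y + 3 / τ * (D ^ 3 * Y))
        + lindebergConst q τ M₀ M * (D ^ 3 * Y) := by
      gcongr
      · exact le_mul_of_one_le_left hr hD1
      · exact le_self_pow₀ hD (by norm_num)
      · exact le_mul_of_one_le_left hY hD1
    _ ≤ 2 * (ε + D ^ 3 * r + D ^ 3 * discConst q (M / τ) * Y + 3 / τ * (D ^ 3 * Y))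
        + lindebergConst q τ M₀ M * (D ^ 3 * Y)
        + ((univConst q τ M₀ M - 2) * (ε + D ^ 3 * r) + 2 * (D ^ 3 * Y)) :=
      le_add_of_nonneg_right (add_nonneg (mul_nonneg
        (sub_nonneg.2 (two_le_univConst hτ hM₀ hM)) (by positivity)) (by positivity))
    _ = univConst q τ M₀ M * (ε + D ^ 3 * (r + Y)) := by unfold univConst; ring

-- `b = (l / T)^(1/3)` balances the smoothing error `l / b` against the Lindeberg error `b² T`.
lemma exists_inverse_temperature {T l : ℝ} (hT0 : 0 < T) (hT : T ≤ 1) (hl : 1 ≤ l) :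
    ∃ b : ℝ, 1 ≤ b ∧ l / b = T ^ (1 / 3 : ℝ) * l ^ (2 / 3 : ℝ) ∧
      b ^ 2 * T = T ^ (1 / 3 : ℝ) * l ^ (2 / 3 : ℝ) := by
  have hl0 : 0 < l := by linarith
  have cube {x : ℝ} (hx : 0 < x) : x = (x ^ (1 / 3 : ℝ)) ^ 3 := by
    rw [← Real.rpow_natCast, ← Real.rpow_mul hx.le]
    norm_num
  have square {x : ℝ} (hx : 0 < x) : x ^ (2 / 3 : ℝ) = (x ^ (1 / 3 : ℝ)) ^ 2 := by
    rw [← Real.rpow_natCast, ← Real.rpow_mul hx.le]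
    norm_num
  have hTpos : 0 < T ^ (1 / 3 : ℝ) := Real.rpow_pos_of_pos hT0 _
  have : 0 < l ^ (1 / 3 : ℝ) := Real.rpow_pos_of_pos hl0 _
  rw [square hl0]
  refine ⟨l ^ (1 / 3 : ℝ) / T ^ (1 / 3 : ℝ), ?_, ?_, ?_⟩
  · rw [one_le_div hTpos]
    exact (Real.rpow_le_one hT0.le hT (by norm_num)).trans (Real.one_le_rpow hl (by norm_num))
  · nth_rewrite 1 [cube hl0]
    field_simp
  · nth_rewrite 2 [cube hT0]
    field_simp

lemma le_rpow_mul_rpow {T l : ℝ} (hT0 : 0 ≤ T) (hT : T ≤ 1) (hl : 1 ≤ l) :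
    T ≤ T ^ (1 / 3 : ℝ) * l ^ (2 / 3 : ℝ) :=
  (Real.self_le_rpow_of_le_one hT0 hT (by norm_num)).trans
    (le_mul_of_one_le_right (Real.rpow_nonneg hT0 _) (Real.one_le_rpow hl (by norm_num)))

lemma rpow_rate_eq {A L σ : ℝ} (hA : 0 ≤ A) (hL : 0 ≤ L) (hσ : 0 ≤ σ) (k : ℕ) (x : ℝ) :
    A ^ (1 / 3 : ℝ) * L ^ (((k : ℝ) + 3) / 3) * x * σ ^ (1 / 3 : ℝ)
      = (A * L ^ (k + 3) * σ) ^ (1 / 3 : ℝ) * x := by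
  rw [Real.mul_rpow (by positivity) hσ, Real.mul_rpow hA (by positivity), ← Real.rpow_natCast L,
    ← Real.rpow_mul hL]
  push_cast
  rw [mul_one_div]
  ring

lemma pos_of_le_natCast_div {x : ℝ} (hx : 0 < x) (h : x ≤ (p : ℝ) / n) : 0 < p := by
  by_contra! hp
  simp only [Nat.le_zero.1 hp, Nat.cast_zero, zero_div] at h
  exact hx.not_ge h

lemma log_card_div_le (hp : (p : ℝ) / n ≤ 1 / τ) (hδ : 0 < δ) (hδL : δ ≤ L) {m : ℕ} (hm : 0 < m)
    (h : (m : ℝ) ≤ (3 * L / δ) ^ p) {b : ℝ} (hb : 0 < b) :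
    Real.log m / (n * b) ≤ 3 / τ * (logPlus (L / δ) / b) := by
  have hl : 0 ≤ logPlus (L / δ) := zero_le_one.trans (le_max_left _ _)
  calc Real.log m / (n * b) ≤ p * (3 * logPlus (L / δ)) / (n * b) := by
        gcongr
        exact log_card_le_mul_logPlus hδ hδL hm h
    _ = 3 * ((p : ℝ) / n) * (logPlus (L / δ) / b) := by ring
    _ ≤ 3 * (1 / τ) * (logPlus (L / δ) / b) := by gcongr
    _ = 3 / τ * (logPlus (L / δ) / b) := by ring

lemma BoundedDerivs.abs_integral_comp_sub_le {K : ℝ} {g : ℝ → ℝ} (hg : BoundedDerivs g K)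
    {Ω Ω' : Type*} [MeasurableSpace Ω] [MeasurableSpace Ω'] (μ : Measure Ω) (ν : Measure Ω')
    [IsProbabilityMeasure μ] [IsProbabilityMeasure ν] (U : Ω → ℝ) (V : Ω' → ℝ) :
    |∫ ω, g (U ω) ∂μ - ∫ ω, g (V ω) ∂ν| ≤ 2 * K := by
  have hU : |∫ ω, g (U ω) ∂μ| ≤ K := by
    simpa using norm_integral_le_of_norm_le_const (μ := μ) (f := fun ω => g (U ω))
      (Filter.Eventually.of_forall fun ω => hg.abs_le (U ω))
  have hV : |∫ ω, g (V ω) ∂ν| ≤ K := by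
    simpa using norm_integral_le_of_norm_le_const (μ := ν) (f := fun ω => g (V ω))
      (Filter.Eventually.of_forall fun ω => hg.abs_le (V ω))
  exact (abs_sub _ _).trans (by linarith)

section ProductLaws

variable (hn : 0 < n) (hτ : τ ∈ Ioo (0 : ℝ) 1) (hp' : τ ≤ (p : ℝ) / n) (hp : (p : ℝ) / n ≤ 1 / τ)
  (hq : ∀ k, 0 ≤ q k) {ε D : ℝ} (hD : 1 ≤ D) {Lℓ : Fin n → ℝ} {ℓ f : Fin n → ℝ → ℝ}
  (hℓ : ∀ i, Continuous (ℓ i)) (hf : ∀ i, SmoothedLoss q (Lℓ i) D (f i))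
  (hfℓ : ∀ i x, |f i x - ℓ i x| ≤ ε) {K : ℝ} {g : ℝ → ℝ} (hg : BoundedDerivs g K)
  {Cov : Fin n → Matrix (Fin p) (Fin p) ℝ} (P P' : Fin n → Measure (EuclideanSpace ℝ (Fin p)))
  [∀ i, IsProbabilityMeasure (P i)] [∀ i, IsProbabilityMeasure (P' i)]
  (hP : ∀ i, RowLaw n Q M (Cov i) (P i)) (hP' : ∀ i, RowLaw n Q M (Cov i) (P' i)) (hM : 0 ≤ M)
  (hQ : bq0 q + 3 ≤ Q) (hM₀ : 0 ≤ M₀)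
  (hCov : ∀ i, ∀ x : Fin p → ℝ, ∑ j, ∑ k, x j * x k * Cov i j k ≤ M₀ * ∑ j, x j ^ 2)
  {κ : Fin n → Type*} [∀ i, Finite (κ i)] {B : (i : Fin n) → κ i → Finset (Fin p)}
  (hB : ∀ i, IsBlockPartition d (B i))
  (hind : ∀ i, iIndepFun (fun a (x : EuclideanSpace ℝ (Fin p)) (j : B i a) => x j) (P i))
  (hind' : ∀ i, iIndepFun (fun a (x : EuclideanSpace ℝ (Fin p)) (j : B i a) => x j) (P' i))
  {R : EuclideanSpace ℝ (Fin p) → ℝ} {S : Set (EuclideanSpace ℝ (Fin p))} (hL : 1 ≤ L)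
  (hS : S ⊆ cube p L) {r : ℝ}
  (hR : ∀ w ∈ cube p L, ∀ w' ∈ cube p L, (∀ j, |w j - w' j| ≤ δ) → |R w - R w'| ≤ r)

include hn hτ hp hq hD hℓ hf hfℓ hg hP hP' hM hQ hM₀ hCov hB hind hind' hL hS hR

lemma abs_integral_minRisk_sub_le_of_net (hd1 : 1 ≤ d) (hd : (d : ℝ) ^ 4 ≤ n / τ ^ 2)
    (hδ0 : 0 ≤ δ) (hδ : δ < omegaN n p d q) {W : Finset (EuclideanSpace ℝ (Fin p))}
    (hnet : IsUniformNet δ S W) (hW : W.Nonempty) {b : ℝ} (hb : 1 ≤ b) :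
    |∫ x, g (minRisk ℓ R S x) ∂(Measure.pi P) - ∫ x, g (minRisk ℓ R S x) ∂(Measure.pi P')|
    ≤ K * (2 * (ε + r + D * discConst q (M / τ) * (avL q Lℓ * L ^ (bq0 q + 3) * sigmaN n p d q)
        + Real.log W.card / (n * b))
      + lindebergConst q τ M₀ M * b ^ 2 * D ^ 3
        * (avL q Lℓ * L ^ (bq0 q + 3) * sigmaN n p d q)) := by
  have hb0 : 0 < b := by linarith
  have (i : Fin n) : Fintype (κ i) := Fintype.ofFinite _
  have := hW.to_subtype
  have smoothing (P : Fin n → Measure (EuclideanSpace ℝ (Fin p))) [∀ i, IsProbabilityMeasure (P i)]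
      (hP : ∀ i, RowLaw n Q M (Cov i) (P i))
      (hind : ∀ i, iIndepFun (fun a (x : EuclideanSpace ℝ (Fin p)) (j : B i a) => x j) (P i)) :=
    abs_integral_minRisk_sub_softRisk_le hn hτ.1 hp hq (by linarith) hℓ hf hfℓ hg P hP hM
      (by omega) hB hind hL hδ0 hδ hS hnet hW hR hb0
  have comparison := abs_integral_softRisk_blocks_sub_le hn hτ hp hd1 hd hq hD hf hg P P' hP hP' hM
    hQ hM₀ hCov hB hL (pts := fun w : W => w.1) (fun w => hS (hnet.subset _ w.2)) (fun w => R w) hb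
  have smoothing_left := smoothing P hP hind
  have smoothing_right := smoothing P' hP' hind'
  rw [abs_le] at smoothing_left smoothing_right comparison ⊢
  constructor <;> linarith [smoothing_left.1, smoothing_left.2, smoothing_right.1,
    smoothing_right.2, comparison.1, comparison.2]

include hp'

lemma abs_integral_minRisk_sub_le_of_lt_one (hδ : δ ∈ Ioo 0 (omegaN n p d q)) (hne : S.Nonempty)
    (hd : 1 ≤ d) (hε : 0 ≤ ε) (hr : 0 ≤ r) (havL : 1 ≤ avL q Lℓ * L ^ (bq0 q + 3))
    (hσ : 0 < sigmaN n p d q) (hT : avL q Lℓ * L ^ (bq0 q + 3) * sigmaN n p d q < 1) :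
    |∫ x, g (minRisk ℓ R S x) ∂(Measure.pi P) - ∫ x, g (minRisk ℓ R S x) ∂(Measure.pi P')|
    ≤ K * (univConst q τ M₀ M * (ε + D ^ 3 * (r
      + (avL q Lℓ * L ^ (bq0 q + 3) * sigmaN n p d q) ^ (1 / 3 : ℝ)
        * logPlus (L / δ) ^ (2 / 3 : ℝ)))) := by
  have hl : 1 ≤ logPlus (L / δ) := le_max_left _ _
  have hσ1 : sigmaN n p d q ≤ 1 := (le_mul_of_one_le_left hσ.le havL).trans hT.le
  have hT0 : 0 < avL q Lℓ * L ^ (bq0 q + 3) * sigmaN n p d q := by positivity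
  have hδL : δ ≤ L := hδ.2.le.trans ((omegaN_le_sigmaN hn hq).trans (hσ1.trans hL))
  obtain ⟨W, hnet, hcard⟩ := exists_isUniformNet hδ.1 hδL hS
  have hW : W.Nonempty := hnet.nonempty hne
  obtain ⟨b, hb1, hb_log, hb_sq⟩ := exists_inverse_temperature hT0 hT.le hl
  have hlog := log_card_div_le hp hδ.1 hδL hW.card_pos hcard (zero_lt_one.trans_le hb1)
  rw [hb_log] at hlog
  refine (abs_integral_minRisk_sub_le_of_net hn hτ hp hq hD hℓ hf hfℓ hg P P' hP hP' hM hQ hM₀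
    hCov hB hind hind' hL hS hR hd (pow_four_le_of_sigmaN_le_one hn hτ.1 hp' hσ1) hδ.1.le hδ.2
    hnet hW hb1).trans (mul_le_mul_of_nonneg_left ?_ hg.nonneg)
  refine le_trans ?_ (total_error_le_univConst_mul hτ.1 hM₀ hM hε hr hD hT0.le
    (le_rpow_mul_rpow hT0.le hT.le hl) hb_sq)
  gcongr

lemma abs_integral_minRisk_sub_le (hδ : δ ∈ Ioo 0 (omegaN n p d q)) (hne : S.Nonempty) :
    |∫ x, g (minRisk ℓ R S x) ∂(Measure.pi P) - ∫ x, g (minRisk ℓ R S x) ∂(Measure.pi P')|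
    ≤ univConst q τ M₀ M * K * (ε + D ^ 3 * (r + avL q Lℓ ^ (1 / 3 : ℝ)
      * L ^ (((bq0 q : ℝ) + 3) / 3) * logPlus (L / δ) ^ (2 / 3 : ℝ)
      * sigmaN n p d q ^ (1 / 3 : ℝ))) := by
  obtain ⟨w₀, hw₀⟩ := hne
  have hK : 0 ≤ K := hg.nonneg
  have hε : 0 ≤ ε := (abs_nonneg _).trans (hfℓ ⟨0, hn⟩ 0)
  have hr : 0 ≤ r := (abs_nonneg _).trans
    (hR w₀ (hS hw₀) w₀ (hS hw₀) fun j => by simpa using hδ.1.le)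
  have hp0 : 0 < p := pos_of_le_natCast_div hτ.1 hp'
  have hd1 : 1 ≤ d := (hB ⟨0, hn⟩).one_le hp0
  have hσ : 0 < sigmaN n p d q := sigmaN_pos hn hp0 hd1
  have hav : 1 ≤ avL q Lℓ := one_le_avL hn hq fun i => (hf i).one_le
  have havL : 1 ≤ avL q Lℓ * L ^ (bq0 q + 3) :=
    one_le_mul_of_one_le_of_one_le hav (one_le_pow₀ hL)
  have hC := two_le_univConst (q := q) hτ.1 hM₀ hM
  rw [rpow_rate_eq (by linarith) (by linarith) hσ.le]
  rcases le_or_gt 1 (avL q Lℓ * L ^ (bq0 q + 3) * sigmaN n p d q) with hT | hT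
  · have hrate := one_le_mul_of_one_le_of_one_le
      (Real.one_le_rpow hT (by norm_num : (0 : ℝ) ≤ 1 / 3))
      (Real.one_le_rpow (le_max_left 1 (Real.log (L / δ))) (by norm_num : (0 : ℝ) ≤ 2 / 3))
    calc _ ≤ 2 * K := hg.abs_integral_comp_sub_le _ _ _ _
      _ ≤ univConst q τ M₀ M * K := by gcongr
      _ ≤ _ := le_mul_of_one_le_right (by positivity)
        (le_add_of_nonneg_of_le hε (one_le_mul_of_one_le_of_one_le (one_le_pow₀ hD)
          (le_add_of_nonneg_of_le hr hrate)))
  · rw [mul_assoc, mul_left_comm]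
    exact abs_integral_minRisk_sub_le_of_lt_one hn hτ hp' hp hq hD hℓ hf hfℓ hg P P' hP hP' hM hQ
      hM₀ hCov hB hind hind' hL hS hR hδ ⟨w₀, hw₀⟩ hd1 hε hr havL hσ hT

end ProductLaws

end MainEstimate

section SmoothStep

lemma exists_abs_iteratedDeriv_smoothTransition_le (k : ℕ) :
    ∃ A : ℝ, ∀ x, |iteratedDeriv k Real.smoothTransition x| ≤ A := by
  have continuous_deriv : Continuous (iteratedDeriv k Real.smoothTransition) :=
    (Real.smoothTransition.contDiff (n := k)).continuous_iteratedDeriv k le_rfl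
  obtain ⟨A, hA⟩ := isCompact_Icc.exists_bound_of_continuousOn (s := Icc (0 : ℝ) 1)
    continuous_deriv.continuousOn
  have le_of_const (c x : ℝ) (hc : |c| ≤ 1) (h : Real.smoothTransition =ᶠ[nhds x] fun _ => c) :
      |iteratedDeriv k Real.smoothTransition x| ≤ max A 1 := by
    rw [(h.iteratedDeriv k).eq_of_nhds, iteratedDeriv_const]
    split_ifs
    · exact hc.trans (le_max_right _ _)
    · simp
  refine ⟨max A 1, fun x => ?_⟩
  rcases lt_or_ge x 0 with hx0 | hx0
  · refine le_of_const 0 x (by simp) ?_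
    filter_upwards [gt_mem_nhds hx0] with y hy using Real.smoothTransition.zero_of_nonpos hy.le
  rcases lt_or_ge 1 x with hx1 | hx1
  · refine le_of_const 1 x (by simp) ?_
    filter_upwards [lt_mem_nhds hx1] with y hy using Real.smoothTransition.one_of_one_le hy.le
  · exact (hA x ⟨hx0, hx1⟩).trans (le_max_left _ _)

lemma exists_forall_abs_iteratedDeriv_smoothTransition_le (m : ℕ) :
    ∃ A : ℝ, ∀ (k : Fin m) (x : ℝ), |iteratedDeriv k Real.smoothTransition x| ≤ A := by
  choose A hA using exists_abs_iteratedDeriv_smoothTransition_le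
  obtain ⟨A', hA'⟩ := (finite_range fun k : Fin m => A k).bddAbove
  exact ⟨A', fun k x => (hA k x).trans (hA' ⟨k, rfl⟩)⟩

/-- A smooth step from `0` on `(-∞, z + ε]` to `1` on `[z + 3 * ε, ∞)`, the test function that turns
comparisons of expectations into comparisons of tails. -/
noncomputable def smoothStep (z ε x : ℝ) : ℝ :=
  Real.smoothTransition ((2 * ε)⁻¹ * (x - (z + ε)))

lemma contDiff_smoothStep (z ε : ℝ) : ContDiff ℝ 3 (smoothStep z ε) :=
  (Real.smoothTransition.contDiff (n := 3)).comp (by fun_prop)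

lemma smoothStep_mem_Icc (z ε x : ℝ) : smoothStep z ε x ∈ Icc (0 : ℝ) 1 :=
  ⟨Real.smoothTransition.nonneg _, Real.smoothTransition.le_one _⟩

lemma smoothStep_eq_zero {z ε x : ℝ} (hε : 0 ≤ ε) (h : x ≤ z + ε) : smoothStep z ε x = 0 :=
  Real.smoothTransition.zero_of_nonpos
    (mul_nonpos_of_nonneg_of_nonpos (by positivity) (by linarith))

lemma smoothStep_eq_one {z ε x : ℝ} (hε : 0 < ε) (h : z + 3 * ε ≤ x) : smoothStep z ε x = 1 := by
  refine Real.smoothTransition.one_of_one_le ?_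
  rw [inv_mul_eq_div, one_le_div (by positivity)]
  linarith

lemma iteratedDeriv_smoothStep (k : ℕ) (z ε x : ℝ) :
    iteratedDeriv k (smoothStep z ε) x = ((2 * ε)⁻¹) ^ k
      * iteratedDeriv k Real.smoothTransition ((2 * ε)⁻¹ * (x - (z + ε))) := by
  have shift := iteratedDeriv_comp_sub_const k
    (fun y => Real.smoothTransition ((2 * ε)⁻¹ * y)) (z + ε)
  rw [iteratedDeriv_comp_const_mul (Real.smoothTransition.contDiff (n := k)) (2 * ε)⁻¹] at shift
  exact congrFun shift x

lemma inv_two_mul_pow_le_max {ε : ℝ} (hε : 0 < ε) {k m : ℕ} (hk : k ≤ m) :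
    ((2 * ε)⁻¹) ^ k ≤ max 1 (ε ^ (-m : ℤ)) := by
  have hε2 : (2 * ε)⁻¹ ≤ ε⁻¹ := inv_anti₀ hε (by linarith)
  refine (pow_le_pow_left₀ (by positivity) hε2 _).trans ?_
  rw [zpow_neg, zpow_natCast, ← inv_pow]
  rcases le_or_gt ε⁻¹ 1 with h | h
  · exact (pow_le_one₀ (by positivity) h).trans (le_max_left _ _)
  · exact (pow_le_pow_right₀ h.le hk).trans (le_max_right _ _)

lemma Kg_smoothStep_le {A : ℝ}
    (hA : ∀ (k : Fin 4) (x : ℝ), |iteratedDeriv k Real.smoothTransition x| ≤ A) (z : ℝ) {ε : ℝ}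
    (hε : 0 < ε) : Kg (smoothStep z ε) ≤ ENNReal.ofReal ((1 + A) * max 1 (ε ^ (-3 : ℤ))) := by
  have hA0 : 0 ≤ A := (abs_nonneg _).trans (hA 0 0)
  rw [Kg, one_add_mul, ENNReal.ofReal_add (by positivity) (by positivity)]
  refine add_le_add (by simp)
    (iSup₂_le fun k x => ENNReal.ofReal_le_ofReal ?_)
  rw [iteratedDeriv_smoothStep, abs_mul, abs_of_nonneg (by positivity), mul_comm]
  exact mul_le_mul (hA k _) (inv_two_mul_pow_le_max hε (Nat.le_of_lt_succ k.2)) (by positivity) hA0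

variable {Ω Ω' : Type*} [MeasurableSpace Ω] [MeasurableSpace Ω'] {μ : Measure Ω} {ν : Measure Ω'}
  [IsProbabilityMeasure μ] [IsProbabilityMeasure ν] {U : Ω → ℝ} {V : Ω' → ℝ}

lemma ofReal_integral_smoothStep (hU : AEMeasurable U μ) (z ε : ℝ) :
    ENNReal.ofReal (∫ ω, smoothStep z ε (U ω) ∂μ)
      = ∫⁻ ω, ENNReal.ofReal (smoothStep z ε (U ω)) ∂μ := by
  refine ofReal_integral_eq_lintegral_ofReal ?_
    (Filter.Eventually.of_forall fun ω => (smoothStep_mem_Icc z ε _).1)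
  refine Integrable.of_bound ((contDiff_smoothStep z ε).continuous.measurable.comp_aemeasurable
    hU).aestronglyMeasurable 1 (Filter.Eventually.of_forall fun ω => ?_)
  rw [Real.norm_of_nonneg (smoothStep_mem_Icc z ε _).1]
  exact (smoothStep_mem_Icc z ε _).2

lemma measure_lt_le_ofReal_integral_smoothStep (hU : AEMeasurable U μ) (z : ℝ) {ε : ℝ}
    (hε : 0 < ε) :
    μ {ω | z + 3 * ε < U ω} ≤ ENNReal.ofReal (∫ ω, smoothStep z ε (U ω) ∂μ) := by
  rw [ofReal_integral_smoothStep hU]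
  have markov := mul_meas_ge_le_lintegral₀ (μ := μ)
    (f := fun ω => ENNReal.ofReal (smoothStep z ε (U ω)))
    ((contDiff_smoothStep z ε).continuous.measurable.comp_aemeasurable hU).ennreal_ofReal 1
  rw [one_mul] at markov
  refine (measure_mono fun ω hω => ?_).trans markov
  rw [mem_ofPred_eq] at hω ⊢
  rw [smoothStep_eq_one hε hω.le, ENNReal.ofReal_one]

lemma ofReal_integral_smoothStep_le_measure_lt (hU : AEMeasurable U μ) (z : ℝ) {ε : ℝ}
    (hε : 0 ≤ ε) :
    ENNReal.ofReal (∫ ω, smoothStep z ε (U ω) ∂μ) ≤ μ {ω | z + ε < U ω} := by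
  rw [ofReal_integral_smoothStep hU]
  refine (lintegral_mono fun ω => ?_).trans (lintegral_indicator_one_le {ω | z + ε < U ω})
  by_cases h : z + ε < U ω
  · simpa [indicator, h] using (smoothStep_mem_Icc z ε (U ω)).2
  · simp [smoothStep_eq_zero hε (not_lt.1 h)]

lemma measure_lt_le_add_ofReal_abs_sub (hU : AEMeasurable U μ) (hV : AEMeasurable V ν) (z : ℝ)
    {ε : ℝ} (hε : 0 < ε) :
    μ {ω | z + 3 * ε < U ω} ≤ ν {ω | z + ε < V ω}
      + ENNReal.ofReal |∫ ω, smoothStep z ε (U ω) ∂μ - ∫ ω, smoothStep z ε (V ω) ∂ν| := by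
  set EU := ∫ ω, smoothStep z ε (U ω) ∂μ
  set EV := ∫ ω, smoothStep z ε (V ω) ∂ν
  calc μ {ω | z + 3 * ε < U ω} ≤ ENNReal.ofReal EU :=
        measure_lt_le_ofReal_integral_smoothStep hU z hε
    _ ≤ ENNReal.ofReal (EV + |EU - EV|) :=
        ENNReal.ofReal_le_ofReal (by linarith [le_abs_self (EU - EV)])
    _ ≤ ENNReal.ofReal EV + ENNReal.ofReal |EU - EV| := ENNReal.ofReal_add_le
    _ ≤ ν {ω | z + ε < V ω} + ENNReal.ofReal |EU - EV| := by
        gcongr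
        exact ofReal_integral_smoothStep_le_measure_lt hV z hε.le

end SmoothStep

section Rate

variable {n p d : ℕ} {q : Fin 4 → ℝ} {ρbar : ℝ} {Lℓ : Fin n → ℝ} {Dl Ml : ℝ → ℝ}
  {R : EuclideanSpace ℝ (Fin p) → ℝ} {L : ℝ}

lemma le_mul_rateR {a c : ℝ≥0∞} (hc0 : c ≠ 0) (hc : c ≠ ⊤) (hD : ∀ ρ ∈ Ioo 0 ρbar, 0 < Dl ρ)
    (h : ∀ ρ ∈ Ioo 0 ρbar, ∀ δ ∈ Ioo 0 (omegaN n p d q),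
      a ≤ c * (ENNReal.ofReal (Ml ρ) + ENNReal.ofReal (Dl ρ ^ 3) * (modR R L δ +
        ENNReal.ofReal (avL q Lℓ ^ (1 / 3 : ℝ) * L ^ (((bq0 q : ℝ) + 3) / 3)
          * logPlus (L / δ) ^ (2 / 3 : ℝ) * sigmaN n p d q ^ (1 / 3 : ℝ))))) :
    a ≤ c * rateR d q ρbar Lℓ Dl Ml R L := by
  rw [rateR, ENNReal.mul_iInf_of_ne hc0 hc]
  refine le_iInf fun ρ => ?_
  rw [ENNReal.mul_iInf_of_ne hc0 hc]
  refine le_iInf fun hρ => ?_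
  have hD0 : ENNReal.ofReal (Dl ρ ^ 3) ≠ 0 := by
    have := hD ρ hρ
    rw [Ne, ENNReal.ofReal_eq_zero, not_le]
    positivity
  rw [ENNReal.mul_iInf_of_ne hD0 ENNReal.ofReal_ne_top, ENNReal.add_iInf,
    ENNReal.mul_iInf_of_ne hc0 hc]
  refine le_iInf fun δ => ?_
  rw [ENNReal.mul_iInf_of_ne hD0 ENNReal.ofReal_ne_top, ENNReal.add_iInf,
    ENNReal.mul_iInf_of_ne hc0 hc]
  exact le_iInf fun hδ => h ρ hρ δ hδ

lemma rateR_ne_zero (hn : 0 < n) (hp : 0 < p) (hd : 0 < d) (hq : ∀ k, 0 ≤ q k)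
    (hLℓ : ∀ i, 1 ≤ Lℓ i) (hD : ∀ ρ ∈ Ioo 0 ρbar, 1 ≤ Dl ρ) (hL : 0 < L) :
    rateR d q ρbar Lℓ Dl Ml R L ≠ 0 := by
  have hσ := sigmaN_pos (q := q) hn hp hd
  have hav := one_le_avL hn hq hLℓ
  set lower := avL q Lℓ ^ (1 / 3 : ℝ) * L ^ (((bq0 q : ℝ) + 3) / 3) * sigmaN n p d q ^ (1 / 3 : ℝ)
  have lower_pos : 0 < lower := by positivity
  have lower_le : ENNReal.ofReal lower ≤ 1 * rateR d q ρbar Lℓ Dl Ml R L := by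
    refine le_mul_rateR one_ne_zero ENNReal.one_ne_top
      (fun ρ hρ => zero_lt_one.trans_le (hD ρ hρ)) fun ρ hρ δ _ => ?_
    have hD1 : 1 ≤ ENNReal.ofReal (Dl ρ ^ 3) := by
      rw [ENNReal.one_le_ofReal]
      exact one_le_pow₀ (hD ρ hρ)
    rw [one_mul]
    refine le_add_of_le_right (le_trans (le_add_of_le_right (ENNReal.ofReal_le_ofReal ?_))
      (le_mul_of_one_le_left zero_le hD1))
    exact mul_le_mul_of_nonneg_right (le_mul_of_one_le_right (by positivity)
      (Real.one_le_rpow (le_max_left _ _) (by norm_num))) (by positivity)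
  rw [one_mul] at lower_le
  exact ((ENNReal.ofReal_pos.2 lower_pos).trans_le lower_le).ne'

lemma LossAssumption.exists_smoothedLoss {ℓ : Fin n → ℝ → ℝ}
    (h : LossAssumption q ρbar Lℓ Dl Ml ℓ) {ρ : ℝ} (hρ : ρ ∈ Ioo 0 ρbar) :
    ∃ f : Fin n → ℝ → ℝ, (∀ i, SmoothedLoss q (Lℓ i) (Dl ρ) (f i)) ∧
      ∀ i x, |f i x - ℓ i x| ≤ Ml ρ := by
  obtain ⟨ℓs, hs⟩ := h.approx
  refine ⟨ℓs ρ, fun i => ?_, fun i => (hs ρ hρ i).2.2.1⟩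
  obtain ⟨nonneg, contDiff, approx, deriv_le⟩ := hs ρ hρ i
  exact smoothedLoss_of_abs_sub_le (h.q_nonneg 0) (h.one_le_Lℓ i) (h.Ml_mem ρ hρ).2 (h.growth i)
    nonneg contDiff approx deriv_le

lemma abs_sub_le_modR {δ : ℝ} (h : modR R L δ ≠ ⊤) {w w' : EuclideanSpace ℝ (Fin p)}
    (hw : w ∈ cube p L) (hw' : w' ∈ cube p L) (hd : ∀ j, |w j - w' j| ≤ δ) :
    |R w - R w'| ≤ (modR R L δ).toReal := by
  rw [← ENNReal.ofReal_le_iff_le_toReal h]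
  exact le_iSup₂_of_le w hw (le_iSup₂_of_le w' hw' (le_iSup_of_le hd le_rfl))

lemma bq0_add_three_le_qStar (q : Fin 4 → ℝ) : bq0 q + 3 ≤ qStar q := by
  unfold qStar bq0
  set J := ⌈q 0 * bq q / 2⌉₊
  have half : (2 * J + 4) / 2 = J + 2 := by omega
  have : J + 1 ≤ 2 ^ J := Nat.lt_two_pow_self
  rw [half, pow_add]
  omega

end Rate

section Universality

variable {n p d : ℕ} {q : Fin 4 → ℝ} {τ M₀ M ρbar L : ℝ} {Lℓ : Fin n → ℝ} {Dl Ml : ℝ → ℝ}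
  {ℓ : Fin n → ℝ → ℝ} {R : EuclideanSpace ℝ (Fin p) → ℝ} {S : Set (EuclideanSpace ℝ (Fin p))}
  {κ : Fin n → Type*} [∀ i, Finite (κ i)] {B : ∀ i, κ i → Finset (Fin p)}
  {Cov : Fin n → Matrix (Fin p) (Fin p) ℝ}
  {Ω Ω' : Type*} [MeasurableSpace Ω] [MeasurableSpace Ω'] {μ : Measure Ω} {ν : Measure Ω'}
  {X : Fin n → Ω → EuclideanSpace ℝ (Fin p)} {Y : Fin n → Ω' → EuclideanSpace ℝ (Fin p)}
  (hτ : τ ∈ Ioo (0 : ℝ) 1) (hM₀ : 0 ≤ M₀) (hM : 0 ≤ M) (hn : 0 < n) (hp' : τ ≤ (p : ℝ) / n)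
  (hp : (p : ℝ) / n ≤ 1 / τ) (hℓ : ∀ i, Continuous (ℓ i))
  (hloss : LossAssumption q ρbar Lℓ Dl Ml ℓ) (hB : ∀ i, IsBlockPartition d (B i))
  (hCov : ∀ i, ∀ x : Fin p → ℝ, ∑ j, ∑ k, x j * x k * Cov i j k ≤ M₀ * ∑ j, x j ^ 2)
  (hX : BlockDesign (bq0 q + 3) M Cov B X μ) (hY : BlockDesign (bq0 q + 3) M Cov B Y ν)
  (hL : 1 ≤ L) (hne : S.Nonempty) (hS : S ⊆ cube p L)

include hτ hM₀ hM hn hp' hp hℓ hloss hB hCov hX hY hL hne hS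

lemma ofReal_abs_integral_minRisk_sub_le_of_mem {g : ℝ → ℝ} (hg : ContDiff ℝ 3 g)
    (hK : Kg g ≠ ⊤) {ρ δ : ℝ} (hρ : ρ ∈ Ioo 0 ρbar) (hδ : δ ∈ Ioo 0 (omegaN n p d q)) :
    ENNReal.ofReal |∫ ω, g (minRisk ℓ R S (fun i => X i ω)) ∂μ
        - ∫ ω, g (minRisk ℓ R S (fun i => Y i ω)) ∂ν|
      ≤ ENNReal.ofReal (univConst q τ M₀ M) * Kg g
        * (ENNReal.ofReal (Ml ρ) + ENNReal.ofReal (Dl ρ ^ 3) * (modR R L δ +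
          ENNReal.ofReal (avL q Lℓ ^ (1 / 3 : ℝ) * L ^ (((bq0 q : ℝ) + 3) / 3)
            * logPlus (L / δ) ^ (2 / 3 : ℝ) * sigmaN n p d q ^ (1 / 3 : ℝ)))) := by
  have hC : 0 < univConst q τ M₀ M := zero_lt_two.trans_le (two_le_univConst hτ.1 hM₀ hM)
  have hK1 : Kg g ≠ 0 := (zero_lt_one.trans_le le_self_add).ne'
  have hD := hloss.one_le_Dl ρ hρ
  by_cases hm : modR R L δ = ⊤
  · rw [hm, top_add, ENNReal.mul_top (by simpa using by positivity), add_top,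
      ENNReal.mul_top (mul_ne_zero (by simpa using hC) hK1)]
    exact le_top
  obtain ⟨f, hf, hfℓ⟩ := hloss.exists_smoothedLoss hρ
  have := hX.isProbabilityMeasure_map
  have := hY.isProbabilityMeasure_map
  have hgm : Measurable fun x => g (minRisk ℓ R S x) :=
    hg.continuous.measurable.comp (measurable_minRisk hℓ R hS)
  have bound := abs_integral_minRisk_sub_le hn hτ hp' hp hloss.q_nonneg hD hℓ hf hfℓ
    (boundedDerivs_of_Kg hg hK) _ _ hX.rowLaw hY.rowLaw hM le_rfl hM₀ hCov hB hX.blocks hY.blocks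
    hL hS (fun w hw w' hw' hd => abs_sub_le_modR hm hw hw' hd) hδ hne
  rw [integral_comp_eq_integral_pi hX.aemeasurable hX.iIndepFun hgm,
    integral_comp_eq_integral_pi hY.aemeasurable hY.iIndepFun hgm]
  refine (ENNReal.ofReal_le_ofReal bound).trans_eq ?_
  have hσ : 0 ≤ sigmaN n p d q := sigmaN_nonneg n p d q
  have hav : 1 ≤ avL q Lℓ := one_le_avL hn hloss.q_nonneg hloss.one_le_Lℓ
  have hlog : 1 ≤ logPlus (L / δ) := le_max_left _ _
  rw [ENNReal.ofReal_mul (by positivity), ENNReal.ofReal_mul hC.le, ENNReal.ofReal_toReal hK,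
    ENNReal.ofReal_add (hloss.Ml_mem ρ hρ).1 (by positivity), ENNReal.ofReal_mul (by positivity),
    ENNReal.ofReal_add ENNReal.toReal_nonneg (by positivity), ENNReal.ofReal_toReal hm]

lemma ofReal_abs_integral_minRisk_sub_le {g : ℝ → ℝ} (hg : ContDiff ℝ 3 g) :
    ENNReal.ofReal |∫ ω, g (minRisk ℓ R S (fun i => X i ω)) ∂μ
        - ∫ ω, g (minRisk ℓ R S (fun i => Y i ω)) ∂ν|
      ≤ ENNReal.ofReal (univConst q τ M₀ M) * Kg g * rateR d q ρbar Lℓ Dl Ml R L := by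
  have hC : ENNReal.ofReal (univConst q τ M₀ M) ≠ 0 := by
    simpa using zero_lt_two.trans_le (two_le_univConst hτ.1 hM₀ hM)
  have hK1 : Kg g ≠ 0 := (zero_lt_one.trans_le le_self_add).ne'
  by_cases hK : Kg g = ⊤
  · have hp0 : 0 < p := pos_of_le_natCast_div hτ.1 hp'
    rw [hK, ENNReal.mul_top hC, ENNReal.top_mul (rateR_ne_zero hn hp0 ((hB ⟨0, hn⟩).one_le hp0)
      hloss.q_nonneg hloss.one_le_Lℓ hloss.one_le_Dl (by linarith))]
    exact le_top
  · exact le_mul_rateR (mul_ne_zero hC hK1) (ENNReal.mul_ne_top ENNReal.ofReal_ne_top hK)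
      (fun ρ hρ => zero_lt_one.trans_le (hloss.one_le_Dl ρ hρ)) fun ρ hρ δ hδ =>
        ofReal_abs_integral_minRisk_sub_le_of_mem hτ hM₀ hM hn hp' hp hℓ hloss hB hCov hX hY hL hne
          hS hg hK hρ hδ

lemma measure_lt_minRisk_le {A : ℝ}
    (hA : ∀ (k : Fin 4) (x : ℝ), |iteratedDeriv k Real.smoothTransition x| ≤ A) (z : ℝ) {ε : ℝ}
    (hε : 0 < ε) :
    μ {ω | z + 3 * ε < minRisk ℓ R S (fun i => X i ω)}
      ≤ ν {ω | z + ε < minRisk ℓ R S (fun i => Y i ω)}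
        + ENNReal.ofReal ((1 + A) * univConst q τ M₀ M * max 1 (ε ^ (-3 : ℤ)))
          * rateR d q ρbar Lℓ Dl Ml R L := by
  have hC : 0 ≤ univConst q τ M₀ M := (two_le_univConst hτ.1 hM₀ hM).trans' zero_le_two
  have := hX.iIndepFun.isProbabilityMeasure
  have := hY.iIndepFun.isProbabilityMeasure
  have hmin := measurable_minRisk hℓ R hS
  refine (measure_lt_le_add_ofReal_abs_sub
    (hmin.comp_aemeasurable (aemeasurable_pi_lambda _ hX.aemeasurable))
    (hmin.comp_aemeasurable (aemeasurable_pi_lambda _ hY.aemeasurable)) z hε).trans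
    (add_le_add_right ?_ _)
  refine (ofReal_abs_integral_minRisk_sub_le hτ hM₀ hM hn hp' hp hℓ hloss hB hCov hX hY hL hne hS
    (contDiff_smoothStep z ε)).trans ?_
  rw [mul_comm (1 + A), mul_assoc (univConst q τ M₀ M), ENNReal.ofReal_mul hC]
  gcongr
  exact Kg_smoothStep_le hA z hε

end Universality

theorem theorem1_general :
    ∃ c : ℝ, 0 < c ∧
    ∀ (τ : ℝ) (q : Fin 4 → ℝ) (M₀ M : ℝ), τ ∈ Ioo (0 : ℝ) 1 → 0 ≤ M₀ → 0 ≤ M →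
    ∃ C₀ : ℝ, 0 < C₀ ∧ ∀ (n p d : ℕ),
    0 < n → τ ≤ (p : ℝ) / n → (p : ℝ) / n ≤ 1 / τ →
    ∀ (ℓ : Fin n → ℝ → ℝ) (R : EuclideanSpace ℝ (Fin p) → ℝ)
      (ρbar : ℝ) (Lℓ : Fin n → ℝ) (Dl Ml : ℝ → ℝ),
    (∀ i, Continuous (ℓ i)) →
    LossAssumption q ρbar Lℓ Dl Ml ℓ →
    ∀ (κ : Fin n → Type*) [∀ i, Finite (κ i)] (B : ∀ i, κ i → Finset (Fin p)),
    (∀ i, IsBlockPartition d (B i)) →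
    ∀ Cov : Fin n → Matrix (Fin p) (Fin p) ℝ,
    (∀ i, ∀ x : Fin p → ℝ, ∑ j, ∑ k, x j * x k * Cov i j k ≤ M₀ * ∑ j, x j ^ 2) →
    ∀ (Ω : Type*) [MeasurableSpace Ω] (μ : Measure Ω) (X : Fin n → Ω → EuclideanSpace ℝ (Fin p)),
    BlockDesign (bq0 q + 3) M Cov B X μ →
    ∀ (Ω' : Type*) [MeasurableSpace Ω'] (ν : Measure Ω')
      (Y : Fin n → Ω' → EuclideanSpace ℝ (Fin p)),
    BlockDesign (bq0 q + 3) M Cov B Y ν →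
    ∀ (L : ℝ) (S : Set (EuclideanSpace ℝ (Fin p))), 1 ≤ L → S.Nonempty → S ⊆ cube p L →
    (∀ g : ℝ → ℝ, ContDiff ℝ 3 g →
      ENNReal.ofReal
          |(∫ ω, g (minRisk ℓ R S (fun i => X i ω)) ∂μ)
            - ∫ ω, g (minRisk ℓ R S (fun i => Y i ω)) ∂ν|
        ≤ ENNReal.ofReal C₀ * Kg g * rateR d q ρbar Lℓ Dl Ml R L) ∧
    (∀ z ε : ℝ, 0 < ε →
      μ {ω | z + 3 * ε < minRisk ℓ R S (fun i => X i ω)}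
          ≤ ν {ω | z + ε < minRisk ℓ R S (fun i => Y i ω)}
            + ENNReal.ofReal (c * C₀ * max 1 (ε ^ (-3 : ℤ)))
              * rateR d q ρbar Lℓ Dl Ml R L ∧
      ν {ω | z + 3 * ε < minRisk ℓ R S (fun i => Y i ω)}
          ≤ μ {ω | z + ε < minRisk ℓ R S (fun i => X i ω)}
            + ENNReal.ofReal (c * C₀ * max 1 (ε ^ (-3 : ℤ)))
              * rateR d q ρbar Lℓ Dl Ml R L) := by
  obtain ⟨A, hA⟩ := exists_forall_abs_iteratedDeriv_smoothTransition_le 4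
  have hA0 : 0 ≤ A := (abs_nonneg _).trans (hA 0 0)
  refine ⟨1 + A, by positivity, fun τ q M₀ M hτ hM₀ hM => ⟨univConst q τ M₀ M,
    zero_lt_two.trans_le (two_le_univConst hτ.1 hM₀ hM), ?_⟩⟩
  intro n p d hn hp' hp ℓ R ρbar Lℓ Dl Ml hℓ hloss κ _ B hB Cov hCov Ω _ μ X hX Ω' _ ν Y hY L S hL
    hne hS
  exact ⟨fun g hg => ofReal_abs_integral_minRisk_sub_le hτ hM₀ hM hn hp' hp hℓ hloss hB hCov hX hY
      hL hne hS hg,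
    fun z ε hε => ⟨measure_lt_minRisk_le hτ hM₀ hM hn hp' hp hℓ hloss hB hCov hX hY hL hne hS hA z
        hε,
      measure_lt_minRisk_le hτ hM₀ hM hn hp' hp hℓ hloss hB hCov hY hX hL hne hS hA z hε⟩⟩

theorem theorem1 :
    -- `c` is the absolute factor in `C₁ = c * C₀`
    ∃ c : ℝ, 0 < c ∧
    ∀ (τ : ℝ) (q : Fin 4 → ℝ) (M : ℝ), τ ∈ Ioo (0 : ℝ) 1 →
    ∃ C₀ : ℝ, 0 < C₀ ∧ ∃ n₀ : ℕ, ∀ (n p d : ℕ), n₀ ≤ n →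
    -- proportional dimensions
    0 < n → τ ≤ (p : ℝ) / n → (p : ℝ) / n ≤ 1 / τ →
    -- losses and regularizer
    ∀ (ℓ : Fin n → ℝ → ℝ) (R : EuclideanSpace ℝ (Fin p) → ℝ)
      (ρbar : ℝ) (Lℓ : Fin n → ℝ) (Dl Ml : ℝ → ℝ),
    (∀ i, Continuous (ℓ i)) →
    LossAssumption q ρbar Lℓ Dl Ml ℓ →
    -- i.i.d. centred covariates with covariance `Cov / n`, moment bounds, block dependence
    ∀ (Cov : Matrix (Fin p) (Fin p) ℝ) (hCov : Cov.PosDef),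
    (∀ k, hCov.isHermitian.eigenvalues k ≤ M) →
    ∀ (Ω : Type*) [MeasurableSpace Ω] (μ : Measure Ω) [IsProbabilityMeasure μ]
      (X : Fin n → Ω → EuclideanSpace ℝ (Fin p)),
    iIndepFun X μ →
    (∀ i i', IdentDistrib (X i) (X i') μ μ) →
    (∀ i j, ∫ ω, X i ω j ∂μ = 0) →
    (∀ i j k, ∫ ω, X i ω j * X i ω k ∂μ = Cov j k / n) →
    (∀ i j, eLpNorm (fun ω => √(n : ℝ) * X i ω j) (qStar q) μ ≤ ENNReal.ofReal M) →
    (∀ i, BlockDependent d (X i) μ) →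
    -- i.i.d. Gaussian vectors with the same covariance
    ∀ (Ω' : Type*) [MeasurableSpace Ω'] (ν : Measure Ω') [IsProbabilityMeasure ν]
      (G : Fin n → Ω' → EuclideanSpace ℝ (Fin p)),
    iIndepFun G ν →
    (∀ i, HasLaw (G i) (multivariateGaussian 0 ((1 / (n : ℝ)) • Cov)) ν) →
    ∀ (L : ℝ) (S : Set (EuclideanSpace ℝ (Fin p))), 1 ≤ L → S.Nonempty → S ⊆ cube p L →
    (∀ g : ℝ → ℝ, ContDiff ℝ 3 g →
      ENNReal.ofReal
          |(∫ ω, g (minRisk ℓ R S (fun i => X i ω)) ∂μ)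
            - ∫ ω, g (minRisk ℓ R S (fun i => G i ω)) ∂ν|
        ≤ ENNReal.ofReal C₀ * Kg g * rateR d q ρbar Lℓ Dl Ml R L) ∧
    (∀ z ε : ℝ, 0 < ε →
      μ {ω | z + 3 * ε < minRisk ℓ R S (fun i => X i ω)}
          ≤ ν {ω | z + ε < minRisk ℓ R S (fun i => G i ω)}
            + ENNReal.ofReal (c * C₀ * max 1 (ε ^ (-3 : ℤ)))
              * rateR d q ρbar Lℓ Dl Ml R L ∧
      ν {ω | z + 3 * ε < minRisk ℓ R S (fun i => G i ω)}
          ≤ μ {ω | z + ε < minRisk ℓ R S (fun i => X i ω)}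
            + ENNReal.ofReal (c * C₀ * max 1 (ε ^ (-3 : ℤ)))
              * rateR d q ρbar Lℓ Dl Ml R L) := by
  obtain ⟨c, hc, general⟩ := theorem1_general
  refine ⟨c, hc, fun τ q M hτ => ?_⟩
  have hγ : 0 ≤ √(max M 0) * gaussianNorm (qStar q) :=
    mul_nonneg (Real.sqrt_nonneg _) (gaussianNorm_nonneg _)
  obtain ⟨C₀, hC₀, bounds⟩ := general τ q (max M 0)
    (max M (√(max M 0) * gaussianNorm (qStar q))) hτ (le_max_right _ _) (le_max_of_le_right hγ)
  refine ⟨C₀, hC₀, 0, ?_⟩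
  intro n p d _ hn hp' hp ℓ R ρbar Lℓ Dl Ml hℓ hloss Cov hCov heig Ω _ μ _ X hX hid hmean hcov hmom
    hblock Ω' _ ν _ G hG hlaw L S
  have quad_le := quadForm_le_of_eigenvalues_le hCov.isHermitian fun k =>
    (heig k).trans (le_max_left M 0)
  obtain ⟨κ, B, hB, designX⟩ := exists_blockDesign_of_blockDependent (Cov := fun _ => Cov)
    (fun i => (hid i i).aemeasurable_fst) hX hmean hcov hmom hblock
  have designG := designX.of_multivariateGaussian hn hG hlaw (fun _ => hCov.posSemidef)
    fun _ => quad_le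
  exact bounds n p d hn hp' hp ℓ R ρbar Lℓ Dl Ml hℓ hloss _ B hB _ (fun _ => quad_le)
    Ω μ X (designX.mono (bq0_add_three_le_qStar q) (le_max_left _ _))
    Ω' ν G (designG.mono (bq0_add_three_le_qStar q) (le_max_right _ _)) L S
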